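/- **Definitions.** A (nondeterministic) branching program $P$ of width $W$ and length $T$ on $n$ Boolean variables has $T$ layers of $W$ nodes; all nodes of layer $i<T$ query the same variable $x_{f(i)}$; edges go from layer $i$ to layer $i+1$ and are marked $0$ or $1$; $P$ accepts $x$ iff there is a path from the first node of layer $1$ to the first node of layer $T$ along edges marked with the value of the variable queried at their source. BP-Satisfying-Pair: given $P$ on $n=2h$ variables and two families $A,B$ of $N\ge 1$ strings in $\{0,1\}^{h}$, is there $(a,b)\in A\times B$ such that $P$ accepts the concatenation $ab$? For even $t$ and $u,v\in\{0,1\}^{2\times\cdots\times 2}$ ($t$ dimensions, size $D=2^t$) the tropical similarity is $$s(u,v)=\mathop{\mathbb E}_{i_1}\max_{i_2}\mathop{\mathbb E}_{i_3}\cdots\max_{i_t}\,(u_i\cdot v_i).$$ Gap-Max-TropSim with threshold $\epsilon$: given two families of $N$ such tensors, distinguish "some pair has $s=1$" from "every pair has $s<\epsilon$". Gap-Min-TropSim with threshold $\epsilon$: distinguish "some pair has $s<\epsilon$" from "every pair has $s=1$". An IP protocol between Merlin, Alice (holding $a$) and Bob (holding $b$): Alice tosses public coins, interleaved with bits sent by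 Merlin according to a fixed schedule; then Bob, who knows $b$ and the public coins, sends a message to Alice; then Alice accepts or rejects according to $a$, the transcript and Bob's message. Logarithms are to base $2$. For $W,T\ge2$ and $0<\epsilon\le1$ put $$q=1+\log\log W+\log\log T+\log\epsilon^{-1},\qquad K=\log^2 W\,\log^2 T\cdot q .$$ **Theorem.** There are a constant $C$ and a word-RAM program $M$ such that for all $W,T\ge 2$, all branching programs $P$ of width $W$ and length $T$ on $2h$ variables, and all thresholds $0<\epsilon\le 1$ (which thus may depend on $N$), there are an even $t$ with $D=2^t\le 2^{C K}$, maps $G,H$ from $\{0,1\}^h$ to the $t$-dimensional binary tensors, and an IP protocol with the following properties. 1. For all $N\ge1$ and all families $A,B$ of $N$ strings in $\{0,1\}^h$, the program $M$, given $P,A,B$ and $\lceil\log\epsilon^{-1}\rceil$, outputs $t$ and the families of $N$ tensors $A'=(G(a))_{a\in A}$ and $B'=(H(b))_{b\in B}$ in at most $C\cdot N\cdot D^{C}$ steps, using words of $O(\log(\text{input size})+\log D)$ bits. 2. If some pair in $A\times B$ is accepted by $P$, then some pair in $A'\times B'$ has tropical similarity $1$; otherwise every pair in $A'\times B'$ has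 tropical similarity $<\epsilon$. So BP-Satisfying-Pair reduces in time $O(N\operatorname{poly}(D))$ to Gap-Max-TropSim with threshold $\epsilon$ on tensors of size $D=2^{O(K)}$. 3. The protocol checks whether $P$ accepts the concatenation of $a$ and $b$, with perfect completeness and soundness error at most $\epsilon$; Merlin sends at most $C K$ bits, Alice tosses at most $C K$ public coins, and Bob sends at most $C q$ bits. For all $a,b\in\{0,1\}^h$, the tropical similarity $s(G(a),H(b))$ equals the maximum, over all strategies of Merlin, of the probability that Alice accepts on $(a,b)$. The same holds for Gap-Min-TropSim (with another constant, program, tensors and protocol): with property 2 replaced by "if some pair in $A\times B$ is accepted by $P$, then some pair in $A'\times B'$ has tropical similarity $<\epsilon$; otherwise every pair in $A'\times B'$ has tropical similarity $1$", and with the protocol of property 3 checking that $P$ does *not* accept the concatenation of $a$ and $b$. -/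

import Mathlib

/-! ## Branching programs -/

/-- A (nondeterministic) branching program of width `W` and length `T` on `n` Boolean inputs: `T`
layers with `W` nodes each.  All nodes of the (non-final) layer `i` query the variable `var i`, and
`edge i u v b = true` means that there is an edge marked `b` from node `u` of layer `i` to node `v`
of layer `i + 1` (layers and nodes are counted from `0`). -/
structure BranchingProgram (W T n : ℕ) where
  var : Fin (T - 1) → Fin n
  edge : Fin (T - 1) → Fin W → Fin W → Bool → Bool

/-- `P` accepts `x` iff some path from the first node of the first layer to the first node of the
last layer uses only edges marked with the value of the variable queried by their source. -/
def BranchingProgram.Accepts {W T n : ℕ} (P : BranchingProgram W T n) (x : Fin n → Bool) : Prop :=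
  ∃ p : Fin T → Fin W,
    (∀ i : Fin T, ((i : ℕ) = 0 ∨ (i : ℕ) + 1 = T) → (p i : ℕ) = 0) ∧
    ∀ i : Fin (T - 1),
      P.edge i (p ⟨i, by omega⟩) (p ⟨i + 1, by omega⟩) (x (P.var i)) = true

/-- BP-Satisfying-Pair: is there `a ∈ A`, `b ∈ B` such that `P` accepts the concatenation `ab`? -/
def BPSatisfyingPair {W T h N : ℕ} (P : BranchingProgram W T (h + h))
    (A B : Fin N → Fin h → Bool) : Prop :=
  ∃ i j, P.Accepts (Fin.append (A i) (B j))

/-! ## Tropical similarity -/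

/-- Tensors in `{0,1}^(2 × ⋯ × 2)` with `t` dimensions, that is, of size `2 ^ t`. -/
abbrev Tensor (t : ℕ) := (Fin t → Bool) → Bool

/-- Alternating expectations and maxima over the `t` binary coordinates, in order, starting with an
expectation if the flag is `true` and with a maximum if it is `false`. -/
noncomputable def altExpMax : (t : ℕ) → Bool → ((Fin t → Bool) → ℝ) → ℝ
  | 0, _, g => g Fin.elim0
  | t + 1, true, g =>
      (altExpMax t false (fun i => g (Fin.cons false i)) +
        altExpMax t false (fun i => g (Fin.cons true i))) / 2
  | t + 1, false, g =>
      max (altExpMax t true (fun i => g (Fin.cons false i)))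
        (altExpMax t true (fun i => g (Fin.cons true i)))

/-- The tropical similarity
`s(u, v) = E_{i₁} max_{i₂} E_{i₃} ⋯ max_{iₜ} (u_i * v_i)`. -/
noncomputable def tropSim {t : ℕ} (u v : Tensor t) : ℝ :=
  altExpMax t true (fun i => if u i = true ∧ v i = true then 1 else 0)

/-- Completeness case of Gap-Max-TropSim. -/
def GapMaxComplete {t N : ℕ} (A B : Fin N → Tensor t) : Prop :=
  ∃ i j, tropSim (A i) (B j) = 1

/-- Soundness case of Gap-Max-TropSim with threshold `ε`. -/
def GapMaxSound {t N : ℕ} (ε : ℝ) (A B : Fin N → Tensor t) : Prop :=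
  ∀ i j, tropSim (A i) (B j) < ε

/-- Completeness case of Gap-Min-TropSim with threshold `ε`. -/
def GapMinComplete {t N : ℕ} (ε : ℝ) (A B : Fin N → Tensor t) : Prop :=
  ∃ i j, tropSim (A i) (B j) < ε

/-- Soundness case of Gap-Min-TropSim. -/
def GapMinSound {t N : ℕ} (A B : Fin N → Tensor t) : Prop :=
  ∀ i j, tropSim (A i) (B j) = 1

/-! ## Merlin-Alice-Bob protocols -/

/-- A public-coin interactive communication protocol between Merlin, Alice (who holds an element of
`X`) and Bob (who holds an element of `Y`).  First Alice and Merlin interact according to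
`schedule`: an entry `true` is a public coin tossed by Alice, an entry `false` is a bit sent by
Merlin.  Then Bob, who knows `y` and the list of public coins, sends `bobBits` bits to Alice, and
Alice accepts or rejects on the basis of `x`, the transcript of her interaction with Merlin, and the
message of Bob. -/
structure IPProtocol (X Y : Type) where
  schedule : List Bool
  bobBits : ℕ
  bob : Y → List Bool → (Fin bobBits → Bool)
  alice : X → List Bool → (Fin bobBits → Bool) → Bool

namespace IPProtocol

variable {X Y : Type}

/-- Number of public coins. -/
def numCoins (R : IPProtocol X Y) : ℕ := R.schedule.count true

/-- Number of bits sent by Merlin. -/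
def merlinBits (R : IPProtocol X Y) : ℕ := R.schedule.count false

/-- The transcript of the interaction of Merlin with Alice when Merlin follows the strategy `σ`
(which maps the transcript so far to his next bit), for given remaining schedule, transcript so far,
and remaining coins. -/
def play (σ : List Bool → Bool) : List Bool → List Bool → List Bool → List Bool
  | [], past, _ => past
  | true :: _, past, [] => past
  | true :: s, past, c :: cs => play σ s (past ++ [c]) cs
  | false :: s, past, cs => play σ s (past ++ [σ past]) cs

/-- The outcome when the public coins are `ω` and Merlin follows `σ`. -/
def outcome (R : IPProtocol X Y) (x : X) (y : Y) (σ : List Bool → Bool)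
    (ω : Fin R.numCoins → Bool) : Bool :=
  R.alice x (play σ R.schedule [] (List.ofFn ω)) (R.bob y (List.ofFn ω))

/-- The probability, over uniform public coins, that Alice accepts when Merlin follows `σ`. -/
noncomputable def acceptProb (R : IPProtocol X Y) (x : X) (y : Y) (σ : List Bool → Bool) : ℝ :=
  ((Finset.univ.filter (fun ω : Fin R.numCoins → Bool => R.outcome x y σ ω = true)).card : ℝ) /
    2 ^ R.numCoins

/-- `v` is the optimal acceptance probability, over all strategies of Merlin. -/
def IsOptimalAcceptProb (R : IPProtocol X Y) (x : X) (y : Y) (v : ℝ) : Prop :=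
  IsGreatest (Set.range (R.acceptProb x y)) v

/-- `R` checks the property `f` with perfect completeness and soundness error `ε`. -/
def Checks (R : IPProtocol X Y) (f : X → Y → Prop) (ε : ℝ) : Prop :=
  ∀ x y, (f x y → ∃ σ, R.acceptProb x y σ = 1) ∧ (¬ f x y → ∀ σ, R.acceptProb x y σ ≤ ε)

end IPProtocol

/-! ## Word RAM -/

namespace RAM

/-- Arithmetic instructions; `sub` is truncated subtraction. -/
inductive Op
  | add | sub | mul | div | mod

def Op.eval : Op → ℕ → ℕ → ℕ
  | .add, a, b => a + b
  | .sub, a, b => a - b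
  | .mul, a, b => a * b
  | .div, a, b => a / b
  | .mod, a, b => a % b

/-- Structured programs of a random access machine with registers `0, 1, 2, …` and arrays
`0, 1, 2, …` (a program mentions only finitely many of them). -/
inductive Prog
  /-- do nothing -/
  | skip
  /-- `r := c` -/
  | const (r c : ℕ)
  /-- `r := a o b` -/
  | arith (o : Op) (r a b : ℕ)
  /-- `r := arr[i]`, where the index is the content of register `i` -/
  | load (r arr i : ℕ)
  /-- `arr[i] := r`, where the index is the content of register `i` -/
  | store (arr i r : ℕ)
  | seq (p q : Prog)
  /-- if register `r` is nonzero then `p` else `q` -/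
  | ite (r : ℕ) (p q : Prog)
  /-- while register `r` is nonzero do `p` -/
  | loop (r : ℕ) (p : Prog)

structure State where
  reg : ℕ → ℕ
  arr : ℕ → ℕ → ℕ

def State.setReg (s : State) (r v : ℕ) : State :=
  { s with reg := Function.update s.reg r v }

def State.setArr (s : State) (a i v : ℕ) : State :=
  { s with arr := Function.update s.arr a (Function.update (s.arr a) i v) }

/-- `Exec M p s s₁ k`: started in the state `s`, the program `p` halts in the state `s₁` after `k`
steps.  All the numbers computed have to fit into a machine word, that is, to be at most `M`;
otherwise the machine is stuck.  Each instruction and each test costs one step. -/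
inductive Exec (M : ℕ) : Prog → State → State → ℕ → Prop
  | skip (s : State) : Exec M .skip s s 1
  | const (s : State) (r c : ℕ) (hM : c ≤ M) : Exec M (.const r c) s (s.setReg r c) 1
  | arith (s : State) (o : Op) (r a b : ℕ) (hM : o.eval (s.reg a) (s.reg b) ≤ M) :
      Exec M (.arith o r a b) s (s.setReg r (o.eval (s.reg a) (s.reg b))) 1
  | load (s : State) (r a i : ℕ) (hM : s.arr a (s.reg i) ≤ M) :
      Exec M (.load r a i) s (s.setReg r (s.arr a (s.reg i))) 1
  | store (s : State) (a i r : ℕ) :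
      Exec M (.store a i r) s (s.setArr a (s.reg i) (s.reg r)) 1
  | seq {p q : Prog} {s s₁ s₂ : State} {k l : ℕ} (hp : Exec M p s s₁ k) (hq : Exec M q s₁ s₂ l) :
      Exec M (.seq p q) s s₂ (k + l)
  | iteTrue {p q : Prog} {s s₁ : State} {r k : ℕ} (hr : s.reg r ≠ 0) (hp : Exec M p s s₁ k) :
      Exec M (.ite r p q) s s₁ (k + 1)
  | iteFalse {p q : Prog} {s s₁ : State} {r k : ℕ} (hr : s.reg r = 0) (hq : Exec M q s s₁ k) :
      Exec M (.ite r p q) s s₁ (k + 1)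
  | loopStop {p : Prog} {s : State} {r : ℕ} (hr : s.reg r = 0) : Exec M (.loop r p) s s 1
  | loopStep {p : Prog} {s s₁ s₂ : State} {r k l : ℕ} (hr : s.reg r ≠ 0) (hp : Exec M p s s₁ k)
      (hl : Exec M (.loop r p) s₁ s₂ l) : Exec M (.loop r p) s s₂ (k + l + 1)

/-- An array holding the values of `g`, padded with zeros. -/
def cells {m : ℕ} (g : Fin m → ℕ) (x : ℕ) : ℕ := if hx : x < m then g ⟨x, hx⟩ else 0

/-- The array of the bits of `N` strings of length `h`, one after the other, one bit per cell. -/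
def stringCells {N h : ℕ} (A : Fin N → Fin h → Bool) : ℕ → ℕ :=
  cells (m := N * h) fun x => (A (finProdFinEquiv.symm x).1 (finProdFinEquiv.symm x).2).toNat

/-- The array of the edge bits of `P`, in row-major order of (layer, source, target, mark). -/
def edgeCells {W T n : ℕ} (P : BranchingProgram W T n) : ℕ → ℕ :=
  cells (m := (T - 1) * (W * (W * 2))) fun x =>
    let a := finProdFinEquiv.symm x
    let b := finProdFinEquiv.symm a.2
    let c := finProdFinEquiv.symm b.2
    (P.edge a.1 b.1 c.1 (finTwoEquiv c.2)).toNat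

/-- The start state: the input is an instance of BP-Satisfying-Pair and a precision `k`. -/
def inputState {W T h N : ℕ} (P : BranchingProgram W T (h + h)) (k : ℕ)
    (A B : Fin N → Fin h → Bool) : State where
  reg := fun _ => 0
  arr := fun a => match a with
    | 0 => cells ![N, h, W, T, k]
    | 1 => cells fun i => (P.var i : ℕ)
    | 2 => edgeCells P
    | 3 => stringCells A
    | 4 => stringCells B
    | _ => fun _ => 0

/-- The number of cells occupied by the input. -/
def inputSize (W T h N : ℕ) : ℕ := 5 + (T - 1) + (T - 1) * (W * (W * 2)) + N * h + N * h

/-- In the state `s`, array `5` holds the number `t` of dimensions, and arrays `6` and `7` hold the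
tensors `A` and the tensors `B`, one after the other, one entry per cell; the entry with index
`(i_1, …, i_t)` is at offset `∑ k, i_k * 2 ^ (k - 1)`. -/
def IsOutput {t N : ℕ} (s : State) (A B : Fin N → Tensor t) : Prop :=
  s.arr 5 0 = t ∧
  (∀ (j : Fin N) (c : ℕ), c < 2 ^ t →
    s.arr 6 (j * 2 ^ t + c) = (A j (fun i => c.testBit i)).toNat) ∧
  (∀ (j : Fin N) (c : ℕ), c < 2 ^ t →
    s.arr 7 (j * 2 ^ t + c) = (B j (fun i => c.testBit i)).toNat)

end RAM

/-! ## Size bounds -/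

/-- `1 + loglog W + loglog T + log (1/ε)`. -/
noncomputable def logTerm (W T : ℕ) (ε : ℝ) : ℝ :=
  1 + Real.logb 2 (Real.logb 2 W) + Real.logb 2 (Real.logb 2 T) + Real.logb 2 ε⁻¹

/-- `log² W * log² T * (1 + loglog W + loglog T + log (1/ε))`. -/
noncomputable def sizeExponent (W T : ℕ) (ε : ℝ) : ℝ :=
  Real.logb 2 W ^ 2 * Real.logb 2 T ^ 2 * logTerm W T ε

/-- With constant `C`, the program `M` maps `(P, A, B)` and the precision `⌈log₂ (1/ε)⌉` to the
tensors `(G (a))_{a ∈ A}` and `(H (b))_{b ∈ B}` of size `D = 2 ^ t` in at most `C * N * D ^ C` steps,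
on words of `O(log (input size) + log D)` bits. -/
def RAM.ComputesTensors {W T h t : ℕ} (M : RAM.Prog) (C : ℕ) (P : BranchingProgram W T (h + h))
    (ε : ℝ) (G H : (Fin h → Bool) → Tensor t) {N : ℕ} (A B : Fin N → Fin h → Bool) : Prop :=
  ∃ (s : RAM.State) (steps : ℕ),
    RAM.Exec ((C * RAM.inputSize W T h N * 2 ^ t) ^ C) M
      (RAM.inputState P ⌈Real.logb 2 ε⁻¹⌉₊ A B) s steps ∧
    steps ≤ C * N * (2 ^ t) ^ C ∧
    RAM.IsOutput s (fun i => G (A i)) (fun j => H (B j))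

/-- `R` checks `f` with soundness error `ε`, with `O(log² W log² T (loglog W + loglog T + log 1/ε))`
bits from Merlin and as many public coins, and `O(loglog W + loglog T + log 1/ε)` bits from Bob
(with constant `C`); and on all inputs the optimal acceptance probability is the tropical similarity
of the tensors `G x` and `H y`. -/
def SimulatedProtocol {X Y : Type} {t : ℕ} (R : IPProtocol X Y) (C W T : ℕ) (ε : ℝ)
    (f : X → Y → Prop) (G : X → Tensor t) (H : Y → Tensor t) : Prop :=
  R.Checks f ε ∧
  (R.merlinBits : ℝ) ≤ C * sizeExponent W T ε ∧
  (R.numCoins : ℝ) ≤ C * sizeExponent W T ε ∧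
  (R.bobBits : ℝ) ≤ C * logTerm W T ε ∧
  ∀ x y, R.IsOptimalAcceptProb x y (tropSim (G x) (H y))

/-!
The program `P` accepts an input if and only if the layered graph of the edges consistent with the
input has a path from the first node of the first layer to the first node of the last one.  After
padding to `2 ^ l` layers this is decided in `l` levels: a path of `2 ^ (k + 1)` edges from `u` to
`v` exists if and only if there is a node `x` such that both halves, from `u` to `x` and from `x`
to `v`, exist (`Arithmetization.blockRel_iff_connected`).  Writing nodes and layers in binary, one
level is a selection of the half, one universal quantifier over a bit, and existential quantifiers
over the bits of `x`.

These operations are arithmetized over the field `ZMod p`, where `2 ^ m ≤ p ≤ 2 ^ (m + 1)`, and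
each of them is followed by a linearization in every coordinate.  Therefore all functions that occur
have degree at most `3` along the lines that matter (`Arithmetization.isPolyLE_iterOp_move`), and a
claimed value of the last function is reduced step by step to a claimed value of the first one: for
each step Merlin sends a cubic polynomial, Alice checks it against the claim, and `m` coins select
the point of the line at which the next claim is made.  A true claim is accepted with certainty
(`Arithmetization.gameValue_verdict_eq_one`), and a false one among `S` steps with probability at
most `3 * S / 2 ^ m`, because distinct cubic polynomials agree in at most three points
(`Arithmetization.gameValue_verdict_le`).  The claim that the indicator of acceptance is `1` yields
the protocol for acceptance, and the claim that it is `0` the one for nonacceptance; this is why both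
have perfect completeness.

The first function is the multilinear extension of the edge relation.  Each layer queries a variable
of Alice or a variable of Bob, and hence this extension is a sum of a part that depends on Alice's
string and a part that depends on Bob's (`BranchingProgram.aliceEntry_add_bobEntry`).  The last point
depends only on the coins, so Bob can complete the verification by sending one element of the field
(`Arithmetization.tropSim_protocol`).

Merlin's bits and the coins alternate, and the entries of Alice's tensor are her decisions for all
transcripts followed by all possible messages of Bob, whereas Bob's tensor marks the message that he
does send.  The tropical similarity is the value of the game in which coins and bits of a maximizing
player alternate.  In the last rounds the player can only guess Bob's message, so this value is
Merlin's optimal probability of success (`IPProtocol.tropSim_eq_gameValue`,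
`IPProtocol.ofNumbers_isOptimal`).

For the running time, a small structured language with expressions is compiled to the word RAM, with
a cost bound that is polynomial in the number of iterations of the loops (`RAM.Cmd.exists_cost_le`)
and rules for correctness proofs (`RAM.Cmd.Achieves`).  The program computes every entry of the
tensors from its definition, by brute force over the cube of the multilinear extension; all loops but
the one over the strings have at most `2 ^ t` iterations (`RAM.exists_exec_tensorProgram`).
-/

/-! ### A structured language on top of the word RAM -/

namespace RAM

@[simp] theorem State.setReg_reg (s : State) (r v x : ℕ) :
    (s.setReg r v).reg x = if x = r then v else s.reg x := by
  simp [State.setReg, Function.update_apply]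

@[simp] theorem State.setReg_arr (s : State) (r v : ℕ) : (s.setReg r v).arr = s.arr := rfl

@[simp] theorem State.setArr_reg (s : State) (a i v : ℕ) : (s.setArr a i v).reg = s.reg := rfl

@[simp] theorem State.setArr_arr (s : State) (a i v b j : ℕ) :
    (s.setArr a i v).arr b j = if b = a ∧ j = i then v else s.arr b j := by
  by_cases hb : b = a
  · subst hb
    simp [State.setArr, Function.update_apply]
  · simp [State.setArr, hb]

@[ext] theorem State.ext' {s s' : State} (h : ∀ r, s.reg r = s'.reg r)
    (h' : ∀ a i, s.arr a i = s'.arr a i) : s = s' := by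
  cases s; cases s'
  congr
  · exact funext h
  · exact funext fun a => funext (h' a)

/-- Enlarging the word size does not invalidate a computation. -/
theorem Exec.mono {M M' : ℕ} (hM : M ≤ M') {p : Prog} {s s' : State} {k : ℕ}
    (h : Exec M p s s' k) : Exec M' p s s' k := by
  induction h with
  | skip s => exact .skip s
  | const s r c h => exact .const s r c (h.trans hM)
  | arith s o r a b h => exact .arith s o r a b (h.trans hM)
  | load s r a i h => exact .load s r a i (h.trans hM)
  | store s a i r => exact .store s a i r
  | seq _ _ h₁ h₂ => exact .seq h₁ h₂
  | iteTrue h _ ih => exact .iteTrue h ih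
  | iteFalse h _ ih => exact .iteFalse h ih
  | loopStop h => exact .loopStop h
  | loopStep h _ _ h₁ h₂ => exact .loopStep h h₁ h₂

/-- Arithmetic expressions over the variables of a `Cmd` and array entries. -/
inductive Exp
  | var (r : ℕ)
  | lit (c : ℕ)
  | bin (o : Op) (a b : Exp)
  | get (arr : ℕ) (i : Exp)

namespace Exp

@[simp] def eval (s : State) : Exp → ℕ
  | var r => s.reg r
  | lit c => c
  | bin o a b => o.eval (a.eval s) (b.eval s)
  | get arr i => s.arr arr (i.eval s)

/-- An exponent `d` such that all intermediate results are at most `X ^ d` if all variables and all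
array entries are at most `X`; see `eval_le`. -/
@[simp] def deg : Exp → ℕ
  | var _ => 1
  | lit _ => 1
  | bin o a b => match o with
    | .add | .mul => a.deg + b.deg
    | .sub | .div | .mod => max a.deg b.deg
  | get _ i => i.deg

/-- The largest literal. -/
@[simp] def maxLit : Exp → ℕ
  | var _ => 0
  | lit c => c
  | bin _ a b => max a.maxLit b.maxLit
  | get _ i => i.maxLit

/-- Variable `r` lives in register `2 * r`; the odd registers serve as evaluation stack, and the
value of the expression is left in register `2 * d + 1`. -/
def compile : ℕ → Exp → Prog
  | d, var r => .seq (.const (2 * d + 1) 0) (.arith .add (2 * d + 1) (2 * d + 1) (2 * r))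
  | d, lit c => .const (2 * d + 1) c
  | d, bin o a b => .seq (a.compile d) (.seq (b.compile (d + 1))
      (.arith o (2 * d + 1) (2 * d + 1) (2 * (d + 1) + 1)))
  | d, get arr i => .seq (i.compile d) (.load (2 * d + 1) arr (2 * d + 1))

def cost : Exp → ℕ
  | var _ => 2
  | lit _ => 1
  | bin _ a b => a.cost + (b.cost + 1)
  | get _ i => i.cost + 1

end Exp

/-- The values of the variables and the arrays that are represented by a machine state. -/
def State.abs (s : State) : State where
  reg := fun r => s.reg (2 * r)
  arr := s.arr

/-- All variables and array entries are at most `X`. -/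
def State.Bdd (X : ℕ) (s : State) : Prop := (∀ r, s.reg r ≤ X) ∧ ∀ a i, s.arr a i ≤ X

theorem Exp.one_le_deg (e : Exp) : 1 ≤ e.deg := by
  induction e with
  | var | lit => simp
  | bin o a b iha ihb => cases o <;> simp <;> omega
  | get a i ih => simpa

theorem Exp.eval_le {X : ℕ} (hX : 2 ≤ X) {s : State} (hs : s.Bdd X) (e : Exp)
    (he : e.maxLit ≤ X) : e.eval s ≤ X ^ e.deg := by
  induction e with
  | var r => simpa using hs.1 r
  | lit c => simpa using he
  | get a i ih =>
    exact (hs.2 _ _).trans (Nat.le_self_pow (by have := i.one_le_deg; simp; omega) X)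
  | bin o a b iha ihb =>
    simp only [Exp.maxLit, max_le_iff] at he
    have ha := iha he.1
    have hb := ihb he.2
    have hmax : X ^ a.deg ≤ X ^ max a.deg b.deg :=
      Nat.pow_le_pow_right (by omega) (le_max_left _ _)
    cases o with
    | add =>
      have h1 : X ^ 1 ≤ X ^ a.deg := Nat.pow_le_pow_right (by omega) a.one_le_deg
      have h2 : X ^ 1 ≤ X ^ b.deg := Nat.pow_le_pow_right (by omega) b.one_le_deg
      simp only [Exp.eval, Op.eval, Exp.deg, pow_add, pow_one] at *
      nlinarith
    | mul =>
      simp only [Exp.eval, Op.eval, Exp.deg, pow_add]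
      exact Nat.mul_le_mul ha hb
    | sub => exact (Nat.sub_le _ _).trans (ha.trans hmax)
    | div => exact (Nat.div_le_self _ _).trans (ha.trans hmax)
    | mod => exact (Nat.mod_le _ _).trans (ha.trans hmax)

/-- Correctness of the compilation of expressions. -/
theorem Exp.exec_compile {X M : ℕ} (hX : 2 ≤ X) (e : Exp) (he : e.maxLit ≤ X)
    (hM : X ^ e.deg ≤ M) (d : ℕ) (s : State) (hs : s.abs.Bdd X) :
    ∃ s', Exec M (e.compile d) s s' e.cost ∧ s'.reg (2 * d + 1) = e.eval s.abs ∧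
      s'.abs = s.abs ∧ ∀ c < d, s'.reg (2 * c + 1) = s.reg (2 * c + 1) := by
  induction e generalizing d s with
  | var r =>
    refine ⟨_, .seq (.const _ _ _ (Nat.zero_le _)) (.arith _ .add _ _ _ ?_), ?_, ?_, ?_⟩
    · have := hs.1 r
      have h : (2 * r : ℕ) ≠ 2 * d + 1 := by omega
      simp [Op.eval, h] at this hM ⊢
      exact this.trans hM
    · have h : (2 * r : ℕ) ≠ 2 * d + 1 := by omega
      simp [Op.eval, State.abs, h]
    · ext x
      · have h : (2 * x : ℕ) ≠ 2 * d + 1 := by omega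
        simp [State.abs, h]
      · rfl
    · intro c hc
      have h : c ≠ d := by omega
      simp [h]
  | lit c =>
    refine ⟨_, .const _ _ _ ?_, ?_, ?_, ?_⟩
    · simp at he hM
      omega
    · simp
    · ext x
      · have h : (2 * x : ℕ) ≠ 2 * d + 1 := by omega
        simp [State.abs, h]
      · rfl
    · intro c hc
      have h : c ≠ d := by omega
      simp [h]
  | get a i ih =>
    obtain ⟨s', h1, h2, h3, h4⟩ := ih he hM d s hs
    have harr : s'.arr = s.arr := (congrArg State.arr h3 :)
    refine ⟨_, .seq h1 (.load _ _ _ _ ?_), ?_, ?_, ?_⟩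
    · rw [harr]
      refine (hs.2 _ _).trans (le_trans (Nat.le_self_pow ?_ X) hM)
      have := i.one_le_deg
      simp
      omega
    · simp [harr, h2, State.abs]
    · rw [← h3]
      ext x
      · have h : (2 * x : ℕ) ≠ 2 * d + 1 := by omega
        simp [State.abs, h]
      · rfl
    · intro c hc
      have h : c ≠ d := by omega
      simp [h, h4 c hc]
  | bin o a b iha ihb =>
    have hval := Exp.eval_le hX hs (.bin o a b) he
    simp only [Exp.maxLit, max_le_iff] at he
    have hda : a.deg ≤ (Exp.bin o a b).deg := by cases o <;> simp
    have hdb : b.deg ≤ (Exp.bin o a b).deg := by cases o <;> simp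
    obtain ⟨s₁, h1, h2, h3, h4⟩ := iha he.1
      ((Nat.pow_le_pow_right (by omega) hda).trans hM) d s hs
    obtain ⟨s₂, h1', h2', h3', h4'⟩ := ihb he.2
      ((Nat.pow_le_pow_right (by omega) hdb).trans hM) (d + 1) s₁ (h3 ▸ hs)
    have hda' : s₂.reg (2 * d + 1) = a.eval s.abs := by rw [h4' d (by omega), h2]
    refine ⟨_, .seq h1 (.seq h1' (.arith _ _ _ _ _ ?_)), ?_, ?_, ?_⟩
    · rw [hda', h2', h3]
      exact hval.trans hM
    · simp [hda', h2', h3]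
    · rw [← h3, ← h3']
      ext x
      · have h : (2 * x : ℕ) ≠ 2 * d + 1 := by omega
        simp [State.abs, h]
      · rfl
    · intro c hc
      have h : c ≠ d := by omega
      simp [h, h4 c hc, h4' c (by omega)]

/-- Commands: assignments, array writes, sequencing, conditionals, and loops whose counter runs
downwards. -/
inductive Cmd
  | skip
  /-- `r := e` -/
  | set (r : ℕ) (e : Exp)
  /-- `arr[i] := e` -/
  | put (arr : ℕ) (i e : Exp)
  | seq (p q : Cmd)
  | ite (e : Exp) (p q : Cmd)
  /-- `for r = e - 1, …, 0 do p`, where `e` is evaluated once -/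
  | loop (r : ℕ) (e : Exp) (p : Cmd)

namespace Cmd

/-- `r := ` the value of the evaluation stack at depth `0` -/
def pop (r : ℕ) : Prog := .seq (.const (2 * r) 0) (.arith .add (2 * r) (2 * r) 1)

/-- The variable `r` is decreased by one. -/
def decr (r : ℕ) : Prog := .seq (.const 1 1) (.arith .sub (2 * r) (2 * r) 1)

def compile : Cmd → Prog
  | skip => .skip
  | set r e => .seq (e.compile 0) (pop r)
  | put arr i e => .seq (i.compile 0) (.seq (e.compile 1) (.store arr 1 3))
  | seq p q => .seq p.compile q.compile
  | ite e p q => .seq (e.compile 0) (.ite 1 p.compile q.compile)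
  | loop r e p => .seq (e.compile 0) (.seq (pop r) (.loop (2 * r) (.seq (decr r) p.compile)))

/-- A bound for the running time if every loop has at most `L` iterations. -/
def cost (L : ℕ) : Cmd → ℕ
  | skip => 1
  | set _ e => e.cost + 2
  | put _ i e => i.cost + (e.cost + 1)
  | seq p q => p.cost L + q.cost L
  | ite e p q => e.cost + (p.cost L + q.cost L + 1)
  | loop _ e p => e.cost + (2 + (L * (p.cost L + 3) + 1))

/-- The variables that a command may change. -/
def writes : Cmd → List ℕ
  | skip => []
  | set r _ => [r]
  | put _ _ _ => []
  | seq p q => p.writes ++ q.writes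
  | ite _ p q => p.writes ++ q.writes
  | loop r _ p => r :: p.writes

/-- The arrays that a command may change. -/
def puts : Cmd → List ℕ
  | skip => []
  | set _ _ => []
  | put a _ _ => [a]
  | seq p q => p.puts ++ q.puts
  | ite _ p q => p.puts ++ q.puts
  | loop _ _ p => p.puts

/-- `s'` agrees with `s` except for the variables and the arrays that `c` may change. -/
def Frame (c : Cmd) (s s' : State) : Prop :=
  (∀ r, r ∉ c.writes → s'.reg r = s.reg r) ∧ ∀ a, a ∉ c.puts → s'.arr a = s.arr a

/-- The running time is polynomial in the number of iterations of the loops. -/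
theorem exists_cost_le (c : Cmd) : ∃ C, ∀ L, 1 ≤ L → c.cost L ≤ C * L ^ C := by
  have key : ∀ {C C' L : ℕ}, 1 ≤ L → C ≤ C' → C * L ^ C ≤ C' * L ^ C' := fun hL h =>
    Nat.mul_le_mul h (Nat.pow_le_pow_right hL h)
  have one : ∀ {C L : ℕ}, 1 ≤ L → C ≤ C * L ^ C := fun {C L} hL =>
    Nat.le_mul_of_pos_right _ (Nat.pow_pos hL)
  induction c with
  | skip => exact ⟨1, fun L hL => by simpa [cost] using hL⟩
  | set r e => exact ⟨e.cost + 2, fun L hL => one hL⟩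
  | put a i e => exact ⟨i.cost + (e.cost + 1), fun L hL => one hL⟩
  | seq p q hp hq =>
    obtain ⟨C, h⟩ := hp
    obtain ⟨C', h'⟩ := hq
    refine ⟨C + C', fun L hL => ?_⟩
    have a1 : L ^ C ≤ L ^ (C + C') := Nat.pow_le_pow_right hL (by omega)
    have a2 : L ^ C' ≤ L ^ (C + C') := Nat.pow_le_pow_right hL (by omega)
    have b1 := (h L hL).trans (Nat.mul_le_mul_left C a1)
    have b2 := (h' L hL).trans (Nat.mul_le_mul_left C' a2)
    rw [add_mul]
    exact Nat.add_le_add b1 b2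
  | ite e p q hp hq =>
    obtain ⟨C, h⟩ := hp
    obtain ⟨C', h'⟩ := hq
    refine ⟨C + C' + (e.cost + 1), fun L hL => ?_⟩
    set R := C + C' + (e.cost + 1) with hR
    have a1 : L ^ C ≤ L ^ R := Nat.pow_le_pow_right hL (by omega)
    have a2 : L ^ C' ≤ L ^ R := Nat.pow_le_pow_right hL (by omega)
    have a3 : 1 ≤ L ^ R := Nat.pow_pos hL
    have b1 := (h L hL).trans (Nat.mul_le_mul_left C a1)
    have b2 := (h' L hL).trans (Nat.mul_le_mul_left C' a2)
    have b3 := Nat.mul_le_mul_left (e.cost + 1) a3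
    have : R * L ^ R = C * L ^ R + C' * L ^ R + (e.cost + 1) * L ^ R := by
      conv_lhs => lhs; rw [hR]
      ring
    simp only [cost]
    omega
  | loop r e p hp =>
    obtain ⟨C, h⟩ := hp
    refine ⟨C + 1 + (e.cost + 6), fun L hL => ?_⟩
    set R := C + 1 + (e.cost + 6) with hR
    have a1 : L ^ (C + 1) ≤ L ^ R := Nat.pow_le_pow_right hL (by omega)
    have a2 : L ^ 1 ≤ L ^ R := Nat.pow_le_pow_right hL (by omega)
    have b1 : L * (p.cost L + 3) ≤ C * L ^ (C + 1) + 3 * L := by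
      have := Nat.mul_le_mul_left L (h L hL)
      calc L * (p.cost L + 3) = L * p.cost L + 3 * L := by ring
        _ ≤ L * (C * L ^ C) + 3 * L := by omega
        _ = _ := by ring
    have b2 := Nat.mul_le_mul_left C a1
    have b3 := Nat.mul_le_mul_left (e.cost + 3) (Nat.pow_pos hL : 0 < L ^ R)
    have : R * L ^ R = C * L ^ R + L ^ R + 3 * L ^ R + (e.cost + 3) * L ^ R := by
      conv_lhs => lhs; rw [hR]
      ring
    simp only [cost]
    simp only [pow_one] at a2
    omega

/-- From the variables and arrays `s`, all of whose entries are at most `X`, the command `c` reaches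
in at most `K` steps values that are at most `X` and satisfy `Q`, changing only what it may change;
all intermediate results are at most `X ^ 8`.  The exponent `8` leaves room for the expressions that
occur below; that their degrees and literals are at most `8` is decided by evaluation in default
arguments of the rules. -/
def Achieves (X K : ℕ) (c : Cmd) (s : State) (Q : State → Prop) : Prop :=
  ∀ σ : State, σ.abs = s → s.Bdd X → ∃ σ' k, Exec (X ^ 8) c.compile σ σ' k ∧ k ≤ K ∧
    c.Frame s σ'.abs ∧ σ'.abs.Bdd X ∧ Q σ'.abs

namespace Achieves

variable {X K K' : ℕ} {s : State} {Q Q' : State → Prop} {c p q : Cmd}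

theorem imp (h : Achieves X K c s Q)
    (hQ : ∀ s', c.Frame s s' → s'.Bdd X → Q s' → Q' s') : Achieves X K c s Q' := by
  intro σ hσ hs
  obtain ⟨σ', k, h1, h2, h3, h4, h5⟩ := h σ hσ hs
  exact ⟨σ', k, h1, h2, h3, h4, hQ _ h3 h4 h5⟩

theorem mono (h : Achieves X K c s Q) (hK : K ≤ K') : Achieves X K' c s Q := by
  intro σ hσ hs
  obtain ⟨σ', k, h1, h2, h3⟩ := h σ hσ hs
  exact ⟨σ', k, h1, h2.trans hK, h3⟩

/-- The bound on the initial values may be used in the proof. -/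
theorem of_bdd (h : s.Bdd X → Achieves X K c s Q) : Achieves X K c s Q :=
  fun σ hσ hs => h hs σ hσ hs

theorem skip (hQ : Q s) : Achieves X 1 .skip s Q := by
  rintro σ rfl hs
  exact ⟨σ, 1, .skip σ, le_rfl, ⟨fun _ _ => rfl, fun _ _ => rfl⟩, hs, hQ⟩

/-- Moving the value of the evaluation stack to a variable is an assignment. -/
theorem exec_pop {M r : ℕ} (σ : State) (h : σ.reg 1 ≤ M) :
    ∃ σ', Exec M (pop r) σ σ' 2 ∧ σ'.abs = σ.abs.setReg r (σ.reg 1) := by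
  have h1 : (1 : ℕ) ≠ 2 * r := by omega
  refine ⟨_, .seq (.const _ _ _ (Nat.zero_le _)) (.arith _ .add _ _ _ ?_), ?_⟩
  · simpa [Op.eval, h1] using h
  · ext x
    · by_cases hx : x = r <;> simp [State.abs, Op.eval, h1, hx]
    · rfl

theorem le_pow_eight (hX : 2 ≤ X) {d : ℕ} (hd : d ≤ 8) : X ^ d ≤ X ^ 8 :=
  Nat.pow_le_pow_right (by omega) hd

theorem bdd_setReg {r v : ℕ} (hs : s.Bdd X) (hv : v ≤ X) : (s.setReg r v).Bdd X := by
  refine ⟨fun x => ?_, hs.2⟩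
  simp only [State.setReg_reg]
  split_ifs
  exacts [hv, hs.1 x]

theorem bdd_setArr {a i v : ℕ} (hs : s.Bdd X) (hv : v ≤ X) : (s.setArr a i v).Bdd X := by
  refine ⟨hs.1, fun b j => ?_⟩
  simp only [State.setArr_arr]
  split_ifs
  exacts [hv, hs.2 b j]

theorem set {L r : ℕ} {e : Exp} (hX : 8 ≤ X) (hQ : Q (s.setReg r (e.eval s)))
    (hv : e.eval s ≤ X) (hd : e.deg ≤ 8 := by exact Nat.le_of_ble_eq_true rfl)
    (hl : e.maxLit ≤ 8 := by exact Nat.le_of_ble_eq_true rfl) :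
    Achieves X ((Cmd.set r e).cost L) (.set r e) s Q := by
  rintro σ rfl hs
  obtain ⟨σ₁, h1, h2, h3, -⟩ := e.exec_compile (by omega) (hl.trans hX)
    (le_pow_eight (by omega) hd) 0 σ hs
  simp only [mul_zero, zero_add] at h2
  obtain ⟨σ₂, h1', h2'⟩ := exec_pop (M := X ^ 8) (r := r) σ₁
    (h2 ▸ hv.trans (Nat.le_self_pow (by norm_num) X))
  rw [h3, h2] at h2'
  refine ⟨σ₂, _, .seq h1 h1', le_rfl, ?_, ?_, ?_⟩ <;> rw [h2']
  · refine ⟨fun x hx => ?_, fun _ _ => rfl⟩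
    simp only [writes, List.mem_singleton] at hx
    simp [hx]
  · exact bdd_setReg hs hv
  · exact hQ

theorem put {L a : ℕ} {i e : Exp} (hX : 8 ≤ X) (hQ : Q (s.setArr a (i.eval s) (e.eval s)))
    (hv : e.eval s ≤ X) (hd : i.deg ≤ 8 := by exact Nat.le_of_ble_eq_true rfl)
    (hl : i.maxLit ≤ 8 := by exact Nat.le_of_ble_eq_true rfl)
    (hd' : e.deg ≤ 8 := by exact Nat.le_of_ble_eq_true rfl)
    (hl' : e.maxLit ≤ 8 := by exact Nat.le_of_ble_eq_true rfl) :
    Achieves X ((Cmd.put a i e).cost L) (.put a i e) s Q := by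
  rintro σ rfl hs
  obtain ⟨σ₁, h1, h2, h3, -⟩ := i.exec_compile (by omega) (hl.trans hX)
    (le_pow_eight (by omega) hd) 0 σ hs
  obtain ⟨σ₂, h1', h2', h3', h4'⟩ := e.exec_compile (by omega) (hl'.trans hX)
    (le_pow_eight (by omega) hd') 1 σ₁ (h3 ▸ hs)
  have h5 := h4' 0 (by omega)
  simp only [mul_zero, zero_add, mul_one, Nat.reduceAdd] at h2 h2' h5
  rw [h3] at h2' h3'
  have harr : σ₂.arr = σ.arr := (congrArg State.arr h3' :)
  have hreg : σ₂.abs.reg = σ.abs.reg := (congrArg State.reg h3' :)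
  have h6 : (σ₂.setArr a (σ₂.reg 1) (σ₂.reg 3)).abs =
      σ.abs.setArr a (i.eval σ.abs) (e.eval σ.abs) := by
    rw [h5, h2, h2']
    ext x y
    · exact congrFun hreg x
    · simp only [State.abs, State.setArr_arr, harr]
  refine ⟨_, _, .seq h1 (.seq h1' (.store _ _ _ _)), le_rfl, ?_, ?_, ?_⟩ <;> rw [h6]
  · refine ⟨fun _ _ => rfl, fun x hx => ?_⟩
    simp only [puts, List.mem_singleton] at hx
    ext y
    simp [hx]
  · exact bdd_setArr hs hv
  · exact hQ

theorem seq (h : Achieves X K p s fun s' => Achieves X K' q s' Q) :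
    Achieves X (K + K') (.seq p q) s Q := by
  intro σ hσ hs
  obtain ⟨σ₁, k, h1, h2, h3, h4, h5⟩ := h σ hσ hs
  obtain ⟨σ₂, k', h1', h2', h3', h4', h5'⟩ := h5 σ₁ rfl h4
  refine ⟨σ₂, _, .seq h1 h1', Nat.add_le_add h2 h2', ⟨fun x hx => ?_, fun x hx => ?_⟩, h4', h5'⟩
  · simp only [writes, List.mem_append, not_or] at hx
    rw [h3'.1 x hx.2, h3.1 x hx.1]
  · simp only [puts, List.mem_append, not_or] at hx
    rw [h3'.2 x hx.2, h3.2 x hx.1]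

theorem ite {L : ℕ} {e : Exp} (hX : 8 ≤ X)
    (hp : e.eval s ≠ 0 → Achieves X (p.cost L) p s Q)
    (hq : e.eval s = 0 → Achieves X (q.cost L) q s Q)
    (hd : e.deg ≤ 8 := by exact Nat.le_of_ble_eq_true rfl)
    (hl : e.maxLit ≤ 8 := by exact Nat.le_of_ble_eq_true rfl) :
    Achieves X ((Cmd.ite e p q).cost L) (.ite e p q) s Q := by
  rintro σ rfl hs
  obtain ⟨σ₁, h1, h2, h3, -⟩ := e.exec_compile (by omega) (hl.trans hX)
    (le_pow_eight (by omega) hd) 0 σ hs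
  simp only [mul_zero, zero_add] at h2
  by_cases h0 : e.eval σ.abs = 0
  · obtain ⟨σ₂, k, h1', h2', h3', h4', h5'⟩ := hq h0 σ₁ h3 hs
    refine ⟨σ₂, _, .seq h1 (.iteFalse (h2.trans h0) h1'), ?_, ⟨fun x hx => ?_, fun x hx => ?_⟩,
      h4', h5'⟩
    · simp only [cost]
      omega
    · simp only [writes, List.mem_append, not_or] at hx
      exact h3'.1 x hx.2
    · simp only [puts, List.mem_append, not_or] at hx
      exact h3'.2 x hx.2
  · obtain ⟨σ₂, k, h1', h2', h3', h4', h5'⟩ := hp h0 σ₁ h3 hs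
    refine ⟨σ₂, _, .seq h1 (.iteTrue (by rwa [h2]) h1'), ?_, ⟨fun x hx => ?_, fun x hx => ?_⟩,
      h4', h5'⟩
    · simp only [cost]
      omega
    · simp only [writes, List.mem_append, not_or] at hx
      exact h3'.1 x hx.1
    · simp only [puts, List.mem_append, not_or] at hx
      exact h3'.2 x hx.1

/-- The loop rule, with a separate bound `n` for the number of iterations: `Inv k` holds when `k`
iterations are left, and the body runs with the counter `k` when `k + 1` iterations are left. -/
theorem loop' {r n : ℕ} {e : Exp} (Inv : ℕ → State → Prop) (hX : 8 ≤ X) (hn : e.eval s = n)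
    (hv : n ≤ X) (hr : r ∉ p.writes) (h0 : Inv n (s.setReg r n))
    (hstep : ∀ k < n, ∀ s', (Cmd.loop r e p).Frame s s' → Inv (k + 1) s' →
      Achieves X K p (s'.setReg r k) (Inv k))
    (hend : ∀ s', (Cmd.loop r e p).Frame s s' → s'.reg r = 0 → Inv 0 s' → Q s')
    (hd : e.deg ≤ 8 := by exact Nat.le_of_ble_eq_true rfl)
    (hl : e.maxLit ≤ 8 := by exact Nat.le_of_ble_eq_true rfl) :
    Achieves X (e.cost + (2 + (n * (K + 3) + 1))) (.loop r e p) s Q := by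
  rintro σ rfl hs
  obtain ⟨σ₁, h1, h2, h3, -⟩ := e.exec_compile (by omega) (hl.trans hX)
    (le_pow_eight (by omega) hd) 0 σ hs
  simp only [mul_zero, zero_add] at h2
  rw [hn] at h2
  obtain ⟨σ₂, h1', h2'⟩ := exec_pop (M := X ^ 8) (r := r) σ₁
    (h2 ▸ hv.trans (Nat.le_self_pow (by norm_num) X))
  rw [h3, h2] at h2'
  have main : ∀ k ≤ n, ∀ τ : State, τ.abs.reg r = k → (Cmd.loop r e p).Frame σ.abs τ.abs →
      τ.abs.Bdd X → Inv k τ.abs → ∃ τ' j, Exec (X ^ 8) (.loop (2 * r) (.seq (decr r) p.compile))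
        τ τ' j ∧ j ≤ k * (K + 3) + 1 ∧ (Cmd.loop r e p).Frame σ.abs τ'.abs ∧ τ'.abs.Bdd X ∧
        τ'.abs.reg r = 0 ∧ Inv 0 τ'.abs := by
    intro k
    induction k with
    | zero =>
      intro _ τ hτ hf hb hI
      exact ⟨τ, _, .loopStop hτ, by omega, hf, hb, hτ, hI⟩
    | succ k ih =>
      intro hk τ hτ hf hb hI
      have hd : ∃ τ₁, Exec (X ^ 8) (decr r) τ τ₁ 2 ∧ τ₁.abs = τ.abs.setReg r k := by
        have hτ' : τ.reg (2 * r) = k + 1 := hτ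
        have h21 : 2 * r ≠ 1 := by omega
        refine ⟨_, .seq (.const _ _ _ (Nat.one_le_pow _ _ (by omega)))
          (.arith _ .sub _ _ _ ?_), ?_⟩
        · simp only [Op.eval, State.setReg_reg, h21, if_false, hτ', if_true]
          exact (by omega : k + 1 - 1 ≤ X).trans (Nat.le_self_pow (by norm_num) X)
        · ext x
          · have hx : 2 * x ≠ 1 := by omega
            simp [State.abs, Op.eval, hτ', h21]
          · rfl
      obtain ⟨τ₁, e1, e2⟩ := hd
      obtain ⟨τ₂, j, f1, f2, f3, f4, f5⟩ := hstep k (by omega) τ.abs hf hI τ₁ e2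
        (bdd_setReg hb (by omega))
      have hreg : τ₂.abs.reg r = k := by rw [f3.1 r hr]; simp
      have hf' : (Cmd.loop r e p).Frame σ.abs τ₂.abs := by
        refine ⟨fun x hx => ?_, fun x hx => ?_⟩
        · have hx' := hx
          simp only [writes, List.mem_cons, not_or] at hx'
          rw [f3.1 x hx'.2, ← hf.1 x hx]
          simp [hx'.1]
        · rw [f3.2 x hx]
          exact hf.2 x hx
      obtain ⟨τ₃, j', g1, g2, g3⟩ := ih (by omega) τ₂ hreg hf' f4 f5
      refine ⟨τ₃, _, .loopStep ?_ (.seq e1 f1) g1, ?_, g3⟩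
      · have : τ.reg (2 * r) = k + 1 := hτ
        omega
      · rw [add_mul]
        omega
  obtain ⟨τ, j, g1, g2, g3, g4, g5, g6⟩ := main n le_rfl σ₂ (by simp [h2']) (by
      rw [h2']
      refine ⟨fun x hx => ?_, fun _ _ => rfl⟩
      simp only [writes, List.mem_cons, not_or] at hx
      simp [hx.1]) (by rw [h2']; exact bdd_setReg hs hv) (by rw [h2']; exact h0)
  exact ⟨τ, _, .seq h1 (.seq h1' g1), by omega, g3, g4, hend _ g3 g5 g6⟩

/-- The loop rule, with the time bound `cost`. -/
theorem loop {L r n : ℕ} {e : Exp} (Inv : ℕ → State → Prop) (hX : 8 ≤ X) (hn : e.eval s = n)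
    (hv : n ≤ X) (hL : n ≤ L) (hr : r ∉ p.writes) (h0 : Inv n (s.setReg r n))
    (hstep : ∀ k < n, ∀ s', (Cmd.loop r e p).Frame s s' → Inv (k + 1) s' →
      Achieves X (p.cost L) p (s'.setReg r k) (Inv k))
    (hend : ∀ s', (Cmd.loop r e p).Frame s s' → s'.reg r = 0 → Inv 0 s' → Q s')
    (hd : e.deg ≤ 8 := by exact Nat.le_of_ble_eq_true rfl)
    (hl : e.maxLit ≤ 8 := by exact Nat.le_of_ble_eq_true rfl) :
    Achieves X ((Cmd.loop r e p).cost L) (.loop r e p) s Q := by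
  refine (loop' Inv hX hn hv hr h0 hstep hend hd hl).mono ?_
  have := Nat.mul_le_mul_right (p.cost L + 3) hL
  simp only [cost]
  omega

end Achieves

end Cmd

end RAM

/-! ### The value of an alternating game -/

/-- The number formed by the first `n` binary digits of `x` in even positions. -/
def evenBits : ℕ → ℕ → ℕ
  | 0, _ => 0
  | n + 1, x => x % 2 + 2 * evenBits n (x / 4)

/-- The number formed by the first `n` binary digits of `x` in odd positions. -/
def oddBits (n x : ℕ) : ℕ := evenBits n (x / 2)

/-- The value of the game in which, for `n` rounds, a fair coin is tossed and then a player chooses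
a bit, and in the end the player obtains `g x`, where `x` has the binary digits coin, bit, coin,
bit, … starting with the lowest one. -/
noncomputable def gameValue : ℕ → (ℕ → ℝ) → ℝ
  | 0, g => g 0
  | n + 1, g =>
      (max (gameValue n fun x => g (0 + 4 * x)) (gameValue n fun x => g (2 + 4 * x)) +
        max (gameValue n fun x => g (1 + 4 * x)) (gameValue n fun x => g (3 + 4 * x))) / 2

/-- The alternation of expectations and maxima is the value of the game; the index `i` is encoded as
the number with the binary digits `i 0`, `i 1`, …. -/
theorem altExpMax_eq_gameValue (n : ℕ) (g : ℕ → ℝ) :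
    altExpMax (2 * n) true (fun i => g (Nat.ofBits i)) = gameValue n g := by
  induction n generalizing g with
  | zero => simp [altExpMax, gameValue]
  | succ n ih =>
    have h : ∀ (b c : Bool) (i : Fin (2 * n) → Bool),
        Nat.ofBits (Fin.cons b (Fin.cons c i : Fin (2 * n + 1) → Bool) : Fin (2 * n + 2) → Bool) =
          b.toNat + 2 * c.toNat + 4 * Nat.ofBits i := by
      intro b c i
      have h1 : ∀ (m : ℕ) (b : Bool) (i : Fin m → Bool),
          Nat.ofBits (Fin.cons b i : Fin (m + 1) → Bool) = b.toNat + 2 * Nat.ofBits i := by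
        intro m b i
        rw [Nat.ofBits_succ, add_comm]
        rfl
      rw [h1, h1]
      ring
    change altExpMax (2 * n + 2) true _ = _
    simp only [altExpMax, h, gameValue, ← ih]
    simp

theorem evenBits_lt (n x : ℕ) : evenBits n x < 2 ^ n := by
  induction n generalizing x with
  | zero => simp [evenBits]
  | succ n ih =>
    have := ih (x / 4)
    simp only [evenBits, pow_succ]
    omega

theorem oddBits_lt (n x : ℕ) : oddBits n x < 2 ^ n := evenBits_lt n _

theorem oddBits_succ (n x : ℕ) : oddBits (n + 1) x = x / 2 % 2 + 2 * oddBits n (x / 4) := by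
  simp only [oddBits, evenBits]
  rw [Nat.div_div_eq_div_mul, Nat.div_div_eq_div_mul]

theorem evenBits_mod (n x : ℕ) : evenBits n (x % 4 ^ n) = evenBits n x := by
  induction n generalizing x with
  | zero => rfl
  | succ n ih =>
    simp only [evenBits]
    rw [← ih (x / 4), pow_succ', Nat.mod_mul_right_div_self,
      Nat.mod_mod_of_dvd _ (by omega : (2 : ℕ) ∣ 4 * 4 ^ n)]

theorem oddBits_mod (n x : ℕ) : oddBits n (x % 4 ^ n) = oddBits n x := by
  induction n generalizing x with
  | zero => rfl
  | succ n ih =>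
    rw [oddBits_succ, oddBits_succ, ← ih (x / 4), pow_succ', Nat.mod_mul_right_div_self]
    congr 1
    have : x % (4 * 4 ^ n) % 4 = x % 4 := Nat.mod_mod_of_dvd _ (Dvd.intro _ rfl)
    omega

theorem evenBits_add_mul (n y x : ℕ) : evenBits n (y + 4 ^ n * x) = evenBits n y := by
  rw [← evenBits_mod, Nat.add_mul_mod_self_left, evenBits_mod]

theorem oddBits_add_mul (n y x : ℕ) : oddBits n (y + 4 ^ n * x) = oddBits n y := by
  rw [← oddBits_mod, Nat.add_mul_mod_self_left, oddBits_mod]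

theorem evenBits_div (k n x : ℕ) : evenBits n (x / 4 ^ k) = evenBits (k + n) x / 2 ^ k := by
  induction k generalizing x with
  | zero => simp
  | succ k ih =>
    rw [pow_succ', ← Nat.div_div_eq_div_mul, ih, add_right_comm, evenBits, pow_succ',
      ← Nat.div_div_eq_div_mul]
    congr 1
    omega

theorem evenBits_eq_mod (n k x : ℕ) : evenBits n x = evenBits (n + k) x % 2 ^ n := by
  induction n generalizing x with
  | zero => simp [evenBits, Nat.mod_one]
  | succ n ih =>
    rw [add_right_comm, evenBits, evenBits, ih, pow_succ', Nat.mod_mul]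
    congr 1
    · omega
    · congr 2
      omega

theorem gameValue_mono {n : ℕ} {f g : ℕ → ℝ} (h : ∀ x < 4 ^ n, f x ≤ g x) :
    gameValue n f ≤ gameValue n g := by
  induction n generalizing f g with
  | zero => exact h 0 (by norm_num)
  | succ n ih =>
    have key : ∀ k < 4, gameValue n (fun x => f (k + 4 * x)) ≤ gameValue n fun x => g (k + 4 * x) :=
      fun k hk => ih fun x hx => h _ (by rw [pow_succ]; omega)
    simp only [gameValue]
    have h0 := max_le_max (key 0 (by omega)) (key 2 (by omega))
    have h1 := max_le_max (key 1 (by omega)) (key 3 (by omega))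
    linarith

theorem gameValue_congr {n : ℕ} {f g : ℕ → ℝ} (h : ∀ x < 4 ^ n, f x = g x) :
    gameValue n f = gameValue n g :=
  le_antisymm (gameValue_mono fun x hx => (h x hx).le) (gameValue_mono fun x hx => (h x hx).ge)

theorem gameValue_const (n : ℕ) (c : ℝ) : (gameValue n fun _ => c) = c := by
  induction n with
  | zero => rfl
  | succ n ih => simp [gameValue, ih]

theorem gameValue_le {n : ℕ} {f : ℕ → ℝ} {B : ℝ} (h : ∀ x < 4 ^ n, f x ≤ B) :
    gameValue n f ≤ B :=
  (gameValue_mono h).trans (gameValue_const n B).le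

theorem le_gameValue {n : ℕ} {f : ℕ → ℝ} {B : ℝ} (h : ∀ x < 4 ^ n, B ≤ f x) :
    B ≤ gameValue n f :=
  (gameValue_const n B).ge.trans (gameValue_mono h)

/-- The first `a` rounds are played before the other `b` rounds. -/
theorem gameValue_add (a b : ℕ) (g : ℕ → ℝ) :
    gameValue (a + b) g = gameValue a fun y => gameValue b fun x => g (y + 4 ^ a * x) := by
  induction a generalizing g with
  | zero => simp [gameValue]
  | succ a ih =>
    rw [add_right_comm]
    simp only [gameValue, ih]
    have : ∀ k y x, k + 4 * (y + 4 ^ a * x) = k + 4 * y + 4 ^ (a + 1) * x := fun k y x => by ring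
    simp only [this]

theorem sum_range_two_mul (n : ℕ) (f : ℕ → ℝ) : ∑ s ∈ Finset.range (2 * n), f s =
    ∑ s ∈ Finset.range n, f (0 + 2 * s) + ∑ s ∈ Finset.range n, f (1 + 2 * s) := by
  induction n with
  | zero => simp
  | succ n ih =>
    rw [mul_add, mul_one, Finset.sum_range_succ, Finset.sum_range_succ, ih,
      Finset.sum_range_succ, Finset.sum_range_succ, zero_add, add_comm 1 (2 * n)]
    ring

/-- If the gain is at most `φ s`, where `s` is the number formed by the coins, then the value of the
game is at most the average of `φ`. -/
theorem gameValue_le_average {n : ℕ} {f φ : ℕ → ℝ} (h : ∀ y < 4 ^ n, f y ≤ φ (evenBits n y)) :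
    gameValue n f ≤ (∑ s ∈ Finset.range (2 ^ n), φ s) / 2 ^ n := by
  induction n generalizing f φ with
  | zero => simpa [gameValue, evenBits] using h 0 (by norm_num)
  | succ n ih =>
    have key : ∀ k < 4, gameValue n (fun x => f (k + 4 * x)) ≤
        (∑ s ∈ Finset.range (2 ^ n), φ (k % 2 + 2 * s)) / 2 ^ n := by
      refine fun k hk => ih fun x hx => (h _ (by rw [pow_succ]; omega)).trans_eq ?_
      rw [evenBits]
      congr 2
      · omega
      · congr 2
        omega
    have h0 := max_le (key 0 (by omega)) (key 2 (by omega))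
    have h1 := max_le (key 1 (by omega)) (key 3 (by omega))
    norm_num only at h0 h1
    rw [pow_succ', sum_range_two_mul, pow_succ', mul_comm (2 : ℝ), ← div_div, add_div]
    simp only [gameValue]
    linarith

/-- A lower bound from a fixed sequence `v` of bits of the player. -/
theorem le_gameValue_of_oddBits {n v : ℕ} {f : ℕ → ℝ} {B : ℝ} (hv : v < 2 ^ n)
    (h : ∀ y < 4 ^ n, oddBits n y = v → B ≤ f y) : B ≤ gameValue n f := by
  induction n generalizing f v with
  | zero =>
    exact h 0 (by norm_num) (by simp only [pow_zero] at hv; simp only [oddBits, evenBits]; omega)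
  | succ n ih =>
    have key : ∀ c < 2, B ≤ gameValue n (fun x => f (c + 2 * (v % 2) + 4 * x)) := by
      intro c hc
      refine ih (v := v / 2) (by rw [pow_succ] at hv; omega) fun x hx hx' =>
        h _ (by rw [pow_succ]; omega) ?_
      rw [oddBits_succ]
      have : (c + 2 * (v % 2) + 4 * x) / 4 = x := by omega
      rw [this, hx']
      omega
    have h0 := key 0 (by omega)
    have h1 := key 1 (by omega)
    simp only [gameValue]
    rcases Nat.mod_two_eq_zero_or_one v with hv' | hv' <;> rw [hv'] at h0 h1 <;>
      norm_num only at h0 h1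
    · have := h0.trans (le_max_left _ (gameValue n fun x => f (2 + 4 * x)))
      have := h1.trans (le_max_left _ (gameValue n fun x => f (3 + 4 * x)))
      simp only [zero_add] at *
      linarith
    · have := h0.trans (le_max_right (gameValue n fun x => f (0 + 4 * x)) _)
      have := h1.trans (le_max_right (gameValue n fun x => f (1 + 4 * x)) _)
      linarith

/-! ### Protocols with alternating coins and bits -/

namespace IPProtocol

/-- The schedule of `n` rounds, each consisting of a coin and a bit of Merlin. -/
def alternating : ℕ → List Bool
  | 0 => []
  | n + 1 => true :: false :: alternating n

theorem count_alternating (n : ℕ) (b : Bool) : (alternating n).count b = n := by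
  induction n with
  | zero => rfl
  | succ n ih => cases b <;> simp [alternating, ih]

/-- The lowest `n` binary digits of `x`. -/
def digitList : ℕ → ℕ → List Bool
  | 0, _ => []
  | n + 1, x => x.testBit 0 :: digitList n (x / 2)

/-- The number with the given binary digits. -/
def ofDigitList : List Bool → ℕ
  | [] => 0
  | b :: l => b.toNat + 2 * ofDigitList l

theorem ofDigitList_digitList (n x : ℕ) : ofDigitList (digitList n x) = x % 2 ^ n := by
  induction n generalizing x with
  | zero => simp [digitList, ofDigitList, Nat.mod_one]
  | succ n ih => rw [digitList, ofDigitList, ih, pow_succ', Nat.mod_mul, Nat.toNat_testBit]; simp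

theorem play_congr {σ σ' : List Bool → Bool} (s past cs : List Bool)
    (h : ∀ l, past <+: l → σ l = σ' l) : play σ s past cs = play σ' s past cs := by
  induction s generalizing past cs with
  | nil => simp [play]
  | cons b s ih =>
    have h' : ∀ c, ∀ l, past ++ [c] <+: l → σ l = σ' l := fun c l hl =>
      h l ((List.prefix_append _ _).trans hl)
    cases b with
    | true =>
      cases cs with
      | nil => simp [play]
      | cons c cs => simpa only [play] using ih _ _ (h' c)
    | false =>
      simp only [play]
      rw [h past (List.prefix_rfl)]
      exact ih _ _ (h' _)

/-- The probability that `Φ` holds of the transcript of `n` alternating rounds and its coins. -/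
noncomputable def roundsProb (n : ℕ) (past : List Bool) (Φ : List Bool → List Bool → Bool)
    (σ : List Bool → Bool) : ℝ :=
  (∑ ω : Fin n → Bool,
    if Φ (play σ (alternating n) past (List.ofFn ω)) (List.ofFn ω) = true then (1 : ℝ) else 0) /
    2 ^ n

theorem roundsProb_succ (n : ℕ) (past : List Bool) (Φ : List Bool → List Bool → Bool)
    (σ : List Bool → Bool) :
    roundsProb (n + 1) past Φ σ =
      (roundsProb n (past ++ [false] ++ [σ (past ++ [false])]) (fun l cs => Φ l (false :: cs)) σ +
      roundsProb n (past ++ [true] ++ [σ (past ++ [true])]) (fun l cs => Φ l (true :: cs)) σ) /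
        2 := by
  simp only [roundsProb]
  rw [← (Fin.consEquiv (fun _ : Fin (n + 1) => Bool)).sum_comp, Fintype.sum_prod_type,
    Fintype.sum_bool, ← add_div, div_div, pow_succ, add_comm]
  have h : ∀ (b : Bool) (ω : Fin n → Bool),
      List.ofFn ((Fin.consEquiv fun _ : Fin (n + 1) => Bool) (b, ω)) = b :: List.ofFn ω :=
    fun b ω => List.ofFn_cons b ω
  simp only [h, alternating, play]

/-- Merlin's optimal probability of success is the value of the game. -/
theorem isGreatest_roundsProb (n : ℕ) (past : List Bool) (Φ : List Bool → List Bool → Bool) :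
    IsGreatest (Set.range (roundsProb n past Φ)) (gameValue n fun x =>
      if Φ (past ++ digitList (2 * n) x) (digitList n (evenBits n x)) = true then 1 else 0) := by
  induction n generalizing past Φ with
  | zero =>
    refine ⟨⟨fun _ => false, ?_⟩, ?_⟩
    · simp [roundsProb, alternating, play, digitList, gameValue]
    · rintro _ ⟨σ, rfl⟩
      simp [roundsProb, alternating, play, digitList, gameValue]
  | succ n ih =>
    have hnext : ∀ c m : Bool,
        (gameValue n fun x => if Φ (past ++ digitList (2 * (n + 1)) (c.toNat + 2 * m.toNat + 4 * x))
          (digitList (n + 1) (evenBits (n + 1) (c.toNat + 2 * m.toNat + 4 * x))) = true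
          then (1 : ℝ) else 0) =
        gameValue n fun x => if Φ ((past ++ [c] ++ [m]) ++ digitList (2 * n) x)
          (c :: digitList n (evenBits n x)) = true then (1 : ℝ) else 0 := by
      intro c m
      congr 1
      ext x
      have e1 : digitList (2 * (n + 1)) (c.toNat + 2 * m.toNat + 4 * x) =
          c :: m :: digitList (2 * n) x := by
        change digitList (2 * n + 2) _ = _
        simp only [digitList]
        have a1 : (c.toNat + 2 * m.toNat + 4 * x) / 2 / 2 = x := by
          cases c <;> cases m <;> simp <;> omega
        rw [a1, Nat.testBit_zero, Nat.testBit_zero]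
        congr 1
        · cases c <;> cases m <;> simp <;> omega
        · congr 1
          cases c <;> cases m <;> simp <;> omega
      have e2 : digitList (n + 1) (evenBits (n + 1) (c.toNat + 2 * m.toNat + 4 * x)) =
          c :: digitList n (evenBits n x) := by
        have a1 : (c.toNat + 2 * m.toNat + 4 * x) / 4 = x := by
          cases c <;> cases m <;> simp <;> omega
        have a2 : (c.toNat + 2 * m.toNat + 4 * x) % 2 = c.toNat := by
          cases c <;> simp <;> omega
        rw [evenBits, a1, a2, digitList, Nat.testBit_zero]
        congr 1
        · cases c <;> simp
        · congr 1
          cases c <;> simp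
          omega
      rw [e1, e2]
      simp
    have h00 := hnext false false
    have h01 := hnext false true
    have h10 := hnext true false
    have h11 := hnext true true
    simp only [Bool.toNat_false, Bool.toNat_true, mul_zero, mul_one, zero_add, add_zero,
      Nat.reduceAdd] at h00 h01 h10 h11
    simp only [gameValue, zero_add]
    rw [h00, h01, h10, h11]
    constructor
    · have hc : ∀ c, ∃ (m : Bool) (σ : List Bool → Bool),
          roundsProb n (past ++ [c] ++ [m]) (fun l cs => Φ l (c :: cs)) σ =
          max (gameValue n fun x => if Φ ((past ++ [c] ++ [false]) ++ digitList (2 * n) x)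
            (c :: digitList n (evenBits n x)) = true then (1 : ℝ) else 0)
          (gameValue n fun x => if Φ ((past ++ [c] ++ [true]) ++ digitList (2 * n) x)
            (c :: digitList n (evenBits n x)) = true then (1 : ℝ) else 0) := by
        intro c
        obtain ⟨σ₀, h₀⟩ := (ih (past ++ [c] ++ [false]) fun l cs => Φ l (c :: cs)).1
        obtain ⟨σ₁, h₁⟩ := (ih (past ++ [c] ++ [true]) fun l cs => Φ l (c :: cs)).1
        rcases max_choice (gameValue n fun x => if Φ ((past ++ [c] ++ [false]) ++
            digitList (2 * n) x) (c :: digitList n (evenBits n x)) = true then (1 : ℝ) else 0)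
          (gameValue n fun x => if Φ ((past ++ [c] ++ [true]) ++ digitList (2 * n) x)
            (c :: digitList n (evenBits n x)) = true then (1 : ℝ) else 0) with h | h
        · exact ⟨false, σ₀, by rw [h, h₀]⟩
        · exact ⟨true, σ₁, by rw [h, h₁]⟩
      choose m σ hσ using hc
      -- the strategies after the two outcomes of the coin are glued together
      let τ : List Bool → Bool := fun l =>
        if l = past ++ [true] then m true else if l = past ++ [false] then m false
        else if past ++ [true] <+: l then σ true l else σ false l
      have hτ : ∀ c, τ (past ++ [c]) = m c := by
        intro c
        cases c <;> simp [τ]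
      have hτ' : ∀ c l, past ++ [c] ++ [m c] <+: l → τ l = σ c l := by
        rintro c l ⟨l', rfl⟩
        cases c <;> simp [τ]
      refine ⟨τ, ?_⟩
      rw [roundsProb_succ, hτ, hτ, ← hσ false, ← hσ true]
      have hp : ∀ c, roundsProb n (past ++ [c] ++ [m c]) (fun l cs => Φ l (c :: cs)) τ =
          roundsProb n (past ++ [c] ++ [m c]) (fun l cs => Φ l (c :: cs)) (σ c) := by
        intro c
        simp only [roundsProb, play_congr _ _ _ (hτ' c)]
      rw [hp, hp]
    · rintro _ ⟨σ, rfl⟩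
      rw [roundsProb_succ]
      have hc : ∀ c, roundsProb n (past ++ [c] ++ [σ (past ++ [c])]) (fun l cs => Φ l (c :: cs)) σ ≤
          max (gameValue n fun x => if Φ ((past ++ [c] ++ [false]) ++ digitList (2 * n) x)
            (c :: digitList n (evenBits n x)) = true then (1 : ℝ) else 0)
          (gameValue n fun x => if Φ ((past ++ [c] ++ [true]) ++ digitList (2 * n) x)
            (c :: digitList n (evenBits n x)) = true then (1 : ℝ) else 0) := by
        intro c
        have := fun b => (ih (past ++ [c] ++ [b]) fun l cs => Φ l (c :: cs)).2 ⟨σ, rfl⟩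
        cases hb : σ (past ++ [c])
        · exact le_max_of_le_left (this false)
        · exact le_max_of_le_right (this true)
      have := hc false
      have := hc true
      linarith

variable {X Y : Type}

/-- The protocol with `n` alternating rounds in which Bob's message is the `b`-bit number `β y e`,
where `e` is the number formed by the coins, and Alice accepts if `α x c m` holds for the number `c`
formed by the transcript and the number `m` sent by Bob. -/
def ofNumbers (n b : ℕ) (α : X → ℕ → ℕ → Bool) (β : Y → ℕ → ℕ) : IPProtocol X Y where
  schedule := alternating n
  bobBits := b
  bob := fun y cs i => (β y (ofDigitList cs)).testBit i
  alice := fun x l msg => α x (ofDigitList l) (Nat.ofBits msg)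

/-- Alice's decisions in `ofNumbers`, for all transcripts followed by all messages of Bob. -/
def aliceTensor (n b : ℕ) (α : X → ℕ → ℕ → Bool) (x : X) : Tensor (2 * (n + b)) := fun i =>
  α x (Nat.ofBits i % 4 ^ n) (oddBits b (Nat.ofBits i / 4 ^ n))

/-- The indicator of Bob's message in `ofNumbers`. -/
def bobTensor (n b : ℕ) (β : Y → ℕ → ℕ) (y : Y) : Tensor (2 * (n + b)) := fun i =>
  decide (β y (evenBits n (Nat.ofBits i)) = oddBits b (Nat.ofBits i / 4 ^ n))

/-- In the last `b` rounds of the game the player can do no better than to guess Bob's message. -/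
theorem tropSim_eq_gameValue (n b : ℕ) (α : X → ℕ → ℕ → Bool) (β : Y → ℕ → ℕ) (x : X) (y : Y)
    (hβ : ∀ e, β y e < 2 ^ b) :
    tropSim (aliceTensor n b α x) (bobTensor n b β y) =
      gameValue n fun c => if α x c (β y (evenBits n c)) = true then 1 else 0 := by
  have h := altExpMax_eq_gameValue (n + b) fun c =>
    if α x (c % 4 ^ n) (oddBits b (c / 4 ^ n)) = true ∧
      β y (evenBits n c) = oddBits b (c / 4 ^ n) then (1 : ℝ) else 0
  simp only [tropSim, aliceTensor, bobTensor, decide_eq_true_eq]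
  rw [h, gameValue_add]
  refine gameValue_congr fun c hc => ?_
  have h4 : 0 < 4 ^ n := by positivity
  simp only [Nat.add_mul_mod_self_left, Nat.mod_eq_of_lt hc, evenBits_add_mul,
    Nat.add_mul_div_left _ _ h4, Nat.div_eq_of_lt hc, zero_add]
  split_ifs with hα
  · refine le_antisymm (gameValue_le fun z _ => ?_)
      (le_gameValue_of_oddBits (hβ (evenBits n c)) fun z _ hz => ?_)
    · split_ifs <;> norm_num
    · rw [if_pos ⟨by rwa [hz], hz.symm⟩]
  · refine le_antisymm (gameValue_le fun z _ => ?_) (le_gameValue fun z _ => ?_)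
    · rw [if_neg]
      rintro ⟨h1, h2⟩
      exact hα (by rwa [h2])
    · split_ifs <;> norm_num

/-- The tropical similarity of the tensors of the protocol is the best probability of success of
Merlin. -/
theorem ofNumbers_isOptimal (n b : ℕ) (α : X → ℕ → ℕ → Bool) (β : Y → ℕ → ℕ) (x : X) (y : Y)
    (hβ : ∀ e, β y e < 2 ^ b) :
    (ofNumbers n b α β).IsOptimalAcceptProb x y
      (tropSim (aliceTensor n b α x) (bobTensor n b β y)) := by
  rw [tropSim_eq_gameValue n b α β x y hβ]
  have key := isGreatest_roundsProb n [] fun l cs => α x (ofDigitList l) (β y (ofDigitList cs))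
  have e1 : (gameValue n fun c => if α x c (β y (evenBits n c)) = true then (1 : ℝ) else 0) =
      gameValue n fun c => if α x (ofDigitList ([] ++ digitList (2 * n) c))
        (β y (ofDigitList (digitList n (evenBits n c)))) = true then 1 else 0 := by
    refine gameValue_congr fun c hc => ?_
    rw [List.nil_append, ofDigitList_digitList, ofDigitList_digitList,
      Nat.mod_eq_of_lt (evenBits_lt n c), pow_mul, Nat.mod_eq_of_lt (by norm_num; exact hc)]
  rw [e1, IsOptimalAcceptProb]
  have hn : (ofNumbers n b α β).numCoins = n := count_alternating n true
  have e2 : (ofNumbers n b α β).acceptProb x y =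
      roundsProb n [] fun l cs => α x (ofDigitList l) (β y (ofDigitList cs)) := by
    ext σ
    have aux : ∀ (k : ℕ), k = n → ∀ P : List Bool → Bool,
        ((Finset.univ.filter fun ω : Fin k → Bool => P (List.ofFn ω) = true).card : ℝ) / 2 ^ k =
          (∑ ω : Fin n → Bool, if P (List.ofFn ω) = true then (1 : ℝ) else 0) / 2 ^ n := by
      rintro k rfl P
      rw [Finset.sum_boole]
    refine (aux _ hn fun cs => (ofNumbers n b α β).alice x
      (play σ (ofNumbers n b α β).schedule [] cs) ((ofNumbers n b α β).bob y cs)).trans ?_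
    have h : ∀ cs, Nat.ofBits (fun i : Fin b => (β y (ofDigitList cs)).testBit i) =
        β y (ofDigitList cs) := fun cs => by
      rw [Nat.ofBits_testBit, Nat.mod_eq_of_lt (hβ _)]
    simp only [ofNumbers, roundsProb, h]
  rw [e2]
  exact key

end IPProtocol

/-! ### Functions of bounded degree in a coordinate -/

namespace Arithmetization

open Function

section Degree

variable {F : Type} [Field F]

/-- `f` is a polynomial function of degree at most `d`. -/
def IsPolyLE (d : ℕ) (f : F → F) : Prop :=
  ∃ P : Polynomial F, P.natDegree ≤ d ∧ ∀ x, f x = P.eval x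

/-- As a function of the coordinate `j` alone, `g` is a polynomial of degree at most `d`. -/
def CoordDeg (d j : ℕ) (g : (ℕ → F) → F) : Prop :=
  ∀ r, IsPolyLE d fun x => g (update r j x)

theorem IsPolyLE.mono {d d' : ℕ} {f : F → F} (h : IsPolyLE d f) (hd : d ≤ d') : IsPolyLE d' f := by
  obtain ⟨P, h1, h2⟩ := h
  exact ⟨P, h1.trans hd, h2⟩

theorem IsPolyLE.const (d : ℕ) (c : F) : IsPolyLE d fun _ => c :=
  ⟨Polynomial.C c, by simp, by simp⟩

theorem IsPolyLE.id : IsPolyLE 1 fun x : F => x :=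
  ⟨Polynomial.X, Polynomial.natDegree_X_le, by simp⟩

theorem IsPolyLE.add {d : ℕ} {f g : F → F} (hf : IsPolyLE d f) (hg : IsPolyLE d g) :
    IsPolyLE d fun x => f x + g x := by
  obtain ⟨P, h1, h2⟩ := hf
  obtain ⟨Q, h3, h4⟩ := hg
  exact ⟨P + Q, Polynomial.natDegree_add_le_of_degree_le h1 h3, fun x => by simp [h2, h4]⟩

theorem IsPolyLE.sub {d : ℕ} {f g : F → F} (hf : IsPolyLE d f) (hg : IsPolyLE d g) :
    IsPolyLE d fun x => f x - g x := by
  obtain ⟨P, h1, h2⟩ := hf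
  obtain ⟨Q, h3, h4⟩ := hg
  exact ⟨P - Q, (Polynomial.natDegree_sub_le_of_le h1 h3).trans (max_self d).le,
    fun x => by simp [h2, h4]⟩

theorem IsPolyLE.mul {d e : ℕ} {f g : F → F} (hf : IsPolyLE d f) (hg : IsPolyLE e g) :
    IsPolyLE (d + e) fun x => f x * g x := by
  obtain ⟨P, h1, h2⟩ := hf
  obtain ⟨Q, h3, h4⟩ := hg
  exact ⟨P * Q, Polynomial.natDegree_mul_le_of_le h1 h3, fun x => by simp [h2, h4]⟩

theorem IsPolyLE.sum {ι : Type} {d : ℕ} {f : ι → F → F} (s : Finset ι)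
    (h : ∀ i ∈ s, IsPolyLE d (f i)) : IsPolyLE d fun x => ∑ i ∈ s, f i x := by
  classical
  induction s using Finset.induction_on with
  | empty => simpa using IsPolyLE.const d 0
  | insert a s ha ih =>
    simp only [Finset.sum_insert ha]
    exact (h a (by simp)).add (ih fun i hi => h i (by simp [hi]))

theorem IsPolyLE.eq_affine {f : F → F} (h : IsPolyLE 1 f) (y : F) :
    f y = (1 - y) * f 0 + y * f 1 := by
  obtain ⟨P, h1, h2⟩ := h
  rw [Polynomial.eq_X_add_C_of_natDegree_le_one h1] at h2
  simp only [h2, Polynomial.eval_add, Polynomial.eval_mul, Polynomial.eval_C, Polynomial.eval_X]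
  ring

theorem CoordDeg.mono {d d' j : ℕ} {g : (ℕ → F) → F} (h : CoordDeg d j g) (hd : d ≤ d') :
    CoordDeg d' j g := fun r => (h r).mono hd

theorem CoordDeg.update_const {d j : ℕ} {g : (ℕ → F) → F} (h : CoordDeg d j g) (i : ℕ) (c : F) :
    CoordDeg d j fun r => g (update r i c) := by
  intro r
  by_cases hij : i = j
  · subst hij
    simpa using IsPolyLE.const d _
  · simp only [update_comm (Ne.symm hij)]
    exact h _

/-- Replacing a constant coordinate by an affine one raises the degree along a path by one. -/
theorem CoordDeg.isPolyLE_update {d v : ℕ} {g : (ℕ → F) → F} (h : CoordDeg 1 v g)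
    {ρ : F → ℕ → F} {a : F → F} (ha : IsPolyLE 1 a)
    (hρ : ∀ c, IsPolyLE d fun s => g (update (ρ s) v c)) :
    IsPolyLE (1 + d) fun s => g (update (ρ s) v (a s)) := by
  have : (fun s => g (update (ρ s) v (a s))) = fun s =>
      (1 - a s) * g (update (ρ s) v 0) + a s * g (update (ρ s) v 1) := by
    ext s
    exact (h (ρ s)).eq_affine (a s)
  rw [this]
  exact (((IsPolyLE.const 1 1).sub ha).mul (hρ 0)).add (ha.mul (hρ 1))

/-- A function that is affine in three coordinates has degree at most three along a path on which
these coordinates are affine. -/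
theorem CoordDeg.isPolyLE_three {j u v : ℕ} {g : (ℕ → F) → F} (hj : CoordDeg 1 j g)
    (hu : CoordDeg 1 u g) (hv : CoordDeg 1 v g) (r : ℕ → F) {a b c : F → F}
    (ha : IsPolyLE 1 a) (hb : IsPolyLE 1 b) (hc : IsPolyLE 1 c) :
    IsPolyLE 3 fun s => g (update (update (update r j (a s)) u (b s)) v (c s)) := by
  refine hv.isPolyLE_update (d := 2) hc fun y => ?_
  refine (hu.update_const v y).isPolyLE_update (d := 1) hb fun x => ?_
  exact ((hj.update_const v y).update_const u x).isPolyLE_update (d := 0) (ρ := fun _ => r) ha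
    fun z => .const 0 _

end Degree

/-! ### Reduction steps -/

/-- The steps of the interactive reduction.  Coordinates of points are numbered by `ℕ`. -/
inductive Step
  /-- linearization in the coordinate `j` -/
  | lin (j : ℕ)
  /-- disjunction over the two values of the coordinate `j` -/
  | ex (j : ℕ)
  /-- conjunction over the two values of the coordinate `j` -/
  | all (j : ℕ)
  /-- depending on the coordinate `b`, the coordinates `u`, `v` are replaced by `u`, `x` or by
  `x`, `v` -/
  | sel (b u v x : ℕ)

namespace Step

variable {F : Type} [Field F]

/-- The value at `r` of the function after the step, in terms of two values of the function before
the step. -/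
def check : Step → (ℕ → F) → F → F → F
  | lin j, r, a, b => (1 - r j) * a + r j * b
  | ex _, _, a, b => a + b - a * b
  | all _, _, a, b => a * b
  | sel .., _, a, _ => a

/-- The points at which the function before the step matters for its value at `r` after the step. -/
def move : Step → (ℕ → F) → F → ℕ → F
  | lin j, r, s => update r j s
  | ex j, r, s => update r j s
  | all j, r, s => update r j s
  | sel b u v x, r, _ =>
    update (update r u ((1 - r b) * r u + r b * r x)) v ((1 - r b) * r x + r b * r v)

/-- The operation on functions that belongs to a step. -/
def op (st : Step) (g : (ℕ → F) → F) (r : ℕ → F) : F :=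
  st.check r (g (st.move r 0)) (g (st.move r 1))

theorem lin_coordDeg_self {d j : ℕ} {g : (ℕ → F) → F} (hd : 1 ≤ d) :
    CoordDeg d j ((lin j).op g) := by
  intro r
  simp only [op, check, move, update_idem, update_self]
  exact ((((IsPolyLE.const 1 1).sub .id).mul (.const 0 _)).add (IsPolyLE.id.mul (.const 0 _))).mono
    hd

theorem lin_coordDeg {d i j : ℕ} {g : (ℕ → F) → F} (hij : i ≠ j) (h : CoordDeg d j g) :
    CoordDeg d j ((lin i).op g) := by
  intro r
  simp only [op, check, move, update_of_ne hij]
  have h0 := ((IsPolyLE.const 0 (1 - r i)).mul (h.update_const i 0 r)).add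
    ((IsPolyLE.const 0 (r i)).mul (h.update_const i 1 r))
  exact h0.mono (by omega)

theorem all_coordDeg {i j : ℕ} {g : (ℕ → F) → F} (h : CoordDeg 1 j g) :
    CoordDeg 3 j ((all i).op g) := fun r =>
  ((h.update_const i 0 r).mul (h.update_const i 1 r)).mono (by omega)

theorem ex_coordDeg {i j : ℕ} {g : (ℕ → F) → F} (h : CoordDeg 1 j g) :
    CoordDeg 3 j ((ex i).op g) := fun r =>
  ((((h.update_const i 0 r).add (h.update_const i 1 r)).mono (by omega)).sub
    ((h.update_const i 0 r).mul (h.update_const i 1 r))).mono (by omega)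

theorem update_apply_isPolyLE (r : ℕ → F) (j i : ℕ) : IsPolyLE 1 fun s => update r j s i := by
  by_cases h : i = j
  · subst h
    simpa using IsPolyLE.id
  · simpa [h] using IsPolyLE.const 1 (r i)

/-- Provided that `b` is not among the coordinates that are combined with its help, these are
affine in each coordinate. -/
theorem sel_isPolyLE (r : ℕ → F) {j b u x : ℕ} (hu : u ≠ b) (hx : x ≠ b) :
    IsPolyLE 1 fun s =>
      (1 - update r j s b) * update r j s u + update r j s b * update r j s x := by
  by_cases h : b = j
  · subst h
    simp only [update_self, update_of_ne hu, update_of_ne hx]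
    exact ((((IsPolyLE.const 1 1).sub .id).mul (.const 0 _)).add (IsPolyLE.id.mul (.const 0 _)))
  · simp only [update_of_ne h]
    exact (((IsPolyLE.const 0 (1 - r b)).mul (update_apply_isPolyLE r j u)).add
      ((IsPolyLE.const 0 (r b)).mul (update_apply_isPolyLE r j x))).mono (by omega)

theorem sel_coordDeg {b u v x j : ℕ} {g : (ℕ → F) → F} (hu : u ≠ b) (hv : v ≠ b) (hx : x ≠ b)
    (hj' : CoordDeg 1 j g) (hu' : CoordDeg 1 u g) (hv' : CoordDeg 1 v g) :
    CoordDeg 3 j ((sel b u v x).op g) := fun r =>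
  hj'.isPolyLE_three hu' hv' r .id (sel_isPolyLE r hu hx) (sel_isPolyLE r hx hv)

/-- The line of points on which a step depends moves in one coordinate, unless it is a single
point. -/
theorem isPolyLE_move {g : (ℕ → F) → F} (st : Step) {d : ℕ}
    (h : ∀ j, st = lin j ∨ st = ex j ∨ st = all j → CoordDeg d j g) (r : ℕ → F) :
    IsPolyLE d fun s => g (st.move r s) := by
  cases st with
  | lin j => exact h j (by simp) r
  | ex j => exact h j (by simp) r
  | all j => exact h j (by simp) r
  | sel b u v x => exact IsPolyLE.const d (g ((sel b u v x).move r 0))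

end Step

/-- The function obtained from `g` by the first `q` of the given steps. -/
def iterOp {F : Type} [Field F] (st : ℕ → Step) (g : (ℕ → F) → F) : ℕ → (ℕ → F) → F
  | 0 => g
  | q + 1 => (st q).op (iterOp st g q)

/-! ### The interactive reduction as a game -/

section Game

variable {p : ℕ} [Fact p.Prime]

/-- The value at `s` of the cubic polynomial whose coefficients are the digits of `V` in base
`B`. -/
def cubic (B V : ℕ) (s : ZMod p) : ZMod p :=
  (V % B : ℕ) + s * ((V / B % B : ℕ) + s * ((V / B / B % B : ℕ) + s * (V / B / B / B % B : ℕ)))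

/-- The decision about the claim that the function after `q` steps has the value `c` at `r`.  The
number `x` encodes the rest of the transcript.  For each step, Merlin sends a cubic polynomial, that
is claimed to describe the function before the step on the line of points that matter, and a
random point on this line is chosen.  In the end the claim is tested by `fin`. -/
def verdict (st : ℕ → Step) (m : ℕ) (fin : (ℕ → ZMod p) → ZMod p → Bool) :
    ℕ → (ℕ → ZMod p) → ZMod p → ℕ → Bool
  | 0, r, c, _ => fin r c
  | q + 1, r, c, x =>
    let V := oddBits (4 * (m + 1)) x
    let s : ZMod p := (evenBits m (x / 4 ^ (4 * (m + 1))) : ℕ)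
    decide ((st q).check r (cubic (2 ^ (m + 1)) V 0) (cubic (2 ^ (m + 1)) V 1) = c) &&
      verdict st m fin q ((st q).move r s) (cubic (2 ^ (m + 1)) V s)
        (x / 4 ^ (4 * (m + 1)) / 4 ^ m)

/-- The number of rounds for each step: `4 * (m + 1)` rounds in which Merlin sends the coefficients
of a cubic polynomial and the coins are ignored, and `m` rounds in which the coins form a random
point and Merlin's bits are ignored. -/
abbrev roundsPerStep (m : ℕ) : ℕ := 4 * (m + 1) + m

/-- Merlin can send every polynomial function of degree at most `3`. -/
theorem exists_cubic_eq {m : ℕ} (hp : p ≤ 2 ^ (m + 1)) {f : ZMod p → ZMod p}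
    (hf : IsPolyLE 3 f) : ∃ V < 2 ^ (4 * (m + 1)), ∀ s, cubic (2 ^ (m + 1)) V s = f s := by
  obtain ⟨P, h1, h2⟩ := hf
  set B := 2 ^ (m + 1) with hB
  have hB4 : 2 ^ (4 * (m + 1)) = B * (B * (B * B)) := by rw [hB]; ring
  have hB0 : 0 < B := by positivity
  have hc : ∀ i, (P.coeff i).val < B := fun i => (ZMod.val_lt _).trans_le hp
  have h0 := hc 0
  have h1' := hc 1
  have h2' := hc 2
  have h3 := hc 3
  refine ⟨(P.coeff 0).val + B * ((P.coeff 1).val + B * ((P.coeff 2).val + B * (P.coeff 3).val)),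
    ?_, fun s => ?_⟩
  · rw [hB4]
    have key : ∀ a b c : ℕ, a < B → b < c → a + B * b < B * c := by
      intro a b c ha hb
      have := Nat.mul_le_mul_left B (Nat.succ_le_of_lt hb)
      rw [Nat.mul_succ] at this
      omega
    exact key _ _ _ h0 (key _ _ _ h1' (key _ _ _ h2' h3))
  · simp only [cubic, Nat.add_mul_mod_self_left, Nat.mod_eq_of_lt, Nat.add_mul_div_left _ _ hB0,
      Nat.div_eq_of_lt, zero_add, h0, h1', h2', h3, ZMod.natCast_val, ZMod.cast_id', id_eq]
    rw [h2, Polynomial.eval_eq_sum_range' (n := 4) (by omega)]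
    simp only [Finset.sum_range_succ, Finset.range_zero, Finset.sum_empty]
    ring

theorem isPolyLE_cubic (B V : ℕ) : IsPolyLE 3 (cubic (p := p) B V) :=
  ((IsPolyLE.const 3 _).add ((IsPolyLE.id.mul (((IsPolyLE.const 2 _).add
    ((IsPolyLE.id.mul (((IsPolyLE.const 1 _).add
      ((IsPolyLE.id.mul (.const 0 _)).mono (by omega)))))))))))

/-- The decision depends only on the digits of the rounds that belong to its steps. -/
theorem verdict_mod (st : ℕ → Step) (m : ℕ) (fin : (ℕ → ZMod p) → ZMod p → Bool) (q : ℕ)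
    (r : ℕ → ZMod p) (c : ZMod p) (x : ℕ) :
    verdict st m fin q r c (x % 4 ^ (q * roundsPerStep m)) = verdict st m fin q r c x := by
  induction q generalizing r c x with
  | zero => rfl
  | succ q ih =>
    have e : 4 ^ ((q + 1) * roundsPerStep m) =
        4 ^ (4 * (m + 1)) * (4 ^ m * 4 ^ (q * roundsPerStep m)) := by
      rw [← pow_add, ← pow_add]
      congr 1
      ring
    have h1 : oddBits (4 * (m + 1)) (x % 4 ^ ((q + 1) * roundsPerStep m)) =
        oddBits (4 * (m + 1)) x := by
      rw [← oddBits_mod, e, Nat.mod_mul_right_mod, oddBits_mod]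
    have h2 : x % 4 ^ ((q + 1) * roundsPerStep m) / 4 ^ (4 * (m + 1)) =
        x / 4 ^ (4 * (m + 1)) % (4 ^ m * 4 ^ (q * roundsPerStep m)) := by
      rw [e, Nat.mod_mul_right_div_self]
    simp only [verdict]
    rw [h1, h2, Nat.mod_mul_right_div_self, ih, ← evenBits_mod, Nat.mod_mul_right_mod, evenBits_mod]

/-- The rounds of a step are separated into Merlin's choice, the coins, and the game for the other
steps, if the gain is `0` unless Merlin's choice passes a test. -/
theorem gameValue_step (m R : ℕ) (A : ℕ → Bool) (f : ℕ → ℕ → ℕ → ℝ) :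
    (gameValue (roundsPerStep m + R) fun x => if A (oddBits (4 * (m + 1)) x) = true then
      f (oddBits (4 * (m + 1)) x) (evenBits m (x / 4 ^ (4 * (m + 1))))
        (x / 4 ^ (4 * (m + 1)) / 4 ^ m) else 0) =
    gameValue (4 * (m + 1)) fun y => gameValue m fun z =>
      if A (oddBits (4 * (m + 1)) y) = true then
        gameValue R fun x => f (oddBits (4 * (m + 1)) y) (evenBits m z) x else 0 := by
  rw [add_assoc, gameValue_add]
  refine gameValue_congr fun y hy => ?_
  rw [gameValue_add]
  refine gameValue_congr fun z hz => ?_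
  have h4 : ∀ n, 0 < 4 ^ n := fun n => by positivity
  simp only [oddBits_add_mul, Nat.add_mul_div_left _ _ (h4 _), Nat.div_eq_of_lt hy,
    Nat.div_eq_of_lt hz, zero_add, evenBits_add_mul]
  split_ifs
  · rfl
  · exact gameValue_const _ _

theorem gameValue_verdict_succ (st : ℕ → Step) (m : ℕ) (fin : (ℕ → ZMod p) → ZMod p → Bool) (q : ℕ)
    (r : ℕ → ZMod p) (c : ZMod p) :
    (gameValue ((q + 1) * roundsPerStep m) fun x =>
      if verdict st m fin (q + 1) r c x = true then 1 else 0) =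
    gameValue (4 * (m + 1)) fun y => gameValue m fun z =>
      if (st q).check r (cubic (2 ^ (m + 1)) (oddBits (4 * (m + 1)) y) 0)
        (cubic (2 ^ (m + 1)) (oddBits (4 * (m + 1)) y) 1) = c then
        gameValue (q * roundsPerStep m) fun x =>
          if verdict st m fin q ((st q).move r (evenBits m z : ℕ))
            (cubic (2 ^ (m + 1)) (oddBits (4 * (m + 1)) y) (evenBits m z : ℕ)) x = true then 1
          else 0
      else 0 := by
  have h := gameValue_step m (q * roundsPerStep m)
    (fun V => decide ((st q).check r (cubic (2 ^ (m + 1)) V 0) (cubic (2 ^ (m + 1)) V 1) = c))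
    fun V s x => if verdict st m fin q ((st q).move r (s : ℕ)) (cubic (2 ^ (m + 1)) V (s : ℕ)) x =
      true then 1 else 0
  simp only [decide_eq_true_eq] at h
  rw [← h, add_mul, one_mul, add_comm]
  congr 1
  ext x
  simp only [verdict, Bool.and_eq_true, decide_eq_true_eq]
  split_ifs <;> tauto

variable {st : ℕ → Step} {m : ℕ} {fin : (ℕ → ZMod p) → ZMod p → Bool}
  {g : (ℕ → ZMod p) → ZMod p}

/-- A true claim is accepted with certainty if Merlin sends the right polynomials. -/
theorem gameValue_verdict_eq_one (hp : p ≤ 2 ^ (m + 1))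
    {S : ℕ} (hdeg : ∀ q < S, ∀ r, IsPolyLE 3 fun s => iterOp st g q ((st q).move r s))
    (hfin : ∀ r c, fin r c = true ↔ g r = c) {q : ℕ} (hq : q ≤ S) (r : ℕ → ZMod p) (c : ZMod p)
    (h : iterOp st g q r = c) :
    (gameValue (q * roundsPerStep m) fun x =>
      if verdict st m fin q r c x = true then 1 else 0) = 1 := by
  refine le_antisymm (gameValue_le fun x _ => by split_ifs <;> norm_num) ?_
  induction q generalizing r c with
  | zero =>
    simp only [zero_mul, gameValue]
    change (1 : ℝ) ≤ if fin r c = true then 1 else 0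
    rw [if_pos ((hfin r c).2 h)]
  | succ q ih =>
    rw [gameValue_verdict_succ]
    obtain ⟨V, hV, hV'⟩ := exists_cubic_eq hp (hdeg q (by omega) r)
    refine le_gameValue_of_oddBits hV fun y _ hy => le_gameValue fun z _ => ?_
    rw [hy, if_pos (by rw [hV', hV']; exact h)]
    exact ih (by omega) _ _ (hV' _).symm

/-- A false claim survives a step only if the random point is a root of the difference of two
distinct cubic polynomials. -/
theorem gameValue_verdict_le (hp : 2 ^ m ≤ p)
    {S : ℕ} (hdeg : ∀ q < S, ∀ r, IsPolyLE 3 fun s => iterOp st g q ((st q).move r s))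
    (hfin : ∀ r c, fin r c = true ↔ g r = c) {q : ℕ} (hq : q ≤ S) (r : ℕ → ZMod p) (c : ZMod p)
    (h : iterOp st g q r ≠ c) :
    (gameValue (q * roundsPerStep m) fun x =>
      if verdict st m fin q r c x = true then 1 else 0) ≤ 3 * q / 2 ^ m := by
  induction q generalizing r c with
  | zero =>
    simp only [zero_mul, gameValue]
    change (if fin r c = true then (1 : ℝ) else 0) ≤ _
    rw [if_neg fun h' => h ((hfin r c).1 h')]
    simp
  | succ q ih =>
    rw [gameValue_verdict_succ]
    refine gameValue_le fun y _ => ?_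
    set V := oddBits (4 * (m + 1)) y
    split_ifs with hc
    swap
    · rw [gameValue_const]
      positivity
    obtain ⟨P, hP, hP'⟩ := hdeg q (by omega) r
    obtain ⟨Q, hQ, hQ'⟩ := isPolyLE_cubic (p := p) (2 ^ (m + 1)) V
    have hne : P - Q ≠ 0 := by
      intro h0
      rw [sub_eq_zero] at h0
      -- Alice's check and the operation of the step use the same combination of two values
      apply h
      rw [← hc]
      simp only [iterOp, Step.op, hP', hQ', h0]
    have hdeg' : (P - Q).natDegree ≤ 3 := Polynomial.natDegree_sub_le_of_le hP hQ
    -- the random points at which the two polynomials agree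
    set bad := (Finset.range (2 ^ m)).filter fun s : ℕ => (P - Q).eval (s : ZMod p) = 0 with hbad
    have hcard : bad.card ≤ 3 := by
      have : bad.card ≤ (P - Q).roots.toFinset.card := by
        refine Finset.card_le_card_of_injOn (fun s : ℕ => (s : ZMod p)) (fun s hs => ?_) ?_
        · simp only [hbad, Finset.coe_filter, Set.mem_ofPred_eq] at hs
          simpa [hne] using hs.2
        · intro s hs s' hs' hss
          simp only [hbad, Finset.coe_filter, Set.mem_ofPred_eq, Finset.mem_range] at hs hs'
          have := (ZMod.natCast_eq_natCast_iff' s s' p).1 hss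
          rwa [Nat.mod_eq_of_lt (by omega), Nat.mod_eq_of_lt (by omega)] at this
      exact this.trans ((Multiset.toFinset_card_le _).trans ((Polynomial.card_roots' _).trans
        hdeg'))
    -- at a bad point the gain is at most one, and at any other point the new claim is false, too
    refine (gameValue_le_average (φ := fun s => (if s ∈ bad then 1 else 0) + 3 * q / 2 ^ m)
      fun z _ => ?_).trans ?_
    · have hs := evenBits_lt m z
      by_cases hb : evenBits m z ∈ bad
      · simp only [hb, if_true]
        refine le_trans (gameValue_le (B := 1) fun x _ => by split_ifs <;> norm_num) ?_
        have : (0 : ℝ) ≤ 3 * q / 2 ^ m := by positivity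
        linarith
      · simp only [hb, if_false, zero_add]
        apply ih (by omega)
        intro h0
        apply hb
        simp only [hbad, Finset.mem_filter, Finset.mem_range, hs, true_and, Polynomial.eval_sub]
        rw [← hP', ← hQ', sub_eq_zero]
        exact h0
    · rw [Finset.sum_add_distrib, Finset.sum_boole, Finset.sum_const, Finset.card_range,
        nsmul_eq_mul]
      have h1 : ((Finset.range (2 ^ m)).filter fun s => s ∈ bad).card ≤ 3 :=
        (Finset.card_le_card fun s hs => (Finset.mem_filter.1 hs).2).trans hcard
      have h2 : (((Finset.range (2 ^ m)).filter fun s => s ∈ bad).card : ℝ) ≤ 3 := by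
        exact_mod_cast h1
      have h3 : (0 : ℝ) < 2 ^ m := by positivity
      push_cast
      rw [mul_div_cancel₀ _ h3.ne']
      gcongr
      linarith

end Game

end Arithmetization

/-! ### The sequence of reduction steps -/

namespace Arithmetization

open Function

/-- The operation that precedes the `b`-th round of linearizations.  Points have `l` coordinates for
a layer, followed by three groups of `w` coordinates for nodes `u`, `v` and `x`.  Each level
consists of `2 * w + 1` operations, which turn a function `f (i, u, v)` into
`∃ x, ∀ β, f ((i, β), (u, x) or (x, v))`, where `β` is the coordinate number `b / (2 * w + 1)` of
the layer. -/
def blockStep (l w b : ℕ) : Step :=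
  if b % (2 * w + 1) < w then
    .sel (b / (2 * w + 1)) (l + b % (2 * w + 1)) (l + w + b % (2 * w + 1))
      (l + 2 * w + b % (2 * w + 1))
  else if b % (2 * w + 1) = w then .all (b / (2 * w + 1))
  else .ex (l + 2 * w + (b % (2 * w + 1) - (w + 1)))

/-- Each operation is followed by the linearization of all `l + 3 * w` coordinates. -/
def stepAt (l w q : ℕ) : Step :=
  if q % (l + 3 * w + 1) = 0 then blockStep l w (q / (l + 3 * w + 1))
  else .lin (q % (l + 3 * w + 1) - 1)

/-- The total number of steps. -/
def numSteps (l w : ℕ) : ℕ := l * (2 * w + 1) * (l + 3 * w + 1)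

theorem stepAt_mul (l w b : ℕ) : stepAt l w (b * (l + 3 * w + 1)) = blockStep l w b := by
  rw [stepAt, Nat.mul_mod_left, if_pos rfl, Nat.mul_div_cancel _ (by omega)]

theorem stepAt_lin (l w b : ℕ) {i : ℕ} (hi : i < l + 3 * w) :
    stepAt l w (b * (l + 3 * w + 1) + 1 + i) = .lin i := by
  have h : (b * (l + 3 * w + 1) + 1 + i) % (l + 3 * w + 1) = i + 1 := by
    rw [add_assoc, Nat.mul_add_mod_of_lt (by omega)]
    omega
  rw [stepAt, h, if_neg (by omega), Nat.add_sub_cancel]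

section Degree

variable {F : Type} [Field F] {l w : ℕ} {g : (ℕ → F) → F}

theorem blockStep_coordDeg {b j : ℕ} (hb : b < l * (2 * w + 1)) (hj : j < l + 3 * w)
    (h : ∀ j < l + 3 * w, CoordDeg 1 j g) : CoordDeg 3 j ((blockStep l w b).op g) := by
  have hlev : b / (2 * w + 1) < l := Nat.div_lt_of_lt_mul (by rw [mul_comm (2 * w + 1)]; exact hb)
  have hblk : b % (2 * w + 1) < 2 * w + 1 := Nat.mod_lt _ (by omega)
  unfold blockStep
  split_ifs with h1 h2
  · exact Step.sel_coordDeg (by omega) (by omega) (by omega) (h j hj) (h _ (by omega))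
      (h _ (by omega))
  · exact Step.all_coordDeg (h j hj)
  · exact Step.ex_coordDeg (h j hj)

theorem iterOp_lin_coordDeg {b : ℕ} (hb : b < l * (2 * w + 1))
    (h : ∀ j < l + 3 * w, CoordDeg 1 j (iterOp (stepAt l w) g (b * (l + 3 * w + 1))))
    {i : ℕ} (hi : i ≤ l + 3 * w) : ∀ j < l + 3 * w,
      CoordDeg (if j < i then 1 else 3) j
        (iterOp (stepAt l w) g (b * (l + 3 * w + 1) + 1 + i)) := by
  induction i with
  | zero =>
    intro j hj
    simpa only [not_lt_zero, if_false, iterOp, stepAt_mul] using blockStep_coordDeg hb hj h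
  | succ i ih =>
    intro j hj
    rw [← add_assoc, iterOp, stepAt_lin l w b (by omega)]
    by_cases hij : i = j
    · subst hij
      exact Step.lin_coordDeg_self (by split_ifs <;> omega)
    · refine Step.lin_coordDeg hij ((ih (by omega) j hj).mono ?_)
      split_ifs <;> omega

/-- After each round of linearizations, all coordinates have degree at most one. -/
theorem iterOp_coordDeg_one (hg : ∀ j < l + 3 * w, CoordDeg 1 j g) {b : ℕ}
    (hb : b ≤ l * (2 * w + 1)) : ∀ j < l + 3 * w,
      CoordDeg 1 j (iterOp (stepAt l w) g (b * (l + 3 * w + 1))) := by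
  induction b with
  | zero => simpa [iterOp] using hg
  | succ b ih =>
    intro j hj
    have h := iterOp_lin_coordDeg (by omega) (ih (by omega)) le_rfl j hj
    rw [if_pos hj] at h
    rwa [show (b + 1) * (l + 3 * w + 1) = b * (l + 3 * w + 1) + 1 + (l + 3 * w) by ring]

/-- Merlin's polynomials have degree at most `3`: before an operation all coordinates have degree at
most one, and each operation raises the degrees to at most `3`. -/
theorem isPolyLE_iterOp_move (hg : ∀ j < l + 3 * w, CoordDeg 1 j g) {q : ℕ}
    (hq : q < numSteps l w) (r : ℕ → F) :
    IsPolyLE 3 fun s => iterOp (stepAt l w) g q ((stepAt l w q).move r s) := by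
  have hb : q / (l + 3 * w + 1) < l * (2 * w + 1) :=
    Nat.div_lt_of_lt_mul (by rw [mul_comm]; exact hq)
  have hlev : q / (l + 3 * w + 1) / (2 * w + 1) < l :=
    Nat.div_lt_of_lt_mul (by rw [mul_comm (2 * w + 1)]; exact hb)
  have hblk : q / (l + 3 * w + 1) % (2 * w + 1) < 2 * w + 1 := Nat.mod_lt _ (by omega)
  have hdiv := Nat.div_add_mod' q (l + 3 * w + 1)
  have hlt := Nat.mod_lt q (show l + 3 * w + 1 > 0 by omega)
  apply Step.isPolyLE_move
  intro j hj
  rcases Nat.eq_zero_or_pos (q % (l + 3 * w + 1)) with h0 | h0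
  · rw [stepAt, if_pos h0, blockStep] at hj
    have hjn : j < l + 3 * w := by
      split_ifs at hj <;> simp at hj <;> omega
    rw [h0, add_zero] at hdiv
    have := iterOp_coordDeg_one hg hb.le j hjn
    rw [hdiv] at this
    exact this.mono (by omega)
  · rw [stepAt, if_neg h0.ne'] at hj
    simp at hj
    have := iterOp_lin_coordDeg hb (iterOp_coordDeg_one hg hb.le)
      (i := q % (l + 3 * w + 1) - 1) (by omega) j (by omega)
    rw [show q / (l + 3 * w + 1) * (l + 3 * w + 1) + 1 + (q % (l + 3 * w + 1) - 1) = q by omega]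
      at this
    exact this.mono (by split_ifs <;> omega)

end Degree

/-! ### Multilinear extensions -/

section Extension

variable {F : Type} [Field F]

/-- The multilinear polynomial in `n` variables that is `1` at the binary digits of `z` and `0` at
the other points with entries in `{0, 1}`. -/
def chi (n z : ℕ) (r : ℕ → F) : F :=
  ∏ j ∈ Finset.range n, if z.testBit j then r j else 1 - r j

/-- The multilinear extension of `e`, as a function of the first `n` binary digits. -/
def extension (n : ℕ) (e : ℕ → ℕ) (r : ℕ → F) : F :=
  ∑ z ∈ Finset.range (2 ^ n), chi n z r * (e z : F)

theorem extension_add (n : ℕ) (e e' : ℕ → ℕ) (r : ℕ → F) :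
    extension n (fun z => e z + e' z) r = extension n e r + extension n e' r := by
  simp only [extension, ← Finset.sum_add_distrib]
  exact Finset.sum_congr rfl fun z _ => by push_cast; ring

theorem chi_coordDeg (n z j : ℕ) : CoordDeg 1 j (chi (F := F) n z) := by
  intro r
  by_cases hj : j ∈ Finset.range n
  · have h : (fun x => chi n z (update r j x)) = fun x =>
        (if z.testBit j then x else 1 - x) *
          ∏ i ∈ (Finset.range n).erase j, if z.testBit i then r i else 1 - r i := by
      ext x
      rw [chi, ← Finset.mul_prod_erase _ _ hj, update_self]
      congr 1
      refine Finset.prod_congr rfl fun i hi => ?_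
      rw [update_of_ne (Finset.ne_of_mem_erase hi)]
    rw [h]
    refine IsPolyLE.mul (d := 1) ?_ (.const 0 _)
    split_ifs
    · exact .id
    · exact (IsPolyLE.const 1 1).sub .id
  · have h : (fun x => chi n z (update r j x)) = fun _ => chi n z r := by
      ext x
      refine Finset.prod_congr rfl fun i hi => ?_
      rw [update_of_ne (ne_of_mem_of_not_mem hi hj)]
    rw [h]
    exact .const _ _

theorem extension_coordDeg (n : ℕ) (e : ℕ → ℕ) (j : ℕ) :
    CoordDeg 1 j (extension (F := F) n e) := fun r =>
  IsPolyLE.sum _ fun z _ => (chi_coordDeg n z j r).mul (.const 0 _)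

/-- The point with entries in `{0, 1}` given by a Boolean assignment. -/
def embed (z : ℕ → Bool) (j : ℕ) : F := if z j then 1 else 0

theorem embed_update (z : ℕ → Bool) (j : ℕ) (b : Bool) :
    embed (F := F) (update z j b) = update (embed z) j (if b then 1 else 0) := by
  ext i
  by_cases h : i = j
  · subst h
    simp [embed]
  · simp [embed, h]

/-- The number with binary digits `z o, …, z (o + k - 1)`, beginning with the lowest one. -/
def digits (o k : ℕ) (z : ℕ → Bool) : ℕ := Nat.ofBits fun i : Fin k => z (o + i)

theorem digits_zero (o : ℕ) (z : ℕ → Bool) : digits o 0 z = 0 := rfl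

theorem digits_succ (o k : ℕ) (z : ℕ → Bool) :
    digits o (k + 1) z = (z o).toNat + 2 * digits (o + 1) k z := by
  rw [digits, Nat.ofBits_succ, add_comm]
  congr 2
  rw [digits]
  congr 1
  ext i
  simp only [comp_apply, Fin.val_succ]
  congr 1
  omega

theorem digits_lt (o k : ℕ) (z : ℕ → Bool) : digits o k z < 2 ^ k := Nat.ofBits_lt_two_pow _

theorem digits_congr {o o' k : ℕ} {z z' : ℕ → Bool} (h : ∀ i < k, z (o + i) = z' (o' + i)) :
    digits o k z = digits o' k z' := by
  unfold digits
  congr 1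
  ext i
  exact h i i.2

theorem digits_add (o a b : ℕ) (z : ℕ → Bool) :
    digits o (a + b) z = digits o a z + 2 ^ a * digits (o + a) b z := by
  induction a generalizing o with
  | zero => simp [digits_zero]
  | succ a ih =>
    rw [add_right_comm, digits_succ, ih, digits_succ, pow_succ', add_right_comm o 1 a,
      add_assoc o a 1]
    ring

theorem digits_testBit (o k : ℕ) {c : ℕ} (hc : c < 2 ^ k) :
    digits o k (fun j => c.testBit (j - o)) = c := by
  unfold digits
  simp only [Nat.add_sub_cancel_left]
  rw [Nat.ofBits_testBit, Nat.mod_eq_of_lt hc]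

theorem chi_embed {n x : ℕ} (hx : x < 2 ^ n) (z : ℕ → Bool) :
    chi n x (embed z : ℕ → F) = if x = digits 0 n z then 1 else 0 := by
  have hz : ∀ j < n, (digits 0 n z).testBit j = z j := by
    intro j hj
    rw [digits, Nat.testBit_ofBits_lt _ _ hj]
    simp
  split_ifs with h
  · refine Finset.prod_eq_one fun j hj => ?_
    rw [h, hz j (Finset.mem_range.1 hj), embed]
    cases z j <;> simp
  · obtain ⟨j, hj⟩ := Nat.exists_testBit_ne_of_ne h
    have hjn : j < n := by
      by_contra hjn
      have h2 : 2 ^ n ≤ 2 ^ j := Nat.pow_le_pow_right (by omega) (by omega)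
      rw [Nat.testBit_lt_two_pow (hx.trans_le h2),
        Nat.testBit_lt_two_pow ((digits_lt 0 n z).trans_le h2)] at hj
      exact hj rfl
    refine Finset.prod_eq_zero (Finset.mem_range.2 hjn) ?_
    rw [hz j hjn] at hj
    rw [embed]
    revert hj
    cases z j <;> cases x.testBit j <;> simp

theorem extension_embed (n : ℕ) (e : ℕ → ℕ) (z : ℕ → Bool) :
    extension n e (embed z : ℕ → F) = (e (digits 0 n z) : F) := by
  rw [extension, Finset.sum_eq_single_of_mem (digits 0 n z) (Finset.mem_range.2 (digits_lt _ _ _))]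
  · rw [chi_embed (digits_lt _ _ _), if_pos rfl, one_mul]
  · intro x hx hne
    rw [chi_embed (Finset.mem_range.1 hx), if_neg hne, zero_mul]

end Extension

/-! ### Boolean meaning of the steps -/

/-- The operation on predicates that belongs to a step. -/
def Step.boolOp : Step → ((ℕ → Bool) → Prop) → (ℕ → Bool) → Prop
  | lin _, R, z => R z
  | ex j, R, z => R (update z j false) ∨ R (update z j true)
  | all j, R, z => R (update z j false) ∧ R (update z j true)
  | sel b u v x, R, z =>
    R (update (update z u (if z b then z x else z u)) v (if z b then z v else z x))

/-- At points with entries in `{0, 1}`, `g` is the indicator function of `R`. -/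
def Represents {F : Type} [Field F] (g : (ℕ → F) → F) (R : (ℕ → Bool) → Prop) : Prop :=
  ∀ z, (R z → g (embed z) = 1) ∧ (¬ R z → g (embed z) = 0)

/-- The steps compute in the field what they mean for Boolean values. -/
theorem Represents.op {F : Type} [Field F] {g : (ℕ → F) → F} {R : (ℕ → Bool) → Prop}
    (h : Represents g R) (st : Step) : Represents (st.op g) (st.boolOp R) := by
  intro z
  have h0 : ∀ j, (update (embed z) j 0 : ℕ → F) = embed (update z j false) := fun j => by
    rw [embed_update]
    simp
  have h1 : ∀ j, (update (embed z) j 1 : ℕ → F) = embed (update z j true) := fun j => by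
    rw [embed_update]
    simp
  cases st with
  | lin j =>
    have hg : (Step.lin j).op g (embed z) = g (embed z) := by
      simp only [Step.op, Step.check, Step.move]
      have hz : update z j (z j) = z := update_eq_self j z
      cases hj : z j <;> rw [hj] at hz
      · have : (embed z j : F) = 0 := by simp [embed, hj]
        rw [this, h0, hz]
        ring
      · have : (embed z j : F) = 1 := by simp [embed, hj]
        rw [this, h1, hz]
        ring
    rw [hg]
    exact h z
  | ex j =>
    simp only [Step.op, Step.check, Step.move, Step.boolOp, h0, h1]
    have a := h (update z j false)
    have b := h (update z j true)
    by_cases ha : R (update z j false) <;> by_cases hb : R (update z j true) <;>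
      simp [ha, hb, a, b]
  | all j =>
    simp only [Step.op, Step.check, Step.move, Step.boolOp, h0, h1]
    have a := h (update z j false)
    have b := h (update z j true)
    by_cases ha : R (update z j false) <;> by_cases hb : R (update z j true) <;>
      simp [ha, hb, a, b]
  | sel b u v x =>
    simp only [Step.op, Step.check, Step.move, Step.boolOp]
    have key : ∀ i k, (1 - embed z b) * (embed z i : F) + embed z b * embed z k =
        if (if z b then z k else z i) then 1 else 0 := by
      intro i k
      cases hb : z b <;> simp [embed, hb]
    rw [key, key, ← embed_update, ← embed_update]
    exact h _

section Levels

variable (l w : ℕ) (R : (ℕ → Bool) → Prop)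

/-- The predicate obtained from `R` by the first `b` rounds of steps. -/
def blockRel : ℕ → (ℕ → Bool) → Prop
  | 0 => R
  | b + 1 => (blockStep l w b).boolOp (blockRel b)

/-- The linearizations do not change the values at points with entries in `{0, 1}`. -/
theorem represents_iterOp {F : Type} [Field F] {g : (ℕ → F) → F} (h : Represents g R) (b : ℕ) :
    Represents (iterOp (stepAt l w) g (b * (l + 3 * w + 1))) (blockRel l w R b) := by
  induction b with
  | zero => simpa [iterOp, blockRel] using h
  | succ b ih =>
    have hi : ∀ i ≤ l + 3 * w, Represents (iterOp (stepAt l w) g (b * (l + 3 * w + 1) + 1 + i))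
        (blockRel l w R (b + 1)) := by
      intro i
      induction i with
      | zero =>
        intro _
        rw [add_zero, iterOp, stepAt_mul]
        exact ih.op _
      | succ i hi =>
        intro hi'
        rw [← add_assoc, iterOp, stepAt_lin l w b (by omega)]
        exact (hi (by omega)).op _
    have := hi _ le_rfl
    rwa [show (b + 1) * (l + 3 * w + 1) = b * (l + 3 * w + 1) + 1 + (l + 3 * w) by ring]

theorem blockStep_level (lev : ℕ) {i : ℕ} (hi : i < 2 * w + 1) :
    blockStep l w (lev * (2 * w + 1) + i) =
      if i < w then .sel lev (l + i) (l + w + i) (l + 2 * w + i)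
      else if i = w then .all lev else .ex (l + 2 * w + (i - (w + 1))) := by
  have h1 : (lev * (2 * w + 1) + i) % (2 * w + 1) = i := Nat.mul_add_mod_of_lt hi
  have h2 : (lev * (2 * w + 1) + i) / (2 * w + 1) = lev := by
    rw [mul_comm, Nat.mul_add_div (by omega), Nat.div_eq_of_lt hi, add_zero]
  rw [blockStep, h1, h2]

/-- The first `k` coordinates of the two nodes are selected according to the coordinate `lev`. -/
def selected (lev k : ℕ) (z : ℕ → Bool) (j : ℕ) : Bool :=
  if l ≤ j ∧ j < l + k then (if z lev then z (j + 2 * w) else z j)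
  else if l + w ≤ j ∧ j < l + w + k then (if z lev then z j else z (j + w))
  else z j

theorem selected_left (lev k : ℕ) (z : ℕ → Bool) {j : ℕ} (h : l ≤ j ∧ j < l + k) :
    selected l w lev k z j = if z lev then z (j + 2 * w) else z j := if_pos h

theorem selected_right (lev k : ℕ) (z : ℕ → Bool) {j : ℕ} (hk : k ≤ w)
    (h : l + w ≤ j ∧ j < l + w + k) :
    selected l w lev k z j = if z lev then z j else z (j + w) := by
  rw [selected, if_neg (by omega), if_pos h]

theorem selected_of_not (lev k : ℕ) (z : ℕ → Bool) {j : ℕ} (h : ¬ (l ≤ j ∧ j < l + k))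
    (h' : ¬ (l + w ≤ j ∧ j < l + w + k)) : selected l w lev k z j = z j := by
  rw [selected, if_neg h, if_neg h']

variable {l w}

/-- The first `k` steps of a level replace the two nodes by the ends of the selected half. -/
theorem blockRel_sel {lev k : ℕ} (hlev : lev < l) (hk : k ≤ w) (z : ℕ → Bool) :
    blockRel l w R (lev * (2 * w + 1) + k) z ↔
      blockRel l w R (lev * (2 * w + 1)) (selected l w lev k z) := by
  induction k generalizing z with
  | zero =>
    have : selected l w lev 0 z = z := by
      ext j
      rw [selected, if_neg (by omega), if_neg (by omega)]
    rw [this, add_zero]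
  | succ k ih =>
    rw [← add_assoc, blockRel, blockStep_level l w lev (by omega), if_pos (by omega), Step.boolOp,
      ih (by omega)]
    apply iff_of_eq
    congr 1
    ext j
    have e1 : lev ≠ l + k := by omega
    have e2 : lev ≠ l + w + k := by omega
    have e3 : l + k ≠ l + w + k := by omega
    by_cases c1 : j = l + k
    · subst c1
      rw [selected_of_not l w lev k _ (by omega) (by omega),
        selected_left l w lev (k + 1) _ (by omega), update_of_ne e3, update_self,
        show l + k + 2 * w = l + 2 * w + k by ring]
    by_cases c2 : j = l + w + k
    · subst c2
      rw [selected_of_not l w lev k _ (by omega) (by omega),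
        selected_right l w lev (k + 1) _ (by omega) (by omega), update_self,
        show l + w + k + w = l + 2 * w + k by ring]
    have c3 : ∀ i, i ≠ l + k → i ≠ l + w + k → update (update z (l + k)
        (if z lev = true then z (l + 2 * w + k) else z (l + k))) (l + w + k)
        (if z lev = true then z (l + w + k) else z (l + 2 * w + k)) i = z i := fun i h1 h2 => by
      rw [update_of_ne h2, update_of_ne h1]
    by_cases d1 : l ≤ j ∧ j < l + k
    · rw [selected_left l w lev k _ d1, selected_left l w lev (k + 1) _ (by omega), c3 lev e1 e2,
        c3 j c1 c2, c3 (j + 2 * w) (by omega) (by omega)]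
    by_cases d2 : l + w ≤ j ∧ j < l + w + k
    · rw [selected_right l w lev k _ (by omega) d2, selected_right l w lev (k + 1) _ hk (by omega),
        c3 lev e1 e2, c3 j c1 c2, c3 (j + w) (by omega) (by omega)]
    · rw [selected_of_not l w lev k _ d1 d2,
        selected_of_not l w lev (k + 1) _ (by omega) (by omega), c3 j c1 c2]

/-- The last steps of a level quantify over the coordinates of the midpoint. -/
theorem blockRel_ex {lev k : ℕ} (hk : k ≤ w) (z : ℕ → Bool) :
    blockRel l w R (lev * (2 * w + 1) + (w + 1) + k) z ↔ ∃ c : ℕ → Bool,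
      blockRel l w R (lev * (2 * w + 1) + (w + 1))
        fun j => if l + 2 * w ≤ j ∧ j < l + 2 * w + k then c j else z j := by
  induction k generalizing z with
  | zero =>
    have : ∀ c : ℕ → Bool,
        (fun j => if l + 2 * w ≤ j ∧ j < l + 2 * w + 0 then c j else z j) = z := by
      intro c
      ext j
      rw [if_neg (by omega)]
    simp only [this, exists_const]
    rfl
  | succ k ih =>
    have hst : blockStep l w (lev * (2 * w + 1) + (w + 1) + k) = .ex (l + 2 * w + k) := by
      rw [add_assoc, blockStep_level l w lev (by omega), if_neg (by omega), if_neg (by omega)]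
      congr 2
      omega
    rw [← add_assoc, blockRel, hst, Step.boolOp, ih (by omega), ih (by omega), ← exists_or]
    constructor
    · have key : ∀ (c : ℕ → Bool) (b : Bool),
          (fun j => if l + 2 * w ≤ j ∧ j < l + 2 * w + k then c j
            else update z (l + 2 * w + k) b j) =
          fun j => if l + 2 * w ≤ j ∧ j < l + 2 * w + (k + 1) then
            update c (l + 2 * w + k) b j else z j := by
        intro c b
        ext j
        by_cases hj : j = l + 2 * w + k
        · subst hj
          rw [if_neg (by omega), if_pos (by omega), update_self, update_self]
        · rw [update_of_ne hj, update_of_ne hj]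
          by_cases hd : l + 2 * w ≤ j ∧ j < l + 2 * w + k
          · rw [if_pos hd, if_pos (by omega)]
          · rw [if_neg hd, if_neg (by omega)]
      rintro ⟨c, hc | hc⟩
      · exact ⟨_, key c false ▸ hc⟩
      · exact ⟨_, key c true ▸ hc⟩
    · rintro ⟨c, hc⟩
      have key : (fun j => if l + 2 * w ≤ j ∧ j < l + 2 * w + (k + 1) then c j else z j) =
          fun j => if l + 2 * w ≤ j ∧ j < l + 2 * w + k then c j
            else update z (l + 2 * w + k) (c (l + 2 * w + k)) j := by
        ext j
        by_cases hj : j = l + 2 * w + k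
        · subst hj
          rw [if_pos (by omega), if_neg (by omega), update_self]
        · rw [update_of_ne hj]
          by_cases hd : l + 2 * w ≤ j ∧ j < l + 2 * w + k
          · rw [if_pos hd, if_pos (by omega)]
          · rw [if_neg hd, if_neg (by omega)]
      rw [key] at hc
      refine ⟨c, ?_⟩
      cases hb : c (l + 2 * w + k) <;> rw [hb] at hc
      · exact Or.inl hc
      · exact Or.inr hc

end Levels

/-! ### Paths in layered graphs -/

/-- There is a path of `n` edges from the node `a` of layer `i` to the node `b` of layer `i + n`. -/
def Connected (E : ℕ → ℕ → ℕ → Prop) : ℕ → ℕ → ℕ → ℕ → Prop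
  | _, 0, a, b => a = b
  | i, n + 1, a, b => ∃ c, E i a c ∧ Connected E (i + 1) n c b

section Paths

variable {E : ℕ → ℕ → ℕ → Prop}

theorem connected_add (i m n a b : ℕ) : Connected E i (m + n) a b ↔
    ∃ c, Connected E i m a c ∧ Connected E (i + m) n c b := by
  induction m generalizing i a with
  | zero => simp [Connected]
  | succ m ih =>
    rw [add_right_comm]
    simp only [Connected, ih, show i + (m + 1) = i + 1 + m by ring]
    constructor
    · rintro ⟨c, h1, d, h2, h3⟩
      exact ⟨d, ⟨c, h1, h2⟩, h3⟩
    · rintro ⟨d, ⟨c, h1, h2⟩, h3⟩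
      exact ⟨c, h1, d, h2, h3⟩

theorem Connected.lt {w : ℕ} (hE : ∀ i a b, a < 2 ^ w → E i a b → b < 2 ^ w) {i n a b : ℕ}
    (ha : a < 2 ^ w) (h : Connected E i n a b) : b < 2 ^ w := by
  induction n generalizing i a with
  | zero => exact h ▸ ha
  | succ n ih =>
    obtain ⟨c, h1, h2⟩ := h
    exact ih (hE _ _ _ ha h1) h2

theorem connected_iff_path (i n a b : ℕ) : Connected E i n a b ↔
    ∃ f : ℕ → ℕ, f 0 = a ∧ f n = b ∧ ∀ k < n, E (i + k) (f k) (f (k + 1)) := by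
  induction n generalizing i a with
  | zero =>
    simp only [Connected, not_lt_zero, false_imp_iff, implies_true, and_true]
    constructor
    · rintro rfl
      exact ⟨fun _ => a, rfl, rfl⟩
    · rintro ⟨f, rfl, rfl⟩
      rfl
  | succ n ih =>
    simp only [Connected, ih]
    constructor
    · rintro ⟨c, h, f, rfl, h1, h2⟩
      refine ⟨fun k => if k = 0 then a else f (k - 1), by simp, by simp [h1], fun k hk => ?_⟩
      rcases k with _ | k
      · simpa using h
      · simpa [add_assoc, add_comm 1 k] using h2 k (by omega)
    · rintro ⟨f, rfl, h1, h2⟩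
      refine ⟨f 1, by simpa using h2 0 (by omega), fun k => f (k + 1), rfl, h1, fun k hk => ?_⟩
      simpa [add_assoc, add_comm 1 k] using h2 (k + 1) (by omega)

/-- After `lev` levels, the predicate says that there is a path of `2 ^ lev` edges from `u` to `v`
starting in a layer whose number has the higher digits of the layer coordinates: the steps of one
level guess the midpoint of the path and check both halves. -/
theorem blockRel_iff_connected {l w : ℕ} (hE : ∀ i a b, a < 2 ^ w → E i a b → b < 2 ^ w)
    {lev : ℕ} (hlev : lev ≤ l) (z : ℕ → Bool) :
    blockRel l w (fun z => E (digits 0 l z) (digits l w z) (digits (l + w) w z))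
      (lev * (2 * w + 1)) z ↔
    Connected E (2 ^ lev * digits lev (l - lev) z) (2 ^ lev) (digits l w z)
      (digits (l + w) w z) := by
  induction lev generalizing z with
  | zero => simp [blockRel, Connected]
  | succ lev ih =>
    set R : (ℕ → Bool) → Prop := fun z => E (digits 0 l z) (digits l w z) (digits (l + w) w z)
      with hR
    set i := digits (lev + 1) (l - (lev + 1)) z with hi
    have hall : ∀ z : ℕ → Bool, digits (lev + 1) (l - (lev + 1)) z = i →
        (blockRel l w R (lev * (2 * w + 1) + (w + 1)) z ↔
        Connected E (2 ^ (lev + 1) * i) (2 ^ lev) (digits l w z) (digits (l + 2 * w) w z) ∧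
        Connected E (2 ^ (lev + 1) * i + 2 ^ lev) (2 ^ lev) (digits (l + 2 * w) w z)
          (digits (l + w) w z)) := by
      intro z hz
      rw [← add_assoc, blockRel, blockStep_level l w lev (by omega), if_neg (by omega), if_pos rfl,
        Step.boolOp, blockRel_sel R (by omega) le_rfl, blockRel_sel R (by omega) le_rfl,
        ih (by omega), ih (by omega)]
      have hd : ∀ b, digits lev (l - lev) (selected l w lev w (update z lev b)) =
          b.toNat + 2 * i := by
        intro b
        rw [show l - lev = l - (lev + 1) + 1 by omega, digits_succ]
        congr 1
        · rw [selected, if_neg (by omega), if_neg (by omega), update_self]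
        · rw [← hz]
          congr 1
          refine digits_congr fun k hk => ?_
          rw [selected, if_neg (by omega), if_neg (by omega), update_of_ne (by omega)]
      have hu : ∀ b, digits l w (selected l w lev w (update z lev b)) =
          if b then digits (l + 2 * w) w z else digits l w z := by
        intro b
        have : ∀ k < w, selected l w lev w (update z lev b) (l + k) =
            if b then z (l + 2 * w + k) else z (l + k) := by
          intro k hk
          rw [selected, if_pos (by omega), update_self, update_of_ne (by omega),
            update_of_ne (by omega), show l + k + 2 * w = l + 2 * w + k by ring]
        cases b
        · exact digits_congr (by simpa using this)
        · exact digits_congr (by simpa using this)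
      have hv : ∀ b, digits (l + w) w (selected l w lev w (update z lev b)) =
          if b then digits (l + w) w z else digits (l + 2 * w) w z := by
        intro b
        have : ∀ k < w, selected l w lev w (update z lev b) (l + w + k) =
            if b then z (l + w + k) else z (l + 2 * w + k) := by
          intro k hk
          rw [selected, if_neg (by omega), if_pos (by omega), update_self, update_of_ne (by omega),
            update_of_ne (by omega), show l + w + k + w = l + 2 * w + k by ring]
        cases b
        · exact digits_congr (by simpa using this)
        · exact digits_congr (by simpa using this)
      rw [hd, hd, hu, hu, hv, hv]
      simp only [Bool.toNat_false, Bool.toNat_true, if_true, Bool.false_eq_true, if_false]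
      rw [show 2 ^ lev * (0 + 2 * i) = 2 ^ (lev + 1) * i by ring,
        show 2 ^ lev * (1 + 2 * i) = 2 ^ (lev + 1) * i + 2 ^ lev by ring]
    rw [show (lev + 1) * (2 * w + 1) = lev * (2 * w + 1) + (w + 1) + w by ring,
      blockRel_ex R le_rfl, pow_succ, mul_two, connected_add, ← mul_two, ← pow_succ]
    have hsub : ∀ c : ℕ → Bool, (blockRel l w R (lev * (2 * w + 1) + (w + 1))
        fun j => if l + 2 * w ≤ j ∧ j < l + 2 * w + w then c j else z j) ↔
        Connected E (2 ^ (lev + 1) * i) (2 ^ lev) (digits l w z) (digits (l + 2 * w) w c) ∧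
        Connected E (2 ^ (lev + 1) * i + 2 ^ lev) (2 ^ lev) (digits (l + 2 * w) w c)
          (digits (l + w) w z) := by
      intro c
      rw [hall _ (digits_congr fun k hk => if_neg (by omega))]
      rw [digits_congr (o := l) (o' := l) (z' := z) fun k hk => if_neg (by omega),
        digits_congr (o := l + w) (o' := l + w) (z' := z) fun k hk => if_neg (by omega),
        digits_congr (o := l + 2 * w) (o' := l + 2 * w) (z' := c) fun k hk => if_pos (by omega)]
    simp only [hsub]
    constructor
    · rintro ⟨c, hc⟩
      exact ⟨_, hc⟩
    · rintro ⟨c, h1, h2⟩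
      have hc : c < 2 ^ w := h1.lt hE (digits_lt _ _ _)
      refine ⟨fun j => c.testBit (j - (l + 2 * w)), ?_⟩
      rw [digits_testBit _ _ hc]
      exact ⟨h1, h2⟩

end Paths

end Arithmetization

/-! ### Branching programs -/

namespace BranchingProgram

open Arithmetization

variable {W T n : ℕ}

/-- The edges of `P` that are marked with the right values of the input `x`, followed by layers that
only have edges from each node to itself. -/
def edgeRel (P : BranchingProgram W T n) (x : Fin n → Bool) (i a b : ℕ) : Prop :=
  if hi : i < T - 1 then
    ∃ (ha : a < W) (hb : b < W), P.edge ⟨i, hi⟩ ⟨a, ha⟩ ⟨b, hb⟩ (x (P.var ⟨i, hi⟩)) = true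
  else a = b

theorem edgeRel_lt (P : BranchingProgram W T n) (x : Fin n → Bool) {w : ℕ} (hw : W ≤ 2 ^ w)
    (i a b : ℕ) (ha : a < 2 ^ w) (h : P.edgeRel x i a b) : b < 2 ^ w := by
  unfold edgeRel at h
  split_ifs at h
  · obtain ⟨_, hb, _⟩ := h
    omega
  · exact h ▸ ha

theorem connected_edgeRel_of_le (P : BranchingProgram W T n) (x : Fin n → Bool) {i : ℕ}
    (hi : T - 1 ≤ i) (k a b : ℕ) : Connected (P.edgeRel x) i k a b ↔ a = b := by
  induction k generalizing i a with
  | zero => rfl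
  | succ k ih =>
    simp only [Connected, ih (show T - 1 ≤ i + 1 by omega), edgeRel, dif_neg (not_lt.2 hi)]
    simp

/-- Acceptance is the existence of a path of any length `N ≥ T - 1`, since the additional layers
only prolong it. -/
theorem connected_iff_accepts (hW : 2 ≤ W) (hT : 2 ≤ T) (P : BranchingProgram W T n)
    (x : Fin n → Bool) {N : ℕ} (hN : T - 1 ≤ N) :
    Connected (P.edgeRel x) 0 N 0 0 ↔ P.Accepts x := by
  obtain ⟨k, rfl⟩ := Nat.exists_eq_add_of_le hN
  rw [connected_add]
  simp only [P.connected_edgeRel_of_le x (show T - 1 ≤ 0 + (T - 1) by omega), exists_eq_right]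
  rw [connected_iff_path]
  constructor
  · rintro ⟨f, h0, h1, h2⟩
    have hf : ∀ i < T, f i < W := by
      intro i hi
      rcases Nat.lt_or_ge i (T - 1) with h | h
      · have := h2 i h
        rw [zero_add, edgeRel, dif_pos h] at this
        exact this.1
      · rw [show i = T - 1 by omega, h1]
        omega
    refine ⟨fun i => ⟨f i, hf i i.2⟩, ?_, fun i => ?_⟩
    · rintro i (h | h)
      · simp [h, h0]
      · simp [show (i : ℕ) = T - 1 by omega, h1]
    · have := h2 i i.2
      simp only [zero_add] at this
      rw [edgeRel, dif_pos i.2] at this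
      obtain ⟨_, _, h⟩ := this
      exact h
  · rintro ⟨f, h1, h2⟩
    refine ⟨fun i => if hi : i < T then f ⟨i, hi⟩ else 0, ?_, ?_, fun i hi => ?_⟩
    · beta_reduce
      rw [dif_pos (by omega)]
      exact h1 _ (Or.inl rfl)
    · beta_reduce
      rw [dif_pos (by omega)]
      exact h1 _ (Or.inr (by simp; omega))
    · beta_reduce
      rw [dif_pos (by omega), dif_pos (by omega), zero_add, edgeRel, dif_pos hi]
      exact ⟨Fin.is_lt _, Fin.is_lt _, h2 ⟨i, hi⟩⟩

/-- The bit that says whether there is an edge marked `c`, or `0` outside the program. -/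
def edgeBit (P : BranchingProgram W T n) (i a b : ℕ) (c : Bool) : ℕ :=
  if h : i < T - 1 ∧ a < W ∧ b < W then (P.edge ⟨i, h.1⟩ ⟨a, h.2.1⟩ ⟨b, h.2.2⟩ c).toNat else 0

/-- The variable queried in layer `i`, or `0` outside the program. -/
def varAt (P : BranchingProgram W T n) (i : ℕ) : ℕ :=
  if h : i < T - 1 then P.var ⟨i, h⟩ else 0

/-- The entry `v` of a string, or `false` outside the string. -/
def bitAt {h : ℕ} (x : Fin h → Bool) (v : ℕ) : Bool := if hv : v < h then x ⟨v, hv⟩ else false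

variable {h : ℕ} (P : BranchingProgram W T (h + h))

/-- The part of `edgeRel` that depends on Alice's string: the edges of the layers that query one of
her variables, and the additional layers. -/
def aliceEntry (x : Fin h → Bool) (i a b : ℕ) : ℕ :=
  if i < T - 1 then if P.varAt i < h then P.edgeBit i a b (bitAt x (P.varAt i)) else 0
  else if a = b then 1 else 0

/-- The part of `edgeRel` that depends on Bob's string. -/
def bobEntry (y : Fin h → Bool) (i a b : ℕ) : ℕ :=
  if i < T - 1 then if P.varAt i < h then 0 else P.edgeBit i a b (bitAt y (P.varAt i - h)) else 0

theorem aliceEntry_add_bobEntry (x y : Fin h → Bool) (i a b : ℕ) :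
    (P.edgeRel (Fin.append x y) i a b → P.aliceEntry x i a b + P.bobEntry y i a b = 1) ∧
    (¬ P.edgeRel (Fin.append x y) i a b → P.aliceEntry x i a b + P.bobEntry y i a b = 0) := by
  unfold edgeRel aliceEntry bobEntry
  by_cases hi : i < T - 1
  swap
  · by_cases hab : a = b <;> simp [hi, hab]
  simp only [hi, if_true, dif_pos]
  have hval : ∀ c, Fin.append x y (P.var ⟨i, hi⟩) = c →
      (if P.varAt i < h then P.edgeBit i a b (bitAt x (P.varAt i)) else 0) +
        (if P.varAt i < h then 0 else P.edgeBit i a b (bitAt y (P.varAt i - h))) =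
      P.edgeBit i a b c := by
    rintro c rfl
    have hvar : P.varAt i = P.var ⟨i, hi⟩ := dif_pos hi
    rw [hvar]
    generalize P.var ⟨i, hi⟩ = v
    induction v using Fin.addCases with
    | left v =>
      rw [Fin.append_left]
      simp [bitAt]
    | right v =>
      rw [Fin.append_right]
      simp [bitAt]
  rw [hval _ rfl, edgeBit]
  by_cases hab : a < W ∧ b < W
  · rw [dif_pos ⟨hi, hab⟩]
    constructor
    · rintro ⟨_, _, h⟩
      simp [h]
    · intro h
      have : ¬ P.edge ⟨i, hi⟩ ⟨a, hab.1⟩ ⟨b, hab.2⟩ (Fin.append x y (P.var ⟨i, hi⟩)) = true :=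
        fun h' => h ⟨_, _, h'⟩
      simpa using this
  · rw [dif_neg fun h => hab h.2]
    exact ⟨fun ⟨h1, h2, _⟩ => absurd ⟨h1, h2⟩ hab, fun _ => rfl⟩

end BranchingProgram

/-! ### The protocol -/

namespace Arithmetization

section Protocol

open BranchingProgram

variable {p : ℕ} [Fact p.Prime]

/-- The last point reached by the reduction steps, where `e` is the number formed by the coins. -/
def finalPoint (st : ℕ → Step) (m : ℕ) : ℕ → (ℕ → ZMod p) → ℕ → ℕ → ZMod p
  | 0, r, _ => r
  | q + 1, r, e => finalPoint st m q
      ((st q).move r (e / 2 ^ (4 * (m + 1)) % 2 ^ m : ℕ)) (e / 2 ^ (4 * (m + 1)) / 2 ^ m)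

theorem finalPoint_succ_evenBits (st : ℕ → Step) (m q : ℕ) (r : ℕ → ZMod p) (x : ℕ) :
    finalPoint st m (q + 1) r (evenBits ((q + 1) * roundsPerStep m) x) =
      finalPoint st m q ((st q).move r (evenBits m (x / 4 ^ (4 * (m + 1))) : ℕ))
        (evenBits (q * roundsPerStep m) (x / 4 ^ (4 * (m + 1)) / 4 ^ m)) := by
  have e1 : evenBits ((q + 1) * roundsPerStep m) x / 2 ^ (4 * (m + 1)) =
      evenBits (m + q * roundsPerStep m) (x / 4 ^ (4 * (m + 1))) := by
    rw [evenBits_div]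
    congr 2
    ring
  rw [finalPoint, e1, ← evenBits_eq_mod, ← evenBits_div]

/-- The final test matters only at the final point. -/
theorem verdict_congr {st : ℕ → Step} {m : ℕ} {fin fin' : (ℕ → ZMod p) → ZMod p → Bool} {q : ℕ}
    {r : ℕ → ZMod p} {x : ℕ}
    (h : ∀ c, fin (finalPoint st m q r (evenBits (q * roundsPerStep m) x)) c =
      fin' (finalPoint st m q r (evenBits (q * roundsPerStep m) x)) c) (c : ZMod p) :
    verdict st m fin q r c x = verdict st m fin' q r c x := by
  induction q generalizing r c x with
  | zero => exact h c
  | succ q ih =>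
    rw [finalPoint_succ_evenBits] at h
    simp only [verdict]
    rw [ih h]

variable {W T h : ℕ} (l w m : ℕ) (P : BranchingProgram W T (h + h))

/-- Alice's summand of the value of the multilinear extension of `edgeRel`. -/
def aliceSum (x : Fin h → Bool) (r : ℕ → ZMod p) : ZMod p :=
  extension (l + 2 * w)
    (fun z => P.aliceEntry x (z % 2 ^ l) (z / 2 ^ l % 2 ^ w) (z / 2 ^ l / 2 ^ w)) r

/-- Bob's summand of the value of the multilinear extension of `edgeRel`. -/
def bobSum (y : Fin h → Bool) (r : ℕ → ZMod p) : ZMod p :=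
  extension (l + 2 * w)
    (fun z => P.bobEntry y (z % 2 ^ l) (z / 2 ^ l % 2 ^ w) (z / 2 ^ l / 2 ^ w)) r

/-- Alice's decision for the claim that the indicator of acceptance is `c₀`, where `tr` is the
transcript and `msg` the message of Bob. -/
def aliceDecision (c₀ : ZMod p) (x : Fin h → Bool) (tr msg : ℕ) : Bool :=
  verdict (stepAt l w) m (fun r c => decide (c = aliceSum l w P x r + (msg : ZMod p)))
    (numSteps l w) 0 c₀ tr

variable (p) in
/-- Bob sends his summand at the final point. -/
def bobMessage (y : Fin h → Bool) (e : ℕ) : ℕ :=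
  (bobSum (p := p) l w P y (finalPoint (stepAt l w) m (numSteps l w) 0 e)).val

variable {l w m}

/-- The last function, evaluated at the point that encodes the first node of the first layer and the
first node of the last layer, is the indicator of acceptance. -/
theorem iterOp_numSteps (hW : 2 ≤ W) (hT : 2 ≤ T) (hw : W ≤ 2 ^ w) (hl : T - 1 ≤ 2 ^ l)
    (x y : Fin h → Bool) :
    (P.Accepts (Fin.append x y) →
      iterOp (stepAt l w) (fun r : ℕ → ZMod p => aliceSum l w P x r + bobSum l w P y r)
        (numSteps l w) 0 = 1) ∧
    (¬ P.Accepts (Fin.append x y) →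
      iterOp (stepAt l w) (fun r : ℕ → ZMod p => aliceSum l w P x r + bobSum l w P y r)
        (numSteps l w) 0 = 0) := by
  have hrep : Represents (fun r : ℕ → ZMod p => aliceSum l w P x r + bobSum l w P y r)
      (fun z => P.edgeRel (Fin.append x y) (digits 0 l z) (digits l w z) (digits (l + w) w z)) := by
    intro z
    have h1 := P.aliceEntry_add_bobEntry x y (digits 0 l z) (digits l w z) (digits (l + w) w z)
    have e : digits 0 (l + 2 * w) z =
        digits 0 l z + 2 ^ l * (digits l w z + 2 ^ w * digits (l + w) w z) := by
      rw [digits_add, two_mul, digits_add, zero_add]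
    have hl0 : 0 < 2 ^ l := by positivity
    have hw0 : 0 < 2 ^ w := by positivity
    simp only [aliceSum, bobSum, extension_embed, ← Nat.cast_add]
    rw [e]
    simp only [Nat.add_mul_mod_self_left, Nat.mod_eq_of_lt (digits_lt _ _ _),
      Nat.add_mul_div_left _ _ hl0, Nat.add_mul_div_left _ _ hw0,
      Nat.div_eq_of_lt (digits_lt _ _ _), zero_add]
    exact ⟨fun h => by rw [h1.1 h, Nat.cast_one], fun h => by rw [h1.2 h, Nat.cast_zero]⟩
  have hrep' := represents_iterOp l w _ hrep (l * (2 * w + 1)) (fun _ => false)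
  have hz : (embed (fun _ => false) : ℕ → ZMod p) = 0 := by
    ext j
    simp [embed]
  have hd : ∀ o k, digits o k (fun _ => false) = 0 := by
    intro o k
    simpa using digits_testBit o k (c := 0) (by positivity)
  rw [blockRel_iff_connected (P.edgeRel_lt _ hw) le_rfl, hz, hd, hd, hd, mul_zero,
    P.connected_iff_accepts hW hT _ hl] at hrep'
  exact hrep'

/-- Completeness and soundness of the protocol for the claim `c₀` about acceptance, in terms of the
tropical similarity.  With Bob's true message, Alice's final test is the test of the multilinear
extension of the edge relation at the final point. -/
theorem tropSim_protocol (hp : p ≤ 2 ^ (m + 1)) (hp' : 2 ^ m ≤ p) (hW : 2 ≤ W) (hT : 2 ≤ T)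
    (hw : W ≤ 2 ^ w) (hl : T - 1 ≤ 2 ^ l) (c₀ : Bool) (x y : Fin h → Bool) :
    ((P.Accepts (Fin.append x y) ↔ c₀ = true) →
      tropSim
        (IPProtocol.aliceTensor (numSteps l w * roundsPerStep m) (m + 1)
          (aliceDecision (p := p) l w m P (c₀.toNat : ℕ)) x)
        (IPProtocol.bobTensor (numSteps l w * roundsPerStep m) (m + 1)
          (bobMessage p l w m P) y) = 1) ∧
    (¬ (P.Accepts (Fin.append x y) ↔ c₀ = true) →
      tropSim
        (IPProtocol.aliceTensor (numSteps l w * roundsPerStep m) (m + 1)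
          (aliceDecision (p := p) l w m P (c₀.toNat : ℕ)) x)
        (IPProtocol.bobTensor (numSteps l w * roundsPerStep m) (m + 1)
          (bobMessage p l w m P) y) ≤ 3 * (numSteps l w : ℕ) / 2 ^ m) := by
  rw [IPProtocol.tropSim_eq_gameValue _ _ _ _ _ _ fun e => (ZMod.val_lt _).trans_le hp]
  have hgame : ∀ c, aliceDecision l w m P ((c₀.toNat : ℕ) : ZMod p) x c
      (bobMessage p l w m P y (evenBits (numSteps l w * roundsPerStep m) c)) =
      verdict (stepAt l w) m (fun r c => decide (c = aliceSum l w P x r + bobSum l w P y r))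
        (numSteps l w) 0 ((c₀.toNat : ℕ) : ZMod p) c := by
    intro c
    refine verdict_congr (fun c' => ?_) _
    rw [bobMessage, ZMod.natCast_val, ZMod.cast_id]
  simp only [hgame]
  have hdeg : ∀ q < numSteps l w, ∀ r, IsPolyLE 3 fun s : ZMod p => iterOp (stepAt l w)
      (fun r => aliceSum l w P x r + bobSum l w P y r) q ((stepAt l w q).move r s) := by
    intro q hq r
    refine isPolyLE_iterOp_move (fun j _ => ?_) hq r
    simp only [aliceSum, bobSum, ← extension_add]
    exact extension_coordDeg _ _ _
  have hfin : ∀ (r : ℕ → ZMod p) (c : ZMod p),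
      decide (c = aliceSum l w P x r + bobSum l w P y r) = true ↔
        aliceSum l w P x r + bobSum l w P y r = c := fun r c => by
    rw [decide_eq_true_iff, eq_comm]
  obtain ⟨h1, h0⟩ := iterOp_numSteps (p := p) P hW hT hw hl x y
  constructor
  · intro hacc
    refine gameValue_verdict_eq_one hp hdeg hfin le_rfl _ _ ?_
    by_cases hA : P.Accepts (Fin.append x y)
    · rw [h1 hA, hacc.1 hA]
      simp
    · rw [h0 hA, Bool.eq_false_iff.2 fun h => hA (hacc.2 h)]
      simp
  · intro hacc
    refine gameValue_verdict_le hp' hdeg hfin le_rfl _ _ ?_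
    by_cases hA : P.Accepts (Fin.append x y)
    · rw [h1 hA, Bool.eq_false_iff.2 fun h => hacc (iff_of_true hA h)]
      simp
    · rw [h0 hA, show c₀ = true by
        by_contra h
        exact hacc (iff_of_false hA h)]
      simp

end Protocol

end Arithmetization

/-! ### Subroutines -/

namespace RAM

attribute [simp] Op.eval

instance : Add Exp := ⟨.bin .add⟩
instance : Sub Exp := ⟨.bin .sub⟩
instance : Mul Exp := ⟨.bin .mul⟩
instance : Div Exp := ⟨.bin .div⟩
instance : Mod Exp := ⟨.bin .mod⟩
instance (n : ℕ) : OfNat Exp n := ⟨.lit n⟩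

namespace Exp

/-- The variable `r` as an expression. -/
abbrev v (r : ℕ) : Exp := .var r

variable (s : State) (a b : Exp)

@[simp] theorem eval_add : (a + b).eval s = a.eval s + b.eval s := rfl
@[simp] theorem eval_sub : (a - b).eval s = a.eval s - b.eval s := rfl
@[simp] theorem eval_mul : (a * b).eval s = a.eval s * b.eval s := rfl
@[simp] theorem eval_div : (a / b).eval s = a.eval s / b.eval s := rfl
@[simp] theorem eval_mod : (a % b).eval s = a.eval s % b.eval s := rfl
@[simp] theorem eval_ofNat (n : ℕ) : Exp.eval s (OfNat.ofNat n) = n := rfl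

end Exp

namespace Cmd

/-- The commands of a list, one after the other. -/
def block : List Cmd → Cmd
  | [] => skip
  | c :: l => seq c (block l)

/-- `Achieves` with the time bound `cost` for loops of at most `L` iterations. -/
abbrev Runs (X L : ℕ) (c : Cmd) (s : State) (Q : State → Prop) : Prop :=
  Achieves X (c.cost L) c s Q

namespace Runs

variable {X L : ℕ} {s : State} {Q Q' : State → Prop} {c : Cmd} {l : List Cmd}

theorem nil (h : Q s) : Runs X L (block []) s Q := Achieves.skip h

theorem call (h : Runs X L c s Q') (hQ : ∀ s', c.Frame s s' → s'.Bdd X → Q' s' →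
    Runs X L (block l) s' Q) : Runs X L (block (c :: l)) s Q :=
  Achieves.seq (h.imp hQ)

theorem set {r v : ℕ} {e : Exp} (hX : 8 ≤ X) (he : e.eval s = v) (hv : v ≤ X)
    (h : Runs X L (block l) (s.setReg r v) Q)
    (hd : e.deg ≤ 8 := by exact Nat.le_of_ble_eq_true rfl)
    (hl : e.maxLit ≤ 8 := by exact Nat.le_of_ble_eq_true rfl) :
    Runs X L (block (.set r e :: l)) s Q :=
  Achieves.seq (Achieves.set hX (by rwa [he]) (by rwa [he]) hd hl)

theorem put {a j v : ℕ} {i e : Exp} (hX : 8 ≤ X) (hi : i.eval s = j) (he : e.eval s = v)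
    (hv : v ≤ X) (h : Runs X L (block l) (s.setArr a j v) Q)
    (hd : i.deg ≤ 8 := by exact Nat.le_of_ble_eq_true rfl)
    (hl : i.maxLit ≤ 8 := by exact Nat.le_of_ble_eq_true rfl)
    (hd' : e.deg ≤ 8 := by exact Nat.le_of_ble_eq_true rfl)
    (hl' : e.maxLit ≤ 8 := by exact Nat.le_of_ble_eq_true rfl) :
    Runs X L (block (.put a i e :: l)) s Q :=
  Achieves.seq (Achieves.put hX (by rwa [hi, he]) (by rwa [he]) hd hl hd' hl')

end Runs

/-- A command that changes none of the first `20` variables and of the first `5` arrays. -/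
def Local (c : Cmd) : Prop := (∀ r ∈ c.writes, 20 ≤ r) ∧ ∀ a ∈ c.puts, 5 ≤ a

instance (c : Cmd) : Decidable c.Local := inferInstanceAs (Decidable (_ ∧ _))

end Cmd

open Cmd Exp

/-- loop counter of the subroutines -/
@[simp] abbrev rI : ℕ := 20
/-- power of two in the subroutines -/
@[simp] abbrev rPow : ℕ := 21
/-- rest of the transcript -/
@[simp] abbrev rX : ℕ := 22

/-- `dst := 2 ^ e` -/
def powTwo (dst : ℕ) (e : Exp) : Cmd :=
  block [.set dst 1, .loop rI e (.set dst (v dst * 2))]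

theorem powTwo_runs {X L n dst : ℕ} {e : Exp} {s : State} (hX : 8 ≤ X) (hd : dst ≠ rI)
    (he : ∀ x, e.eval (s.setReg dst x) = n) (hn : n ≤ L) (hL : L ≤ X) (h2 : 2 ^ n ≤ X)
    (hdeg : e.deg ≤ 8 := by exact Nat.le_of_ble_eq_true rfl)
    (hlit : e.maxLit ≤ 8 := by exact Nat.le_of_ble_eq_true rfl) :
    Runs X L (powTwo dst e) s fun s' => s'.reg dst = 2 ^ n := by
  refine Runs.set hX rfl (by simp; omega) (Runs.call (Achieves.loop
    (fun k s' => s'.reg dst * 2 ^ k = 2 ^ n) hX (he _) (hn.trans hL) hn ?_ ?_ ?_ ?_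
    (Q := fun s' => s'.reg dst = 2 ^ n) (hd := hdeg) (hl := hlit)) fun s' _ _ h => Runs.nil h)
  · simpa [writes] using hd.symm
  · simp [hd]
  · intro k hk s' _ hI
    have hk0 : 0 < 2 ^ k := by positivity
    have hI' : s'.reg dst * 2 * 2 ^ k = 2 ^ n := by rw [← hI, pow_succ]; ring
    refine Achieves.set hX ?_ ?_
    · simpa [hd] using hI'
    · have := Nat.le_mul_of_pos_right (s'.reg dst * 2) hk0
      simp [hd]
      omega
  · intro s' _ _ hI
    simpa using hI

/-- `dst := ⌈log₂ src⌉` -/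
def ceilLog (dst src : ℕ) : Cmd :=
  block [.set dst 0, .set rPow 1, .loop rI (v src)
    (.ite (v src - v rPow) (block [.set dst (v dst + 1), .set rPow (v rPow * 2)]) .skip)]

theorem ceilLog_runs {X L x dst src : ℕ} {s : State} (hX : 8 ≤ X) (hd : dst ≠ rI)
    (hd' : dst ≠ rPow) (hs : src ≠ rI) (hs' : src ≠ rPow) (hds : dst ≠ src)
    (hx : s.reg src = x) (hxL : x ≤ L) (hL : L ≤ X) (h2 : 2 * x ≤ X) :
    Runs X L (ceilLog dst src) s fun s' => s'.reg dst = Nat.clog 2 x := by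
  have hclog : Nat.clog 2 x ≤ x := by
    rw [Nat.clog_le_iff_le_pow (by norm_num)]
    exact Nat.lt_two_pow_self.le
  refine Runs.set hX rfl (by simp) (Runs.set hX rfl (by simp; omega) (Runs.call (Achieves.loop
    (n := x)
    (fun k s' => s'.reg src = x ∧ s'.reg rPow = 2 ^ s'.reg dst ∧
      s'.reg dst = min (x - k) (Nat.clog 2 x)) hX ?_ (hxL.trans hL) hxL ?_ ?_ ?_ ?_
    (Q := fun s' => s'.reg dst = Nat.clog 2 x)) fun s' _ _ h => Runs.nil h))
  · simp at *
    simp [hs', Ne.symm hds, hx]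
  · simp [writes, block] at *
    omega
  · simp at *
    simp [hd, hd', hs, hs', hx, Ne.symm hds]
  · rintro k hk s' _ ⟨h1, h3, h4⟩
    simp only [rI, rPow] at *
    refine Achieves.ite hX (fun hc => ?_) fun hc => Achieves.skip ?_
    · simp [hs, h1] at hc
      have hlt : 2 ^ s'.reg dst < x := by omega
      have hlt' : s'.reg dst < Nat.clog 2 x := by
        by_contra h
        have := Nat.le_pow_clog (b := 2) (by norm_num) x
        have := Nat.pow_le_pow_right (n := 2) (by norm_num) (not_lt.1 h)
        omega
      refine Runs.set hX (v := s'.reg dst + 1) (by simp [hd]) (by omega)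
        (Runs.set hX (v := 2 ^ (s'.reg dst + 1)) ?_ ?_ (Runs.nil ?_))
      · simp [hd'.symm, h3, pow_succ]
      · rw [pow_succ]
        omega
      · simp only [State.setReg_reg, hd, hd', hs, hs', hds.symm, if_true, if_false, h1, true_and]
        omega
    · simp [hs, h1] at hc
      refine ⟨by simp [hs, h1], by simp [hd, h3], ?_⟩
      have hle : Nat.clog 2 x ≤ s'.reg dst := by
        rw [Nat.clog_le_iff_le_pow (by norm_num)]
        omega
      simp [hd]
      omega
  · rintro s' _ _ ⟨_, _, h⟩
    rw [h]
    simpa using hclog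

/-- `dst :=` the number formed by the first `e` digits of the variable `rX` in positions of the
parity of `o - 1`, where `o ∈ {1, 2}`; these digits and the interleaved ones are removed from
`rX`. -/
def readBits (dst : ℕ) (o e : Exp) : Cmd :=
  block [.set dst 0, .set rPow 1, .loop rI e (block [
    .set dst (v dst + v rX / o % 2 * v rPow), .set rPow (v rPow * 2), .set rX (v rX / 4)])]

theorem readBits_runs {X L x o n dst : ℕ} {e : Exp} {s : State} (hX : 8 ≤ X)
    (hd : dst ≠ rI) (hd' : dst ≠ rPow) (hd'' : dst ≠ rX) (hx : s.reg rX = x)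
    (he : ∀ y z, e.eval ((s.setReg dst y).setReg rPow z) = n) (hn : n ≤ L) (hL : L ≤ X)
    (h2 : 2 ^ n ≤ X) (ho : o ≤ 8 := by norm_num)
    (hdeg : e.deg ≤ 8 := by exact Nat.le_of_ble_eq_true rfl)
    (hlit : e.maxLit ≤ 8 := by exact Nat.le_of_ble_eq_true rfl) :
    Runs X L (readBits dst (.lit o) e) s fun s' =>
      s'.reg dst = evenBits n (x / o) ∧ s'.reg rX = x / 4 ^ n := by
  have hdm : ((v dst + v rX / .lit o % 2 * v rPow : Exp)).maxLit ≤ 8 := by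
    change max 0 (max (max (max 0 o) 2) 0) ≤ 8
    omega
  refine Achieves.of_bdd fun hb => ?_
  refine Runs.set hX rfl (by simp) (Runs.set hX rfl (by simp; omega) (Runs.call (Achieves.loop
    (fun k s' => s'.reg dst + s'.reg rPow * evenBits k (s'.reg rX / o) = evenBits n (x / o) ∧
      s'.reg rPow * 2 ^ k = 2 ^ n ∧ s'.reg rX / 4 ^ k = x / 4 ^ n ∧ s'.reg rX ≤ x)
    hX (he _ _) (hn.trans hL) hn ?_ ?_ ?_ ?_
    (Q := fun s' => s'.reg dst = evenBits n (x / o) ∧ s'.reg rX = x / 4 ^ n)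
    (hd := hdeg) (hl := hlit))
    fun s' _ _ h => Runs.nil h))
  · simp [writes, block] at *
    omega
  · simp at *
    simp [hd, hd', Ne.symm hd'', hx]
  · rintro k hk s' _ ⟨h1, h3, h4, h5⟩
    simp only [rI, rPow, rX] at *
    have hk0 : 0 < 2 ^ k := by positivity
    have hpow : s'.reg 21 * 2 * 2 ^ k = 2 ^ n := by rw [← h3, pow_succ]; ring
    have hpow' := Nat.le_mul_of_pos_right (s'.reg 21 * 2) hk0
    have hxX : x ≤ X := hx ▸ hb.1 22
    have hnext : s'.reg dst + s'.reg 22 / o % 2 * s'.reg 21 +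
        s'.reg 21 * 2 * evenBits k (s'.reg 22 / 4 / o) = evenBits n (x / o) := by
      rw [← h1, evenBits, Nat.div_right_comm]
      ring
    have hlt := evenBits_lt n (x / o)
    refine Runs.set hX (v := s'.reg dst + s'.reg 22 / o % 2 * s'.reg 21) (by simp [hd]) (by omega)
      (Runs.set hX (v := s'.reg 21 * 2) (by simp [hd'.symm]) (by omega)
      (Runs.set hX (v := s'.reg 22 / 4) (by simp [hd''.symm])
        ((Nat.div_le_self _ _).trans (h5.trans hxX)) (Runs.nil ?_)))
        (by exact Nat.le_of_ble_eq_true rfl) hdm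
    simp only [State.setReg_reg, hd, hd', hd'', if_true, if_false]
    simp
    refine ⟨hnext, hpow, ?_, (Nat.div_le_self _ _).trans h5⟩
    rw [← h4, Nat.div_div_eq_div_mul, pow_succ']
  · rintro s' _ _ ⟨h1, _, h3, _⟩
    simp only [evenBits, mul_zero, add_zero, pow_zero, Nat.div_one] at h1 h3
    exact ⟨h1, h3⟩

end RAM

/-! ### The program: evaluation of the multilinear extensions -/

namespace RAM

open Cmd Exp Arithmetization BranchingProgram

/-- number of strings -/
@[simp] abbrev rN : ℕ := 0
/-- length of the strings -/
@[simp] abbrev rLen : ℕ := 1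
/-- width of the branching program -/
@[simp] abbrev rWidth : ℕ := 2
/-- length of the branching program -/
@[simp] abbrev rTime : ℕ := 3
/-- precision -/
@[simp] abbrev rPrec : ℕ := 4
/-- `w`, the number of bits of a node -/
@[simp] abbrev rNode : ℕ := 5
/-- `l`, the number of bits of a layer -/
@[simp] abbrev rLayer : ℕ := 6
/-- `l + 3 * w`, the number of coordinates -/
@[simp] abbrev rCoord : ℕ := 7
/-- number of reduction steps -/
@[simp] abbrev rSteps : ℕ := 8
/-- `m`, the number of coins per step -/
@[simp] abbrev rCoins : ℕ := 9
/-- `p`, the size of the field -/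
@[simp] abbrev rPrime : ℕ := 10
/-- `2 ^ (m + 1)` -/
@[simp] abbrev rBase : ℕ := 11
/-- `2 ^ t`, the size of the tensors -/
@[simp] abbrev rSize : ℕ := 12
/-- `2 ^ l` -/
@[simp] abbrev rLayers : ℕ := 13
/-- `2 ^ w` -/
@[simp] abbrev rNodes : ℕ := 14
/-- `l + 2 * w`, the number of coordinates that matter in the end -/
@[simp] abbrev rVars : ℕ := 15
/-- `2 ^ (l + 2 * w)` -/
@[simp] abbrev rCube : ℕ := 16
/-- `t`, the number of dimensions of the tensors -/
@[simp] abbrev rDim : ℕ := 17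

section

variable {W T h N : ℕ} (P : BranchingProgram W T (h + h)) (A B : Fin N → Fin h → Bool)
  (l w m p t : ℕ)

/-- The variables and arrays that do not change in the main loop have the right contents. -/
structure Loaded (s : State) : Prop where
  num : s.reg rN = N
  len : s.reg rLen = h
  width : s.reg rWidth = W
  time : s.reg rTime = T
  node : s.reg rNode = w
  layer : s.reg rLayer = l
  coord : s.reg rCoord = l + 3 * w
  steps : s.reg rSteps = numSteps l w
  coins : s.reg rCoins = m
  prime : s.reg rPrime = p
  base : s.reg rBase = 2 ^ (m + 1)
  size : s.reg rSize = 2 ^ t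
  layers : s.reg rLayers = 2 ^ l
  nodes : s.reg rNodes = 2 ^ w
  vars : s.reg rVars = l + 2 * w
  cube : s.reg rCube = 2 ^ (l + 2 * w)
  arr1 : s.arr 1 = cells fun i => (P.var i : ℕ)
  arr2 : s.arr 2 = edgeCells P
  arr3 : s.arr 3 = stringCells A
  arr4 : s.arr 4 = stringCells B

variable {P A B l w m p t}

theorem Loaded.congr {s s' : State} (hs : Loaded P A B l w m p t s)
    (hr : ∀ r < 20, s'.reg r = s.reg r) (ha : ∀ a < 5, s'.arr a = s.arr a) :
    Loaded P A B l w m p t s' where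
  num := (hr _ (by decide)).trans hs.num
  len := (hr _ (by decide)).trans hs.len
  width := (hr _ (by decide)).trans hs.width
  time := (hr _ (by decide)).trans hs.time
  node := (hr _ (by decide)).trans hs.node
  layer := (hr _ (by decide)).trans hs.layer
  coord := (hr _ (by decide)).trans hs.coord
  steps := (hr _ (by decide)).trans hs.steps
  coins := (hr _ (by decide)).trans hs.coins
  prime := (hr _ (by decide)).trans hs.prime
  base := (hr _ (by decide)).trans hs.base
  size := (hr _ (by decide)).trans hs.size
  layers := (hr _ (by decide)).trans hs.layers
  nodes := (hr _ (by decide)).trans hs.nodes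
  vars := (hr _ (by decide)).trans hs.vars
  cube := (hr _ (by decide)).trans hs.cube
  arr1 := (ha _ (by decide)).trans hs.arr1
  arr2 := (ha _ (by decide)).trans hs.arr2
  arr3 := (ha _ (by decide)).trans hs.arr3
  arr4 := (ha _ (by decide)).trans hs.arr4

theorem Loaded.frame {s s' : State} {c : Cmd} (hs : Loaded P A B l w m p t s)
    (hf : c.Frame s s') (hc : c.Local) : Loaded P A B l w m p t s' :=
  hs.congr (fun r hr => hf.1 r fun h => by have := hc.1 r h; omega)
    fun a ha => hf.2 a fun h => by have := hc.2 a h; omega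

theorem Loaded.setReg {s : State} (hs : Loaded P A B l w m p t s) {r v : ℕ}
    (hr : 20 ≤ r := by exact Nat.le_of_ble_eq_true rfl) :
    Loaded P A B l w m p t (s.setReg r v) :=
  hs.congr (fun r' h' => by rw [State.setReg_reg, if_neg (by omega)]) fun _ _ => rfl

theorem Loaded.setArr {s : State} (hs : Loaded P A B l w m p t s) {a i v : ℕ}
    (ha : 5 ≤ a := by exact Nat.le_of_ble_eq_true rfl) :
    Loaded P A B l w m p t (s.setArr a i v) :=
  hs.congr (fun _ _ => rfl) fun a' h' => by
    ext j
    rw [State.setArr_arr, if_neg (by omega)]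

theorem cells_var (P : BranchingProgram W T (h + h)) (i : ℕ) :
    cells (fun i => (P.var i : ℕ)) i = P.varAt i := rfl

theorem cells_apply {n : ℕ} (g : Fin n → ℕ) (i : Fin n) : cells g i = g i := by
  simp [cells]

theorem stringCells_apply (A : Fin N → Fin h → Bool) (j : Fin N) {v : ℕ} (hv : v < h) :
    stringCells A (j * h + v) = (bitAt (A j) v).toNat := by
  have e : (j * h + v : ℕ) = (finProdFinEquiv (j, (⟨v, hv⟩ : Fin h)) : Fin (N * h)) := by
    simp [finProdFinEquiv, mul_comm, add_comm]
  rw [stringCells, e, cells_apply, Equiv.symm_apply_apply, bitAt, dif_pos hv]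

theorem edgeCells_apply (P : BranchingProgram W T (h + h)) {i a b : ℕ} (hi : i < T - 1)
    (ha : a < W) (hb : b < W) (c : Bool) :
    edgeCells P (((i * W + a) * W + b) * 2 + c.toNat) = P.edgeBit i a b c := by
  have e : ((i * W + a) * W + b) * 2 + c.toNat =
      (finProdFinEquiv ((⟨i, hi⟩ : Fin (T - 1)), finProdFinEquiv ((⟨a, ha⟩ : Fin W),
        finProdFinEquiv ((⟨b, hb⟩ : Fin W), finTwoEquiv.symm c))) :
          Fin ((T - 1) * (W * (W * 2)))) := by
    cases c <;> simp [finProdFinEquiv, finTwoEquiv] <;> ring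
  rw [edgeCells, e, cells_apply, edgeBit, dif_pos ⟨hi, ha, hb⟩]
  simp only [Equiv.symm_apply_apply, Equiv.apply_symm_apply]

variable (l w m p t) in
/-- All loops of the program have at most `L` iterations, and all values are at most `X`. -/
structure Sizes (X L : ℕ) : Prop where
  eight_le : 8 ≤ X
  le : L ≤ X
  coords : l + 3 * w ≤ L
  steps : numSteps l w ≤ L
  cube : 2 ^ (l + 2 * w) ≤ L
  message : 2 ^ (4 * (m + 1)) ≤ L
  size : 2 ^ t ≤ L
  prime : p ≤ 2 ^ (m + 1)

theorem Sizes.base_le {X L : ℕ} (hz : Sizes l w m p t X L) : 2 ^ (m + 1) ≤ X :=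
  (Nat.pow_le_pow_right (by norm_num) (by omega)).trans (hz.message.trans hz.le)

theorem Sizes.prime_le {X L : ℕ} (hz : Sizes l w m p t X L) : p ≤ X :=
  hz.prime.trans hz.base_le

theorem mod_eq_val {p a : ℕ} [Fact p.Prime] {y : ZMod p} (h : (a : ZMod p) = y) :
    a % p = y.val := by
  rw [← h, ZMod.val_natCast]

theorem cast_val {p : ℕ} [Fact p.Prime] (y : ZMod p) : ((y.val : ℕ) : ZMod p) = y := by
  rw [ZMod.natCast_val, ZMod.cast_id]

theorem cast_one_sub {p : ℕ} [Fact p.Prime] (y : ZMod p) :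
    ((p + 1 - y.val : ℕ) : ZMod p) = 1 - y := by
  rw [Nat.cast_sub ((ZMod.val_lt y).le.trans (by omega)), cast_val]
  simp

/-- index of the current string -/
@[simp] abbrev rString : ℕ := 23
/-- Alice's sum -/
@[simp] abbrev rAlice : ℕ := 24
/-- Bob's sum -/
@[simp] abbrev rBob : ℕ := 25
/-- index of a vertex of the cube -/
@[simp] abbrev rVertex : ℕ := 26
/-- partial product -/
@[simp] abbrev rProd : ℕ := 27
/-- remaining digits of a vertex of the cube -/
@[simp] abbrev rDigits : ℕ := 28
/-- a coordinate of the point -/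
@[simp] abbrev rEntry : ℕ := 29
/-- layer -/
@[simp] abbrev rEdgeLayer : ℕ := 30
/-- source of an edge -/
@[simp] abbrev rSource : ℕ := 31
/-- target of an edge -/
@[simp] abbrev rTarget : ℕ := 32
/-- queried variable -/
@[simp] abbrev rQuery : ℕ := 33
/-- bit of a string -/
@[simp] abbrev rBit : ℕ := 34
/-- indicator of an edge -/
@[simp] abbrev rEdge : ℕ := 35

/-- The product `chi` for the vertex in `rVertex` at the point in array `8`.  As loop counters run
downwards, the coordinate of the current digit is `rVars - (rI + 1)`; the difference `1 - rEntry` in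
the field is computed as `rPrime + 1 - rEntry`, to avoid truncation. -/
def evalChi : Cmd :=
  block [.set rProd 1, .set rDigits (v rVertex), .loop rI (v rVars) (block [
    .set rEntry (.get 8 (v rVars - (v rI + 1))),
    .ite (v rDigits % 2) (block [.set rProd (v rProd * v rEntry % v rPrime)])
      (block [.set rProd (v rProd * (v rPrime + 1 - v rEntry) % v rPrime)]),
    .set rDigits (v rDigits / 2)])]

/-- The entry of Alice or Bob for the vertex in `rVertex`, multiplied by `rProd`, is added to the
corresponding sum.  A truncated difference `a - b` serves as the test `b < a`, a product as a
conjunction, and `(a - b) + (b - a)` as the test `a ≠ b`. -/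
def addEntry : Cmd :=
  block [.set rEdgeLayer (v rVertex % v rLayers),
    .set rSource (v rVertex / v rLayers % v rNodes),
    .set rTarget (v rVertex / v rLayers / v rNodes),
    .ite (v rTime - (v rEdgeLayer + 1))
      (.ite ((v rWidth - v rSource) * (v rWidth - v rTarget))
        (block [.set rQuery (.get 1 (v rEdgeLayer)),
          .ite (v rLen - v rQuery)
            (block [.set rBit (.get 3 (v rString * v rLen + v rQuery)),
              .set rEdge (.get 2 (((v rEdgeLayer * v rWidth + v rSource) * v rWidth +
                v rTarget) * 2 + v rBit)),
              .set rAlice ((v rAlice + v rProd * v rEdge) % v rPrime)])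
            (block [.set rBit (.get 4 (v rString * v rLen + (v rQuery - v rLen))),
              .set rEdge (.get 2 (((v rEdgeLayer * v rWidth + v rSource) * v rWidth +
                v rTarget) * 2 + v rBit)),
              .set rBob ((v rBob + v rProd * v rEdge) % v rPrime)])])
        .skip)
      (.ite ((v rSource - v rTarget) + (v rTarget - v rSource)) .skip
        (block [.set rAlice ((v rAlice + v rProd) % v rPrime)]))]

/-- The sums of Alice and Bob for the point in array `8`, by summation over all vertices of the
cube. -/
def evalSums : Cmd :=
  block [.set rAlice 0, .set rBob 0, .loop rVertex (v rCube) (block [evalChi, addEntry])]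

variable [Fact p.Prime] {X L : ℕ} {s : State}

theorem evalChi_runs (hz : Sizes l w m p t X L) (hs : Loaded P A B l w m p t s)
    {r : ℕ → ZMod p} (hr : ∀ i < l + 2 * w, s.arr 8 i = (r i).val) {z : ℕ}
    (hv : s.reg rVertex = z) :
    Runs X L evalChi s fun s' => s'.reg rProd = (chi (l + 2 * w) z r).val := by
  have h8 := hz.eight_le
  have hp := hz.prime_le
  have hval : ∀ y : ZMod p, y.val ≤ X := fun y => (ZMod.val_lt y).le.trans hp
  refine Achieves.of_bdd fun hb => ?_
  have hzX : z ≤ X := hv ▸ hb.1 _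
  refine Runs.set h8 rfl (by simp; omega) (Runs.set h8 (v := z) (by simpa using hv) hzX
    (Runs.call (Achieves.loop (n := l + 2 * w)
    (fun k s' => s'.reg rProd = (∏ j ∈ Finset.range (l + 2 * w - k),
        if z.testBit j then r j else 1 - r j).val ∧
      s'.reg rDigits = z / 2 ^ (l + 2 * w - k)) h8 ?_ ?_ ?_ (by decide) ?_ ?_ ?_
    (Q := fun s' => s'.reg rProd = (chi (l + 2 * w) z r).val)) fun s' _ _ h => Runs.nil h))
  · simpa using hs.vars
  · have := hz.coords; have := hz.le; omega
  · have := hz.coords; omega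
  · have hp1 := Nat.Prime.one_lt (Fact.out : p.Prime)
    have : Fact (1 < p) := ⟨hp1⟩
    simp [ZMod.val_one]
  · rintro k hk s' hf ⟨h1, h2⟩
    have hs' : Loaded P A B l w m p t s' := (hs.setReg.setReg).frame hf (by decide)
    have harr : s'.arr 8 = s.arr 8 := hf.2 8 (by decide)
    set j := l + 2 * w - (k + 1) with hj
    have hjk : l + 2 * w - k = j + 1 := by omega
    have hbit : z / 2 ^ j % 2 = (z.testBit j).toNat := (Nat.toNat_testBit z j).symm
    have hprime := hs'.prime
    have hvars := hs'.vars
    simp at h1 h2 hprime hvars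
    refine Runs.set h8 (v := (r j).val) ?_ (hval _) ?_
    · have : l + 2 * w - (k + 1) = j := rfl
      simp [hvars, harr, this, hr j (by omega)]
    refine Runs.call (Q' := fun s'' =>
        s''.reg rProd = (∏ j ∈ Finset.range (l + 2 * w - k),
          if z.testBit j then r j else 1 - r j).val)
        (Achieves.ite h8 (fun hc => ?_) fun hc => ?_) ?_
    · simp [h2, hbit] at hc
      refine Runs.set h8 (v := (∏ j ∈ Finset.range (l + 2 * w - k),
          if z.testBit j then r j else 1 - r j).val) ?_ (hval _) (Runs.nil (by simp))
      simp [h1, hprime]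
      refine mod_eq_val ?_
      rw [hjk, Finset.prod_range_succ, if_pos hc]
      push_cast
      rw [cast_val, cast_val]
    · simp [h2, hbit] at hc
      refine Runs.set h8 (v := (∏ j ∈ Finset.range (l + 2 * w - k),
          if z.testBit j then r j else 1 - r j).val) ?_ (hval _) (Runs.nil (by simp))
      simp [h1, hprime]
      refine mod_eq_val ?_
      rw [hjk, Finset.prod_range_succ, if_neg (by simp [hc]), Nat.cast_mul, cast_val, cast_one_sub]
    · intro s'' hf' _ hQ
      have hd : s''.reg 28 = z / 2 ^ j := by
        rw [hf'.1 28 (by decide)]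
        simp [h2]
      refine Runs.set h8 (v := z / 2 ^ (j + 1)) ?_ ((Nat.div_le_self _ _).trans hzX)
        (Runs.nil ⟨?_, ?_⟩)
      · simp [hd, Nat.div_div_eq_div_mul, pow_succ]
      · simpa using hQ
      · simp [hjk]
  · rintro s' _ _ ⟨h1, _⟩
    exact h1

theorem addEntry_runs (hz : Sizes l w m p t X L) (hs : Loaded P A B l w m p t s) {z : ℕ}
    (hv : s.reg rVertex = z) {j : Fin N} (hj : s.reg rString = j) {c a b : ZMod p}
    (hc : s.reg rProd = c.val) (ha : s.reg rAlice = a.val) (hb : s.reg rBob = b.val) :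
    Runs X L addEntry s fun s' =>
      s'.reg rAlice = (a + c *
        (P.aliceEntry (A j) (z % 2 ^ l) (z / 2 ^ l % 2 ^ w) (z / 2 ^ l / 2 ^ w) : ℕ)).val ∧
      s'.reg rBob = (b + c *
        (P.bobEntry (B j) (z % 2 ^ l) (z / 2 ^ l % 2 ^ w) (z / 2 ^ l / 2 ^ w) : ℕ)).val := by
  have h8 := hz.eight_le
  have hp := hz.prime_le
  have hval : ∀ y : ZMod p, y.val ≤ X := fun y => (ZMod.val_lt y).le.trans hp
  refine Achieves.of_bdd fun hbd => ?_
  have hzX : z ≤ X := hv ▸ hbd.1 _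
  have hprime := hs.prime
  have hlayers := hs.layers
  have hnodes := hs.nodes
  have htime := hs.time
  have hwidth := hs.width
  have hlen := hs.len
  simp at hv hj hc ha hb hprime hlayers hnodes htime hwidth hlen
  set i := z % 2 ^ l with hi
  set u := z / 2 ^ l % 2 ^ w with hu
  set x := z / 2 ^ l / 2 ^ w with hx
  have hiX : i ≤ X := (Nat.mod_le _ _).trans hzX
  have hdX : z / 2 ^ l ≤ X := (Nat.div_le_self _ _).trans hzX
  have huX : u ≤ X := (Nat.mod_le _ _).trans hdX
  have hxX : x ≤ X := (Nat.div_le_self _ _).trans hdX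
  refine Runs.set h8 (v := i) (by simp [hv, hlayers, hi]) hiX
    (Runs.set h8 (v := u) (by simp [hv, hlayers, hnodes, hu]) huX
    (Runs.set h8 (v := x) (by simp [hv, hlayers, hnodes, hx]) hxX
    (Runs.call (Q' := _) (Achieves.ite h8 (fun h1 => ?_) fun h1 => ?_)
    fun s' _ _ h => Runs.nil h)))
  · simp [htime] at h1
    have h1' : i < T - 1 := by omega
    refine Achieves.ite h8 (fun h2 => ?_) fun h2 => Achieves.skip ?_
    · simp [hwidth] at h2
      have hu' : u < W := by omega
      have hx' : x < W := by omega
      have hq : s.arr 1 i = P.varAt i := by rw [hs.arr1, cells_var]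
      refine Runs.set h8 (v := P.varAt i) (by simp [hq]) (by rw [← hq]; exact hbd.2 _ _)
        (Runs.call (Q' := _) (Achieves.ite h8 (fun h3 => ?_) fun h3 => ?_)
        fun s' _ _ h => Runs.nil h)
      · simp [hlen] at h3
        have hvar : P.varAt i < h := by omega
        have hbit : s.arr 3 (j * h + P.varAt i) = (bitAt (A j) (P.varAt i)).toNat := by
          rw [hs.arr3, stringCells_apply _ _ hvar]
        have hedge := edgeCells_apply P h1' hu' hx' (bitAt (A j) (P.varAt i))
        rw [← hs.arr2] at hedge
        refine Runs.set h8 (v := (bitAt (A j) (P.varAt i)).toNat) (by simp [hj, hlen, hbit])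
          (by rw [← hbit]; exact hbd.2 _ _)
          (Runs.set h8 (v := P.edgeBit i u x (bitAt (A j) (P.varAt i)))
          (by simp [hwidth, hedge]) (by rw [← hedge]; exact hbd.2 _ _)
          (Runs.set h8 (v := (a + c * (P.aliceEntry (A j) i u x : ℕ)).val) ?_ (hval _)
          (Runs.nil ⟨?_, ?_⟩)))
        · simp [ha, hc, hprime]
          refine mod_eq_val ?_
          rw [aliceEntry, if_pos h1', if_pos hvar]
          push_cast
          rw [cast_val, cast_val]
        · simp
        · simp [hb, bobEntry, h1', hvar]
      · simp [hlen] at h3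
        have hvar : ¬ P.varAt i < h := by omega
        have hvar' : P.varAt i - h < h := by
          have : P.varAt i < h + h := by
            rw [varAt, dif_pos h1']
            exact Fin.is_lt _
          omega
        have hbit : s.arr 4 (j * h + (P.varAt i - h)) = (bitAt (B j) (P.varAt i - h)).toNat := by
          rw [hs.arr4, stringCells_apply _ _ hvar']
        have hedge := edgeCells_apply P h1' hu' hx' (bitAt (B j) (P.varAt i - h))
        rw [← hs.arr2] at hedge
        refine Runs.set h8 (v := (bitAt (B j) (P.varAt i - h)).toNat) (by simp [hj, hlen, hbit])
          (by rw [← hbit]; exact hbd.2 _ _)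
          (Runs.set h8 (v := P.edgeBit i u x (bitAt (B j) (P.varAt i - h)))
          (by simp [hwidth, hedge]) (by rw [← hedge]; exact hbd.2 _ _)
          (Runs.set h8 (v := (b + c * (P.bobEntry (B j) i u x : ℕ)).val) ?_ (hval _)
          (Runs.nil ⟨?_, ?_⟩)))
        · simp [hb, hc, hprime]
          refine mod_eq_val ?_
          rw [bobEntry, if_pos h1', if_neg hvar]
          push_cast
          rw [cast_val, cast_val]
        · simp [ha, aliceEntry, h1', hvar]
        · simp
    · simp [hwidth] at h2
      have he : ∀ c, P.edgeBit i u x c = 0 := fun c => dif_neg (by omega)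
      simp [aliceEntry, bobEntry, h1', he, ha, hb]
  · simp [htime] at h1
    have h1' : ¬ i < T - 1 := by omega
    refine Achieves.ite h8 (fun h2 => Achieves.skip ?_) fun h2 => ?_
    · simp at h2
      have hux : u ≠ x := by omega
      simp [aliceEntry, bobEntry, h1', hux, ha, hb]
    · simp at h2
      have hux : u = x := by omega
      refine Runs.set h8 (v := (a + c * (P.aliceEntry (A j) i u x : ℕ)).val) ?_ (hval _)
          (Runs.nil ⟨?_, ?_⟩)
      · simp [ha, hc, hprime]
        refine mod_eq_val ?_
        rw [aliceEntry, if_neg h1', if_pos hux]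
        push_cast
        rw [cast_val, cast_val, mul_one]
      · simp
      · simp [hb, bobEntry, h1']

theorem evalSums_runs (hz : Sizes l w m p t X L) (hs : Loaded P A B l w m p t s)
    {r : ℕ → ZMod p} (hr : ∀ i < l + 2 * w, s.arr 8 i = (r i).val) {j : Fin N}
    (hj : s.reg rString = j) :
    Runs X L evalSums s fun s' => s'.reg rAlice = (aliceSum l w P (A j) r).val ∧
      s'.reg rBob = (bobSum l w P (B j) r).val := by
  have h8 := hz.eight_le
  refine Runs.set h8 rfl (by simp) (Runs.set h8 rfl (by simp) (Runs.call (Achieves.loop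
    (n := 2 ^ (l + 2 * w)) (fun k s' =>
      s'.reg rAlice = (∑ z ∈ Finset.Ico k (2 ^ (l + 2 * w)), chi (l + 2 * w) z r *
        (P.aliceEntry (A j) (z % 2 ^ l) (z / 2 ^ l % 2 ^ w) (z / 2 ^ l / 2 ^ w) : ℕ)).val ∧
      s'.reg rBob = (∑ z ∈ Finset.Ico k (2 ^ (l + 2 * w)), chi (l + 2 * w) z r *
        (P.bobEntry (B j) (z % 2 ^ l) (z / 2 ^ l % 2 ^ w) (z / 2 ^ l / 2 ^ w) : ℕ)).val)
      h8 ?_ (hz.cube.trans hz.le) hz.cube (by decide) ?_ ?_ ?_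
      (Q := fun s' => s'.reg rAlice = (aliceSum l w P (A j) r).val ∧
      s'.reg rBob = (bobSum l w P (B j) r).val)) fun s' _ _ h => Runs.nil h))
  · simpa using hs.cube
  · simp
  · rintro k hk s' hf ⟨h1, h2⟩
    have hs' : Loaded P A B l w m p t s' := (hs.setReg.setReg).frame hf (by decide)
    have harr : s'.arr 8 = s.arr 8 := hf.2 8 (by decide)
    refine Runs.call (evalChi_runs hz (hs'.setReg (r := rVertex) (v := k)) (r := r) (z := k)
      (by simpa [harr] using hr) (by simp)) fun s₁ hf₁ _ hc => ?_
    refine Runs.call (addEntry_runs hz ((hs'.setReg).frame hf₁ (by decide)) (z := k) (j := j)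
      ?_ ?_ hc
      (a := (∑ z ∈ Finset.Ico (k + 1) (2 ^ (l + 2 * w)), chi (l + 2 * w) z r *
        (P.aliceEntry (A j) (z % 2 ^ l) (z / 2 ^ l % 2 ^ w) (z / 2 ^ l / 2 ^ w) : ℕ)))
      (b := (∑ z ∈ Finset.Ico (k + 1) (2 ^ (l + 2 * w)), chi (l + 2 * w) z r *
        (P.bobEntry (B j) (z % 2 ^ l) (z / 2 ^ l % 2 ^ w) (z / 2 ^ l / 2 ^ w) : ℕ))) ?_ ?_)
      fun s₂ _ _ h => Runs.nil ?_
    rotate_left 4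
    · rw [Finset.sum_eq_sum_Ico_succ_bot hk, Finset.sum_eq_sum_Ico_succ_bot hk, add_comm,
        add_comm (chi _ _ _ * _)]
      exact h
    · rw [hf₁.1 _ (by decide)]
      simp
    · rw [hf₁.1 _ (by decide)]
      have := hf.1 rString (by decide)
      simp at this hj ⊢
      omega
    · rw [hf₁.1 _ (by decide)]
      simpa using h1
    · rw [hf₁.1 _ (by decide)]
      simpa using h2
  · rintro s' _ _ h
    simp only [aliceSum, bobSum, extension, Finset.range_eq_Ico]
    exact h

end

end RAM

/-! ### The program: the reduction steps and the entries of the tensors -/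

namespace RAM

open Cmd Exp Arithmetization BranchingProgram

/-- index of an entry of a tensor -/
@[simp] abbrev rCell : ℕ := 36
/-- number of remaining steps -/
@[simp] abbrev rStep : ℕ := 37
/-- claimed value -/
@[simp] abbrev rClaim : ℕ := 38
/-- have all tests been passed so far? -/
@[simp] abbrev rOk : ℕ := 39
/-- digits of the coefficients of the cubic polynomial -/
@[simp] abbrev rCubic : ℕ := 40
/-- random element of the field -/
@[simp] abbrev rCoin : ℕ := 41
/-- constant coefficient of the cubic polynomial -/
@[simp] abbrev rCoeff0 : ℕ := 42
/-- linear coefficient of the cubic polynomial -/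
@[simp] abbrev rCoeff1 : ℕ := 43
/-- quadratic coefficient of the cubic polynomial -/
@[simp] abbrev rCoeff2 : ℕ := 44
/-- leading coefficient of the cubic polynomial -/
@[simp] abbrev rCoeff3 : ℕ := 45
/-- value of the cubic polynomial at `0` -/
@[simp] abbrev rValue0 : ℕ := 46
/-- value of the cubic polynomial at `1` -/
@[simp] abbrev rValue1 : ℕ := 47
/-- value of the cubic polynomial at `rCoin` -/
@[simp] abbrev rValue : ℕ := 48
/-- position of a step after the preceding operation -/
@[simp] abbrev rPos : ℕ := 49
/-- position of an operation in its level -/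
@[simp] abbrev rBlock : ℕ := 50
/-- level of an operation -/
@[simp] abbrev rLevel : ℕ := 51
/-- coordinate that selects -/
@[simp] abbrev rSel : ℕ := 52
/-- coordinate of the first node -/
@[simp] abbrev rFirst : ℕ := 53
/-- coordinate of the second node -/
@[simp] abbrev rSecond : ℕ := 54
/-- coordinate of the intermediate node -/
@[simp] abbrev rMiddle : ℕ := 55
/-- value that follows from Merlin's polynomial -/
@[simp] abbrev rCheck : ℕ := 56
/-- message of Bob -/
@[simp] abbrev rMsg : ℕ := 57

/-- Merlin's polynomial and the random element for one step are read. -/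
def readStep : Cmd :=
  block [readBits rCubic (.lit 2) (4 * (v rCoins + 1)), readBits rCoin (.lit 1) (v rCoins),
    .set rCoeff0 (v rCubic % v rBase), .set rCubic (v rCubic / v rBase),
    .set rCoeff1 (v rCubic % v rBase), .set rCubic (v rCubic / v rBase),
    .set rCoeff2 (v rCubic % v rBase), .set rCubic (v rCubic / v rBase),
    .set rCoeff3 (v rCubic % v rBase),
    .set rValue0 (v rCoeff0 % v rPrime),
    .set rValue1 ((v rCoeff0 + (v rCoeff1 + (v rCoeff2 + v rCoeff3))) % v rPrime),
    .set rValue ((v rCoeff0 + v rCoin * ((v rCoeff1 + v rCoin * ((v rCoeff2 +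
      v rCoin * v rCoeff3) % v rPrime)) % v rPrime)) % v rPrime)]

/-- The value that follows from Merlin's polynomial is computed, and the point in array `8` is
moved. -/
def applyStep : Cmd :=
  block [.set rPos (v rStep % (v rCoord + 1)),
    .set rBlock (v rStep / (v rCoord + 1)),
    .set rLevel (v rBlock / (2 * v rNode + 1)),
    .set rBlock (v rBlock % (2 * v rNode + 1)),
    .ite (v rPos)
      (block [.set rSel (.get 8 (v rPos - 1)),
        .set rCheck ((v rValue0 * (v rPrime + 1 - v rSel) + v rSel * v rValue1) % v rPrime),
        .put 8 (v rPos - 1) (v rCoin % v rPrime)])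
      (.ite (v rNode - v rBlock)
        (block [.set rSel (.get 8 (v rLevel)),
          .set rFirst (.get 8 (v rLayer + v rBlock)),
          .set rSecond (.get 8 (v rLayer + v rNode + v rBlock)),
          .set rMiddle (.get 8 (v rLayer + 2 * v rNode + v rBlock)),
          .set rCheck (v rValue0),
          .put 8 (v rLayer + v rBlock)
            (((v rPrime + 1 - v rSel) * v rFirst + v rSel * v rMiddle) % v rPrime),
          .put 8 (v rLayer + v rNode + v rBlock)
            (((v rPrime + 1 - v rSel) * v rMiddle + v rSel * v rSecond) % v rPrime)])
        (.ite (v rBlock - v rNode)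
          (block [.set rCheck ((v rValue0 + v rValue1 +
              (v rPrime - v rValue0 * v rValue1 % v rPrime)) % v rPrime),
            .put 8 (v rLayer + 2 * v rNode + (v rBlock - (v rNode + 1))) (v rCoin % v rPrime)])
          (block [.set rCheck (v rValue0 * v rValue1 % v rPrime),
            .put 8 (v rLevel) (v rCoin % v rPrime)])))]

/-- One step of the reduction; a failed test is remembered in `rOk`, and the computation goes
on. -/
def stepBody : Cmd :=
  block [readStep, applyStep,
    .ite ((v rCheck - v rClaim) + (v rClaim - v rCheck)) (block [.set rOk 0]) .skip,
    .set rClaim (v rValue)]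

/-- The entries number `rCell` of the tensors of the strings number `rString`, where `c₀` is the
claim about acceptance. -/
def cellBody (c₀ : Bool) : Cmd :=
  block [.loop rI (v rCoord) (block [.put 8 (v rI) 0]), .set rX (v rCell),
    .set rClaim (.lit c₀.toNat), .set rOk 1, .loop rStep (v rSteps) stepBody,
    readBits rMsg (.lit 2) (v rCoins + 1), evalSums,
    .set rCheck ((v rAlice + v rMsg) % v rPrime),
    .put 6 (v rString * v rSize + v rCell)
      (v rOk * (1 - ((v rCheck - v rClaim) + (v rClaim - v rCheck)))),
    .put 7 (v rString * v rSize + v rCell) (1 - ((v rBob - v rMsg) + (v rMsg - v rBob)))]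

section

variable {W T h N : ℕ} {P : BranchingProgram W T (h + h)} {A B : Fin N → Fin h → Bool}
  {l w m p t : ℕ} [Fact p.Prime] {X L : ℕ} {s : State}

theorem readStep_runs (hz : Sizes l w m p t X L) (hs : Loaded P A B l w m p t s) {x : ℕ}
    (hx : s.reg rX = x) {V e : ℕ} (hV : V = oddBits (4 * (m + 1)) x)
    (he : e = evenBits m (x / 4 ^ (4 * (m + 1)))) :
    Runs X L readStep s fun s' => s'.reg rCoin = e ∧
      s'.reg rX = x / 4 ^ (4 * (m + 1)) / 4 ^ m ∧
      s'.reg rValue0 = (cubic (p := p) (2 ^ (m + 1)) V 0).val ∧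
      s'.reg rValue1 = (cubic (p := p) (2 ^ (m + 1)) V 1).val ∧
      s'.reg rValue = (cubic (p := p) (2 ^ (m + 1)) V (e : ℕ)).val := by
  have h8 := hz.eight_le
  have hp := hz.prime_le
  have hB := hz.base_le
  have hm := hz.message
  have hLX := hz.le
  have hval : ∀ y : ZMod p, y.val ≤ X := fun y => (ZMod.val_lt y).le.trans hp
  have h2m : 2 ^ m ≤ 2 ^ (4 * (m + 1)) := Nat.pow_le_pow_right (by norm_num) (by omega)
  have hcoins := hs.coins
  simp at hcoins
  refine Runs.call (readBits_runs (x := x) (n := 4 * (m + 1)) h8 (by decide) (by decide)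
    (by decide) hx (by simp [hcoins])
    ((Nat.lt_two_pow_self.le).trans hm) hLX (hm.trans hLX)) fun s₁ hf₁ _ ⟨hV₁, hx₁⟩ => ?_
  have hs₁ := hs.frame hf₁ (by decide)
  have hcoins₁ := hs₁.coins
  simp at hcoins₁
  refine Runs.call (readBits_runs (x := x / 4 ^ (4 * (m + 1))) (n := m) h8 (by decide) (by decide)
    (by decide) hx₁ (by simp [hcoins₁])
    ((Nat.lt_two_pow_self.le).trans (h2m.trans hm)) hLX (h2m.trans (hm.trans hLX)))
    fun s₂ hf₂ _ ⟨he₂, hx₂⟩ => ?_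
  have hs₂ := hs₁.frame hf₂ (by decide)
  have hV₂ : s₂.reg rCubic = V := by
    rw [hf₂.1 _ (by decide), hV₁, hV, oddBits]
  have hVX : V ≤ X := by
    rw [hV]
    exact (oddBits_lt _ _).le.trans (hm.trans hLX)
  rw [Nat.div_one, ← he] at he₂
  have hB0 : 0 < 2 ^ (m + 1) := by positivity
  have hdig : ∀ y, y % 2 ^ (m + 1) ≤ X := fun y => (Nat.mod_lt _ hB0).le.trans hB
  have hprime := hs₂.prime
  have hbase := hs₂.base
  simp at hV₂ he₂ hx₂ hprime hbase
  have hd : ∀ {a b : ℕ}, a ≤ X → a / b ≤ X := fun h => (Nat.div_le_self _ _).trans h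
  refine Runs.set h8 (v := V % 2 ^ (m + 1)) (by simp [hV₂, hbase]) (hdig _) <|
    Runs.set h8 (v := V / 2 ^ (m + 1)) (by simp [hV₂, hbase]) (hd hVX) <|
    Runs.set h8 (v := V / 2 ^ (m + 1) % 2 ^ (m + 1)) (by simp [hbase]) (hdig _) <|
    Runs.set h8 (v := V / 2 ^ (m + 1) / 2 ^ (m + 1)) (by simp [hbase]) (hd (hd hVX)) <|
    Runs.set h8 (v := V / 2 ^ (m + 1) / 2 ^ (m + 1) % 2 ^ (m + 1)) (by simp [hbase]) (hdig _) <|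
    Runs.set h8 (v := V / 2 ^ (m + 1) / 2 ^ (m + 1) / 2 ^ (m + 1)) (by simp [hbase])
      (hd (hd (hd hVX))) <|
    Runs.set h8 (v := V / 2 ^ (m + 1) / 2 ^ (m + 1) / 2 ^ (m + 1) % 2 ^ (m + 1)) (by simp [hbase])
      (hdig _) <|
    Runs.set h8 (v := (cubic (p := p) (2 ^ (m + 1)) V 0).val) ?_ (hval _) <|
    Runs.set h8 (v := (cubic (p := p) (2 ^ (m + 1)) V 1).val) ?_ (hval _) <|
    Runs.set h8 (v := (cubic (p := p) (2 ^ (m + 1)) V (e : ℕ)).val) ?_ (hval _) <|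
    Runs.nil ?_
  · simp [hprime]
    exact mod_eq_val (by simp [cubic])
  · simp [hprime]
    exact mod_eq_val (by simp [cubic])
  · simp [hprime, he₂]
    refine mod_eq_val ?_
    simp [cubic]
  · simp [he₂, hx₂]

theorem applyStep_runs (hz : Sizes l w m p t X L) (hs : Loaded P A B l w m p t s)
    {r : ℕ → ZMod p} (hr : ∀ i < l + 3 * w, s.arr 8 i = (r i).val) {k e : ℕ}
    (hk : s.reg rStep = k) (hkS : k < numSteps l w) (he : s.reg rCoin = e) {a b : ZMod p}
    (ha : s.reg rValue0 = a.val) (hb : s.reg rValue1 = b.val) :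
    Runs X L applyStep s fun s' => s'.reg rCheck = ((stepAt l w k).check r a b).val ∧
      ∀ i < l + 3 * w, s'.arr 8 i = ((stepAt l w k).move r (e : ℕ) i).val := by
  have h8 := hz.eight_le
  have hp := hz.prime_le
  have hval : ∀ y : ZMod p, y.val ≤ X := fun y => (ZMod.val_lt y).le.trans hp
  refine Achieves.of_bdd fun hbd => ?_
  have hkX : k ≤ X := hk ▸ hbd.1 _
  have hcoord := hs.coord
  have hprime := hs.prime
  have hnode := hs.node
  have hlayer := hs.layer
  simp at hk he ha hb hcoord hprime hnode hlayer
  have hblk : k / (l + 3 * w + 1) < l * (2 * w + 1) := by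
    rw [Nat.div_lt_iff_lt_mul (by omega)]
    exact hkS
  have hlev : k / (l + 3 * w + 1) / (2 * w + 1) < l := by
    rw [Nat.div_lt_iff_lt_mul (by omega)]
    exact hblk
  set pos := k % (l + 3 * w + 1) with hpos
  set lev := k / (l + 3 * w + 1) / (2 * w + 1) with hlevdef
  set i := k / (l + 3 * w + 1) % (2 * w + 1) with hidef
  have hposlt : pos < l + 3 * w + 1 := Nat.mod_lt _ (by omega)
  have hilt : i < 2 * w + 1 := Nat.mod_lt _ (by omega)
  have hkX' : k / (l + 3 * w + 1) ≤ X := (Nat.div_le_self _ _).trans hkX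
  have hemod : e % p = ((e : ℕ) : ZMod p).val := mod_eq_val rfl
  have hstep : stepAt l w k = if pos = 0 then
      if i < w then .sel lev (l + i) (l + w + i) (l + 2 * w + i)
      else if i = w then .all lev else .ex (l + 2 * w + (i - (w + 1)))
      else .lin (pos - 1) := rfl
  refine Runs.set h8 (v := pos) (by simp [hk, hcoord, hpos]) ((Nat.mod_le _ _).trans hkX) <|
    Runs.set h8 (v := k / (l + 3 * w + 1)) (by simp [hk, hcoord]) hkX' <|
    Runs.set h8 (v := lev) (by simp [hnode, hlevdef]) ((Nat.div_le_self _ _).trans hkX') <|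
    Runs.set h8 (v := i) (by simp [hnode, hidef]) ((Nat.mod_le _ _).trans hkX') <|
    Runs.call (Q' := fun s' => s'.reg rCheck = ((stepAt l w k).check r a b).val ∧
      ∀ i < l + 3 * w, s'.arr 8 i = ((stepAt l w k).move r (e : ℕ) i).val)
      (Achieves.ite h8 (fun h1 => ?_) fun h1 => ?_) fun s' _ _ h => Runs.nil h
  · simp at h1
    rw [hstep, if_neg h1]
    refine Runs.set h8 (v := (r (pos - 1)).val) ?_ (hval _) <|
      Runs.set h8 (v := ((1 - r (pos - 1)) * a + r (pos - 1) * b).val) ?_ (hval _) <|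
      Runs.put h8 (j := pos - 1) (v := ((e : ℕ) : ZMod p).val) (by simp) ?_ (hval _) <|
      Runs.nil ⟨?_, fun j hj => ?_⟩
    · simp [hr (pos - 1) (by omega)]
    · simp [hprime, ha, hb]
      refine mod_eq_val ?_
      push_cast
      rw [cast_val, cast_val, cast_val, cast_one_sub, mul_comm a]
    · simp [hprime, he]
    · simp [Step.check]
    · simp [Step.move, Function.update_apply]
      split_ifs
      exacts [hemod, hr j hj]
  · simp at h1
    rw [hstep, if_pos h1]
    refine Achieves.ite h8 (fun h2 => ?_) fun h2 => ?_
    · simp [hnode] at h2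
      have h2' : i < w := by omega
      rw [if_pos h2']
      refine Runs.set h8 (v := (r lev).val) (by simp [hr lev (by omega)]) (hval _) <|
        Runs.set h8 (v := (r (l + i)).val) (by simp [hlayer, hr (l + i) (by omega)]) (hval _) <|
        Runs.set h8 (v := (r (l + w + i)).val)
          (by simp [hlayer, hnode, hr (l + w + i) (by omega)]) (hval _) <|
        Runs.set h8 (v := (r (l + 2 * w + i)).val)
          (by simp [hlayer, hnode, hr (l + 2 * w + i) (by omega)]) (hval _) <|
        Runs.set h8 (v := a.val) (by simp [ha]) (hval _) <|
        Runs.put h8 (j := l + i)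
          (v := ((1 - r lev) * r (l + i) + r lev * r (l + 2 * w + i)).val)
          (by simp [hlayer]) ?_ (hval _) <|
        Runs.put h8 (j := l + w + i)
          (v := ((1 - r lev) * r (l + 2 * w + i) + r lev * r (l + w + i)).val)
          (by simp [hlayer, hnode]) ?_ (hval _) <|
        Runs.nil ⟨?_, fun j hj => ?_⟩
      · simp [hprime]
        refine mod_eq_val ?_
        push_cast
        rw [cast_val, cast_val, cast_val, cast_one_sub]
      · simp [hprime]
        refine mod_eq_val ?_
        push_cast
        rw [cast_val, cast_val, cast_val, cast_one_sub]
      · simp [Step.check]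
      · simp [Step.move, Function.update_apply]
        split_ifs
        exacts [rfl, rfl, hr j hj]
    · simp [hnode] at h2
      rw [if_neg (by omega)]
      refine Achieves.ite h8 (fun h3 => ?_) fun h3 => ?_
      · simp [hnode] at h3
        rw [if_neg (by omega)]
        refine Runs.set h8 (v := (a + b - a * b).val) ?_ (hval _) <|
          Runs.put h8 (j := l + 2 * w + (i - (w + 1))) (v := ((e : ℕ) : ZMod p).val)
            (by simp [hlayer, hnode]) ?_ (hval _) <|
          Runs.nil ⟨?_, fun j hj => ?_⟩
        · simp [hprime, ha, hb]
          refine mod_eq_val ?_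
          have : a.val * b.val % p ≤ p := (Nat.mod_lt _ (Fact.out : p.Prime).pos).le
          rw [Nat.cast_add, Nat.cast_sub this]
          push_cast
          rw [cast_val, cast_val]
          simp
          ring
        · simp [hprime, he]
        · simp [Step.check]
        · simp [Step.move, Function.update_apply]
          split_ifs
          exacts [hemod, hr j hj]
      · simp [hnode] at h3
        rw [if_pos (by omega)]
        refine Runs.set h8 (v := (a * b).val) ?_ (hval _) <|
          Runs.put h8 (j := lev) (v := ((e : ℕ) : ZMod p).val) (by simp) ?_ (hval _) <|
          Runs.nil ⟨?_, fun j hj => ?_⟩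
        · simp [hprime, ha, hb]
          refine mod_eq_val ?_
          push_cast
          rw [cast_val, cast_val]
        · simp [hprime, he]
        · simp [Step.check]
        · simp [Step.move, Function.update_apply]
          split_ifs
          exacts [hemod, hr j hj]

variable (l w m p) in
/-- The state of the reduction when `k` steps are left: the current point and claim, the rest of the
transcript, and the outcome of the tests so far, for the transcript `x₀` and the first claim
`c₀`. -/
def Progress (c₀ : Bool) (x₀ k : ℕ) (s : State) : Prop :=
  ∃ (r : ℕ → ZMod p) (c : ZMod p) (x : ℕ) (ok : Bool),
    (∀ i < l + 3 * w, s.arr 8 i = (r i).val) ∧ s.reg rClaim = c.val ∧ s.reg rX = x ∧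
    s.reg rOk = ok.toNat ∧
    (∀ fin, verdict (stepAt l w) m fin (numSteps l w) 0 ((c₀.toNat : ℕ) : ZMod p) x₀ =
      (ok && verdict (stepAt l w) m fin k r c x)) ∧
    finalPoint (stepAt l w) m (numSteps l w) 0 (evenBits (numSteps l w * roundsPerStep m) x₀) =
      finalPoint (stepAt l w) m k r (evenBits (k * roundsPerStep m) x) ∧
    x / 4 ^ (k * roundsPerStep m) = x₀ / 4 ^ (numSteps l w * roundsPerStep m)

theorem stepBody_runs (hz : Sizes l w m p t X L) (hs : Loaded P A B l w m p t s) {c₀ : Bool}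
    {x₀ k : ℕ} (hk : s.reg rStep = k) (hkS : k < numSteps l w)
    (hI : Progress l w m p c₀ x₀ (k + 1) s) :
    Runs X L stepBody s (Progress l w m p c₀ x₀ k) := by
  have h8 := hz.eight_le
  have hp := hz.prime_le
  have hval : ∀ y : ZMod p, y.val ≤ X := fun y => (ZMod.val_lt y).le.trans hp
  obtain ⟨r, c, x, ok, hr, hc, hx, hok, hver, hfin, hdiv⟩ := hI
  set V := oddBits (4 * (m + 1)) x with hV
  set e := evenBits m (x / 4 ^ (4 * (m + 1))) with he
  refine Runs.call (readStep_runs hz hs hx hV he) fun s₁ hf₁ _ ⟨he₁, hx₁, h01, h11, hv1⟩ => ?_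
  have hs₁ := hs.frame hf₁ (by decide)
  refine Runs.call (applyStep_runs hz hs₁ (r := r) (by rwa [hf₁.2 _ (by decide)])
    (by rwa [hf₁.1 _ (by decide)]) hkS he₁ h01 h11) fun s₂ hf₂ _ ⟨hchk, hr₂⟩ => ?_
  set chk := (stepAt l w k).check r (cubic (p := p) (2 ^ (m + 1)) V 0)
    (cubic (p := p) (2 ^ (m + 1)) V 1) with hchkdef
  have hc₂ : s₂.reg rClaim = c.val := by rw [hf₂.1 _ (by decide), hf₁.1 _ (by decide), hc]
  have hok₂ : s₂.reg rOk = ok.toNat := by rw [hf₂.1 _ (by decide), hf₁.1 _ (by decide), hok]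
  have hx₂ := (hf₂.1 rX (by decide)).trans hx₁
  have hv₂ := (hf₂.1 rValue (by decide)).trans hv1
  simp at hchk hc₂ hok₂ hx₂ hv₂
  refine Runs.call (Q' := fun s' => s'.reg rOk = (ok && decide (chk = c)).toNat)
    (Achieves.ite h8 (fun h1 => ?_) fun h1 => Achieves.skip ?_) fun s₃ hf₃ _ hok₃ => ?_
  · simp [hchk, hc₂] at h1
    have : chk ≠ c := by
      rintro h
      rw [h] at h1
      omega
    exact Runs.set h8 (v := 0) (by simp) (by simp) (Runs.nil (by simp [this]))
  · simp [hchk, hc₂] at h1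
    have : chk = c := ZMod.val_injective p (by omega)
    simp [this, hok₂]
  · have hv₃ := hf₃.1 rValue (by decide)
    have hx₃ := hf₃.1 rX (by decide)
    simp at hv₃ hx₃ hok₃
    refine Runs.set h8 (v := (cubic (p := p) (2 ^ (m + 1)) V (e : ℕ)).val)
      (by simp [hv₃, hv₂]) (hval _) <| Runs.nil ⟨(stepAt l w k).move r (e : ℕ),
        cubic (p := p) (2 ^ (m + 1)) V (e : ℕ), x / 4 ^ (4 * (m + 1)) / 4 ^ m,
        ok && decide (chk = c), fun i hi => ?_, ?_, ?_, ?_, fun fin => ?_, ?_, ?_⟩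
    · rw [State.setReg_arr, hf₃.2 _ (by decide)]
      exact hr₂ i hi
    · simp
    · simp [hx₃, hx₂]
    · simp [hok₃]
    · rw [hver, verdict, Bool.and_assoc]
    · rw [hfin, finalPoint_succ_evenBits]
    · rw [← hdiv, Nat.div_div_eq_div_mul, Nat.div_div_eq_div_mul, ← pow_add, ← pow_add]
      congr 2
      simp only [roundsPerStep]
      ring

theorem cellBody_runs (hz : Sizes l w m p t X L) (hs : Loaded P A B l w m p t s) {c₀ : Bool}
    {x₀ : ℕ} (hx₀ : s.reg rCell = x₀) {j : Fin N} (hj : s.reg rString = j) :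
    Runs X L (cellBody c₀) s fun s' =>
      (∀ i, s'.arr 6 i = if i = j * 2 ^ t + x₀ then
        (aliceDecision (p := p) l w m P (c₀.toNat : ℕ) (A j)
          (x₀ % 4 ^ (numSteps l w * roundsPerStep m))
          (oddBits (m + 1) (x₀ / 4 ^ (numSteps l w * roundsPerStep m)))).toNat
        else s.arr 6 i) ∧
      ∀ i, s'.arr 7 i = if i = j * 2 ^ t + x₀ then
        (decide (bobMessage p l w m P (B j) (evenBits (numSteps l w * roundsPerStep m) x₀) =
          oddBits (m + 1) (x₀ / 4 ^ (numSteps l w * roundsPerStep m)))).toNat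
        else s.arr 7 i := by
  have h8 := hz.eight_le
  have hp := hz.prime_le
  have hLX := hz.le
  have hval : ∀ y : ZMod p, y.val ≤ X := fun y => (ZMod.val_lt y).le.trans hp
  have hp1 : Fact (1 < p) := ⟨(Fact.out : p.Prime).one_lt⟩
  refine Achieves.of_bdd fun hbd => ?_
  have hxX : x₀ ≤ X := hx₀ ▸ hbd.1 _
  have hbool : ∀ b : Bool, b.toNat ≤ X := fun b => (Bool.toNat_le b).trans (by omega)
  refine Runs.call (Q' := fun s' => ∀ i < l + 3 * w, s'.arr 8 i = 0)
    (Achieves.loop (n := l + 3 * w) (fun k s' => ∀ i < l + 3 * w, k ≤ i → s'.arr 8 i = 0) h8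
    hs.coord (hz.coords.trans hLX) hz.coords (by decide) (fun i h h' => by omega) ?_
    fun s' _ _ h i hi => h i hi (Nat.zero_le _)) fun s₁ hf₁ _ hr => ?_
  · intro k hk s' _ hI
    refine Runs.put h8 (j := k) (v := 0) (by simp) rfl (by simp) (Runs.nil fun i hi hki => ?_)
    by_cases hik : i = k
    · simp [hik]
    · simpa [hik] using hI i hi (by omega)
  have hs₁ := hs.frame hf₁ (by decide)
  have hx₁ := (hf₁.1 rCell (by decide)).trans hx₀
  simp at hx₁
  refine Runs.set h8 (v := x₀) (by simp [hx₁]) hxX <|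
    Runs.set h8 (v := c₀.toNat) rfl (hbool _) (hl := by cases c₀ <;> simp) <|
    Runs.set h8 (v := 1) rfl (by omega) <|
    Runs.call (Q' := Progress l w m p c₀ x₀ 0) (Achieves.loop (n := numSteps l w)
      (Progress l w m p c₀ x₀) h8 ?_ (hz.steps.trans hLX) hz.steps (by decide) ?_ ?_
      fun s' _ _ h => h) ?_
  · simpa using hs₁.steps
  · refine ⟨0, (c₀.toNat : ℕ), x₀, true, ?_, ?_, ?_, ?_, ?_, ?_, ?_⟩
    · simpa using hr
    · cases c₀ <;> simp [ZMod.val_one]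
    · simp
    · simp
    · simp
    · rfl
    · rfl
  · intro k hk s' hf hI
    have hs' : Loaded P A B l w m p t s' :=
      (((hs₁.setReg).setReg).setReg).frame hf (by decide)
    refine stepBody_runs hz hs'.setReg (by simp) hk ?_
    simpa [Progress] using hI
  rintro s₂ hf₂ - ⟨r, c, x, ok, hr₂, hc, hx, hok, hver, hfin, hdiv⟩
  have hs₂ : Loaded P A B l w m p t s₂ :=
    (((hs₁.setReg).setReg).setReg).frame hf₂ (by decide)
  simp only [zero_mul, pow_zero, Nat.div_one] at hdiv
  have hcoins := hs₂.coins
  simp at hcoins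
  have hb := hz.base_le
  have hbL : 2 ^ (m + 1) ≤ L :=
    (Nat.pow_le_pow_right (by norm_num) (by omega)).trans hz.message
  refine Runs.call (readBits_runs (x := x) (n := m + 1) h8 (by decide) (by decide)
    (by decide) hx (by simp [hcoins])
    ((Nat.lt_two_pow_self.le).trans hbL) hLX hb) fun s₃ hf₃ _ ⟨hm₃, _⟩ => ?_
  have hs₃ := hs₂.frame hf₃ (by decide)
  have harr₃ := hf₃.2 8 (by decide)
  have hj₃ : s₃.reg rString = j := by
    rw [hf₃.1 _ (by decide), hf₂.1 _ (by decide)]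
    simpa using (hf₁.1 rString (by decide)).trans hj
  refine Runs.call (evalSums_runs hz hs₃ (r := r)
    (fun i hi => by rw [harr₃]; exact hr₂ i (by omega)) hj₃) fun s₄ hf₄ _ ⟨hA, hB⟩ => ?_
  have hs₄ := hs₃.frame hf₄ (by decide)
  have hj₄ := (hf₄.1 rString (by decide)).trans hj₃
  have hc₄ : s₄.reg rClaim = c.val := by
    rw [hf₄.1 _ (by decide), hf₃.1 _ (by decide), hc]
  have hok₄ : s₄.reg rOk = ok.toNat := by
    rw [hf₄.1 _ (by decide), hf₃.1 _ (by decide), hok]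
  have hcell : s₄.reg rCell = x₀ := by
    rw [hf₄.1 _ (by decide), hf₃.1 _ (by decide), hf₂.1 _ (by decide)]
    simpa using hx₁
  have hm₄ : s₄.reg rMsg = oddBits (m + 1) (x₀ / 4 ^ (numSteps l w * roundsPerStep m)) := by
    rw [hf₄.1 _ (by decide), hm₃, ← hdiv, oddBits]
  have harr : ∀ a, a = 6 ∨ a = 7 → s₄.arr a = s.arr a := by
    rintro a (rfl | rfl) <;>
    · rw [hf₄.2 _ (by decide), hf₃.2 _ (by decide), hf₂.2 _ (by decide)]
      simpa using hf₁.2 _ (by decide)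
  set msg := oddBits (m + 1) (x₀ / 4 ^ (numSteps l w * roundsPerStep m)) with hmsg
  have hprime := hs₄.prime
  have hsize := hs₄.size
  simp at hj₄ hc₄ hok₄ hcell hm₄ hA hB hprime hsize
  have hcmp : ∀ y z : ℕ, 1 - (y - z + (z - y)) = (decide (y = z)).toNat := by
    intro y z
    by_cases h : y = z
    · simp [h]
    · have : 1 - (y - z + (z - y)) = 0 := by omega
      simp [this, h]
  have halice : aliceDecision (p := p) l w m P (c₀.toNat : ℕ) (A j)
      (x₀ % 4 ^ (numSteps l w * roundsPerStep m)) msg =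
      (ok && decide ((aliceSum l w P (A j) r + (msg : ZMod p)).val = c.val)) := by
    rw [aliceDecision, verdict_mod, hver, verdict]
    simp only [(ZMod.val_injective p).eq_iff, eq_comm]
  have hbob : bobMessage p l w m P (B j) (evenBits (numSteps l w * roundsPerStep m) x₀) =
      (bobSum (p := p) l w P (B j) r).val := by
    rw [bobMessage, hfin]
    rfl
  rw [halice, hbob]
  refine Runs.set h8 (v := (aliceSum l w P (A j) r + (msg : ZMod p)).val) ?_ (hval _) <|
    Runs.put h8 (j := j * 2 ^ t + x₀)
      (v := (ok && decide ((aliceSum l w P (A j) r + (msg : ZMod p)).val = c.val)).toNat)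
      (by simp [hj₄, hsize, hcell]) ?_ (hbool _) <|
    Runs.put h8 (j := j * 2 ^ t + x₀)
      (v := (decide ((bobSum (p := p) l w P (B j) r).val = msg)).toNat)
      (by simp [hj₄, hsize, hcell]) ?_ (hbool _) <|
    Runs.nil ⟨fun i => ?_, fun i => ?_⟩
  · simp [hA, hm₄, hprime]
    refine mod_eq_val ?_
    rw [Nat.cast_add, cast_val]
  · simp [hok₄, hc₄, hcmp]
    cases ok <;> simp
  · simp [hB, hm₄, hcmp]
  · simp [harr]
  · simp [harr]

end

end RAM

/-! ### The program: parameters and main loop -/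

namespace RAM

open Cmd Exp Arithmetization BranchingProgram

/-- candidate for a prime -/
@[simp] abbrev rCand : ℕ := 58
/-- is the candidate a prime? -/
@[simp] abbrev rFlag : ℕ := 59
/-- possible divisor -/
@[simp] abbrev rDiv : ℕ := 60
/-- number of remaining candidates -/
@[simp] abbrev rLeft : ℕ := 61

/-- `rFlag` becomes nonzero if and only if `rCand` is a prime.  It starts with `rCand - 1`, which
excludes the candidates `0` and `1`, and the truncated difference `rDiv - 1` excludes the divisors
`0` and `1`. -/
def testPrime : Cmd :=
  block [.set rFlag (v rCand - 1),
    .loop rDiv (v rCand)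
      (.ite ((v rDiv - 1) * (1 - v rCand % v rDiv)) (block [.set rFlag 0]) .skip)]

/-- `rPrime` becomes the largest prime that is at most `rBase`: the candidates ascend from `1`, and
the last prime remains. -/
def findPrime : Cmd :=
  block [.set rPrime 0, .loop rLeft (v rBase) (block [.set rCand (v rBase - v rLeft), testPrime,
    .ite (v rFlag) (block [.set rPrime (v rCand)]) .skip])]

/-- The parameters are read and computed.  The variable `rPrime` also serves as an auxiliary
variable before the prime is known. -/
def preamble : Cmd :=
  block [.set rN (.get 0 0), .set rLen (.get 0 1), .set rWidth (.get 0 2), .set rTime (.get 0 3),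
    .set rPrec (.get 0 4), ceilLog rNode rWidth, ceilLog rLayer rTime,
    .set rVars (v rLayer + 2 * v rNode), .set rCoord (v rLayer + 3 * v rNode),
    .set rSteps (v rLayer * (2 * v rNode + 1) * (v rCoord + 1)),
    .set rPrime (3 * v rSteps), ceilLog rCoins rPrime, .set rCoins (v rPrec + 1 + v rCoins),
    .set rDim (2 * (v rSteps * (4 * (v rCoins + 1) + v rCoins) + (v rCoins + 1))),
    powTwo rBase (v rCoins + 1), findPrime, powTwo rSize (v rDim), powTwo rLayers (v rLayer),
    powTwo rNodes (v rNode), powTwo rCube (v rVars), .put 5 0 (v rDim)]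

/-- The entries of the tensors of the strings number `rString`. -/
def stringBody (c₀ : Bool) : Cmd := .loop rCell (v rSize) (cellBody c₀)

/-- The whole program. -/
def tensorProgram (c₀ : Bool) : Cmd := .seq preamble (.loop rString (v rN) (stringBody c₀))

variable {X L : ℕ} {s : State}

theorem testPrime_runs (h8 : 8 ≤ X) (hLX : L ≤ X) {c : ℕ} (hc : s.reg rCand = c) (hcL : c ≤ L) :
    Runs X L testPrime s fun s' => s'.reg rFlag ≠ 0 ↔ c.Prime := by
  refine Runs.set h8 (v := c - 1) (by simp at hc; simp [hc]) (by omega) <|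
    Runs.call (Q' := fun s' => s'.reg rFlag ≠ 0 ↔ c.Prime) (Achieves.loop (n := c)
      (fun k s' => s'.reg rFlag ≠ 0 ↔ 2 ≤ c ∧ ∀ d, 2 ≤ d → k ≤ d → d < c → ¬ d ∣ c) h8
      (by simpa using hc) (hcL.trans hLX) hcL (by decide) ?_ ?_ ?_) fun s' _ _ h => Runs.nil h
  · simp
    constructor
    · exact fun h => ⟨by omega, fun d _ h1 h2 => by omega⟩
    · exact fun h => by omega
  · intro k hk s' hf hI
    have hc' : s'.reg rCand = c := by
      rw [hf.1 _ (by decide)]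
      simpa using hc
    simp at hc' hI
    refine Achieves.ite h8 (fun h1 => ?_) fun h1 => Achieves.skip ?_
    · simp [hc'] at h1
      refine Runs.set h8 (v := 0) rfl (by omega) (Runs.nil ?_)
      simp
      have : c % k = 0 := by omega
      exact fun _ => ⟨k, by omega, le_rfl, hk, Nat.dvd_of_mod_eq_zero this⟩
    · simp [hc'] at h1
      simp
      rw [hI]
      refine and_congr_right fun _ => ⟨fun h d h2 hkd hdc => ?_, fun h d h2 hkd hdc =>
        h d h2 (by omega) hdc⟩
      rcases Nat.lt_or_eq_of_le hkd with hlt | rfl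
      · exact h d h2 hlt hdc
      · intro hdvd
        have := Nat.mod_eq_zero_of_dvd hdvd
        omega
  · rintro s' _ _ h
    rw [h, Nat.prime_def_lt']
    simp

theorem findPrime_runs (h8 : 8 ≤ X) (hLX : L ≤ X) {b : ℕ} (hb : s.reg rBase = b) (hbL : b ≤ L) :
    Runs X L findPrime s fun s' => s'.reg rPrime = Nat.findGreatest Nat.Prime b := by
  refine Runs.set h8 (v := 0) rfl (by omega) <|
    Runs.call (Achieves.loop (n := b)
      (fun k s' => s'.reg rPrime = Nat.findGreatest Nat.Prime (b - k)) h8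
      (by simpa using hb) (hbL.trans hLX) hbL (by decide) ?_ ?_ fun s' _ _ h => h)
    fun s' _ _ h => Runs.nil (by simpa using h)
  · simp
  · intro k hk s' hf hI
    have hb' : s'.reg rBase = b := by
      rw [hf.1 _ (by decide)]
      simpa using hb
    simp at hb' hI
    refine Runs.set h8 (v := b - k) (by simp [hb']) (by omega) <|
      Runs.call (testPrime_runs h8 hLX (c := b - k) (by simp) (by omega)) fun s₁ hf₁ _ h1 => ?_
    have hc₁ := hf₁.1 rCand (by decide)
    have hp₁ := hf₁.1 rPrime (by decide)
    simp [hI] at hc₁ hp₁ h1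
    have hsucc : b - k = b - (k + 1) + 1 := by omega
    refine Runs.call (Q' := fun s' => s'.reg rPrime = Nat.findGreatest Nat.Prime (b - k))
      (Achieves.ite h8 (fun h2 => ?_) fun h2 => Achieves.skip ?_) fun s' _ _ h => Runs.nil h
    · simp at h2
      refine Runs.set h8 (v := b - k) (by simp [hc₁]) (by omega) (Runs.nil ?_)
      rw [hsucc, Nat.findGreatest_succ, if_pos (by rw [← hsucc]; exact h1.1 h2)]
      simp
    · simp at h2
      rw [hsucc, Nat.findGreatest_succ, if_neg (by rw [← hsucc]; exact fun h => h1.2 h h2)]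
      simpa using hp₁

section

variable {W T h N : ℕ} {P : BranchingProgram W T (h + h)} {A B : Fin N → Fin h → Bool}
  {k l w m p t : ℕ}

theorem preamble_runs (hl : l = Nat.clog 2 T) (hw : w = Nat.clog 2 W)
    (hm : m = k + 1 + Nat.clog 2 (3 * numSteps l w))
    (ht : t = 2 * (numSteps l w * roundsPerStep m + (m + 1)))
    (hp : p = Nat.findGreatest Nat.Prime (2 ^ (m + 1)))
    (hz : Sizes l w m p t X L) (hWL : W ≤ L) (hTL : T ≤ L) (hSL : 3 * numSteps l w ≤ L)
    (hLX : 2 * L ≤ X) :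
    Runs X L preamble (inputState P k A B) fun s' =>
      Loaded P A B l w m p t s' ∧ s'.arr 5 0 = t := by
  have h8 := hz.eight_le
  have hL := hz.le
  have hcoords := hz.coords
  have hsteps := hz.steps
  have hbase : 2 ^ (m + 1) ≤ L :=
    (Nat.pow_le_pow_right (by norm_num) (by omega)).trans hz.message
  have hmL : m + 1 ≤ L := Nat.lt_two_pow_self.le.trans hbase
  have htL : t ≤ L := Nat.lt_two_pow_self.le.trans hz.size
  have hpow : ∀ i ≤ l + 2 * w, 2 ^ i ≤ X := fun i hi =>
    (Nat.pow_le_pow_right (by norm_num) hi).trans (hz.cube.trans hL)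
  refine Achieves.of_bdd fun hbd => ?_
  have e0 : (inputState P k A B).arr 0 0 = N := by simp [inputState, cells]
  have e1 : (inputState P k A B).arr 0 1 = h := by simp [inputState, cells]
  have e2 : (inputState P k A B).arr 0 2 = W := by simp [inputState, cells]
  have e3 : (inputState P k A B).arr 0 3 = T := by simp [inputState, cells]
  have e4 : (inputState P k A B).arr 0 4 = k := by simp [inputState, cells]
  refine Runs.set h8 (v := N) (by simp [e0]) (e0 ▸ hbd.2 _ _) <|
    Runs.set h8 (v := h) (by simp [e1]) (e1 ▸ hbd.2 _ _) <|
    Runs.set h8 (v := W) (by simp [e2]) (e2 ▸ hbd.2 _ _) <|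
    Runs.set h8 (v := T) (by simp [e3]) (e3 ▸ hbd.2 _ _) <|
    Runs.set h8 (v := k) (by simp [e4]) (e4 ▸ hbd.2 _ _) <|
    Runs.call (ceilLog_runs (x := W) h8 (by decide) (by decide) (by decide) (by decide) (by decide)
      (by simp) hWL hL (by omega)) fun s₁ hf₁ _ h₁ =>
    Runs.call (ceilLog_runs (x := T) h8 (by decide) (by decide) (by decide) (by decide) (by decide)
      (by simp (disch := decide) [hf₁.1]) hTL hL (by omega)) fun s₂ hf₂ _ h₂ => ?_
  rw [← hw] at h₁
  rw [← hl] at h₂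
  have h₁' := (hf₂.1 rNode (by decide)).trans h₁
  simp at h₁ h₂ h₁'
  refine Runs.set h8 (v := l + 2 * w) (by simp [h₂, h₁']) (by omega) <|
    Runs.set h8 (v := l + 3 * w) (by simp [h₂, h₁']) (by omega) <|
    Runs.set h8 (v := numSteps l w) (by simp [h₂, h₁', numSteps]) (by omega) <|
    Runs.set h8 (v := 3 * numSteps l w) (by simp) (by omega) <|
    Runs.call (ceilLog_runs (x := 3 * numSteps l w) h8 (by decide) (by decide) (by decide)
      (by decide) (by decide) (by simp) hSL hL (by omega)) fun s₃ hf₃ _ h₃ => ?_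
  have hk₃ : s₃.reg 4 = k := by simp (disch := decide) [hf₃.1, hf₂.1, hf₁.1]
  have hS₃ : s₃.reg 8 = numSteps l w := by simp (disch := decide) [hf₃.1]
  simp at h₃
  refine Runs.set h8 (v := m) (by simp [hk₃, h₃, hm]) (by omega) <|
    Runs.set h8 (v := t) (by simp [hS₃, ht]) (by omega) <|
    Runs.call (powTwo_runs (n := m + 1) h8 (by decide) (by simp) hmL hL (hbase.trans hL))
      fun s₄ hf₄ _ h₄ =>
    Runs.call (findPrime_runs h8 hL h₄ hbase) fun s₅ hf₅ _ h₅ =>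
    Runs.call (powTwo_runs (n := t) h8 (by decide)
      (by simp (disch := decide) [hf₅.1, hf₄.1]) htL hL (hz.size.trans hL)) fun s₆ hf₆ _ h₆ =>
    Runs.call (powTwo_runs (n := l) h8 (by decide)
      (by simp (disch := decide) [hf₆.1, hf₅.1, hf₄.1, hf₃.1, h₂]) (by omega) hL
      (hpow _ (by omega))) fun s₇ hf₇ _ h₇ =>
    Runs.call (powTwo_runs (n := w) h8 (by decide)
      (by simp (disch := decide) [hf₇.1, hf₆.1, hf₅.1, hf₄.1, hf₃.1, h₁']) (by omega) hL
      (hpow _ (by omega)))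
      fun s₈ hf₈ _ h₈ =>
    Runs.call (powTwo_runs (n := l + 2 * w) h8 (by decide)
      (by simp (disch := decide) [hf₈.1, hf₇.1, hf₆.1, hf₅.1, hf₄.1, hf₃.1]) (by omega) hL
      (hpow _ le_rfl))
      fun s₉ hf₉ _ h₉ =>
    Runs.put h8 (j := 0) (v := t) rfl
      (by simp (disch := decide) [hf₉.1, hf₈.1, hf₇.1, hf₆.1, hf₅.1, hf₄.1])
      (htL.trans hL) <| Runs.nil ⟨Loaded.setArr ?_, by simp⟩
  rw [← hp] at h₅
  have harr : ∀ a ≠ 5, s₉.arr a = (inputState P k A B).arr a := by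
    intro a _
    rw [hf₉.2 _ (by simp [powTwo, block, puts]), hf₈.2 _ (by simp [powTwo, block, puts]),
      hf₇.2 _ (by simp [powTwo, block, puts]), hf₆.2 _ (by simp [powTwo, block, puts]),
      hf₅.2 _ (by simp [findPrime, testPrime, block, puts]),
      hf₄.2 _ (by simp [powTwo, block, puts])]
    simp only [State.setReg_arr]
    rw [hf₃.2 _ (by simp [ceilLog, block, puts])]
    simp only [State.setReg_arr]
    rw [hf₂.2 _ (by simp [ceilLog, block, puts]), hf₁.2 _ (by simp [ceilLog, block, puts])]
    rfl
  simp at h₄ h₅ h₆ h₇ h₈ h₉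
  constructor
  all_goals first
    | simp (disch := decide) [hf₉.1, hf₈.1, hf₇.1, hf₆.1, hf₅.1, hf₄.1, hf₃.1, hf₂.1, hf₁.1,
        h₁, h₂, h₄, h₅, h₆, h₇, h₈, h₉]
    | exact harr _ (by decide)

variable [Fact p.Prime]

variable (P A B l w m p) in
/-- The entries from offset `y` on have been written to the arrays `6` and `7`. -/
def Filled (c₀ : Bool) (t y : ℕ) (s : State) : Prop :=
  ∀ (j : Fin N) (c : ℕ), c < 2 ^ t → y ≤ j * 2 ^ t + c →
    s.arr 6 (j * 2 ^ t + c) = (aliceDecision (p := p) l w m P (c₀.toNat : ℕ) (A j)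
      (c % 4 ^ (numSteps l w * roundsPerStep m))
      (oddBits (m + 1) (c / 4 ^ (numSteps l w * roundsPerStep m)))).toNat ∧
    s.arr 7 (j * 2 ^ t + c) =
      (decide (bobMessage p l w m P (B j) (evenBits (numSteps l w * roundsPerStep m) c) =
        oddBits (m + 1) (c / 4 ^ (numSteps l w * roundsPerStep m)))).toNat

theorem stringBody_runs (hz : Sizes l w m p t X L) (hs : Loaded P A B l w m p t s) {c₀ : Bool}
    {j : Fin N} (hj : s.reg rString = j) (hI : Filled P A B l w m p c₀ t ((j + 1) * 2 ^ t) s) :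
    Runs X L (stringBody c₀) s (Filled P A B l w m p c₀ t (j * 2 ^ t)) := by
  have hsize := hz.size
  refine Achieves.loop (n := 2 ^ t) (fun y => Filled P A B l w m p c₀ t (j * 2 ^ t + y))
    hz.eight_le hs.size (hsize.trans hz.le) hsize (by cases c₀ <;> decide) ?_ ?_ fun s' _ _ h => h
  · rwa [← Nat.succ_mul]
  · intro y hy s' hf hI'
    have hs' : Loaded P A B l w m p t s' := hs.frame hf (by cases c₀ <;> decide)
    have hj' : (s'.setReg rCell y).reg rString = j := by
      simpa using (hf.1 rString (by cases c₀ <;> decide)).trans hj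
    refine (cellBody_runs hz hs'.setReg (x₀ := y) (by simp) hj').imp
      fun s₂ _ _ ⟨h6, h7⟩ i c hc hle => ?_
    rw [h6, h7]
    by_cases hic : (i : ℕ) * 2 ^ t + c = j * 2 ^ t + y
    · have hc' : c = y := by
        have := congrArg (· % 2 ^ t) hic
        simpa [Nat.mod_eq_of_lt hc, Nat.mod_eq_of_lt hy] using this
      subst hc'
      have hij : i = j :=
        Fin.ext (Nat.eq_of_mul_eq_mul_right (Nat.two_pow_pos t) (Nat.add_right_cancel hic))
      subst hij
      simp
    · rw [if_neg hic, if_neg hic]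
      exact hI' i c hc (by omega)

theorem mainLoop_achieves (hz : Sizes l w m p t X L) (hs : Loaded P A B l w m p t s)
    (hN : N ≤ X) (c₀ : Bool) :
    Achieves X ((v rN).cost + (2 + (N * ((stringBody c₀).cost L + 3) + 1)))
      (.loop rString (v rN) (stringBody c₀)) s
      fun s' => s'.arr 5 = s.arr 5 ∧ Filled P A B l w m p c₀ t 0 s' := by
  refine Achieves.loop' (n := N) (fun y => Filled P A B l w m p c₀ t (y * 2 ^ t))
    hz.eight_le hs.num hN (by cases c₀ <;> decide) ?_ ?_ fun s' hf _ h =>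
      ⟨hf.2 5 (by cases c₀ <;> decide), by simpa using h⟩
  · intro j c hc hle
    have := Nat.mul_le_mul_right (2 ^ t) (Nat.succ_le_of_lt j.is_lt)
    rw [Nat.succ_mul] at this
    omega
  · intro y hy s' hf hI
    have hs' : Loaded P A B l w m p t s' := hs.frame hf (by cases c₀ <;> decide)
    exact stringBody_runs hz hs'.setReg (j := ⟨y, hy⟩) (by simp) hI

/-- The program computes the tensors, in time linear in the number of strings. -/
theorem exists_exec_tensorProgram (hl : l = Nat.clog 2 T) (hw : w = Nat.clog 2 W)
    (hm : m = k + 1 + Nat.clog 2 (3 * numSteps l w))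
    (ht : t = 2 * (numSteps l w * roundsPerStep m + (m + 1)))
    (hp : p = Nat.findGreatest Nat.Prime (2 ^ (m + 1)))
    (hz : Sizes l w m p t X L) (hWL : W ≤ L) (hTL : T ≤ L) (hSL : 3 * numSteps l w ≤ L)
    (hLX : 2 * L ≤ X) (hN : N ≤ X) (hb : (inputState P k A B).Bdd X) (c₀ : Bool) :
    ∃ s' steps, Exec (X ^ 8) (tensorProgram c₀).compile (inputState P k A B) s' steps ∧
      steps ≤ preamble.cost L + (2 + (2 + (N * ((stringBody c₀).cost L + 3) + 1))) ∧
      s'.arr 5 0 = t ∧ Filled P A B l w m p c₀ t 0 s' := by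
  obtain ⟨s', steps, h1, h2, -, -, h3, h4⟩ := (Achieves.seq
    ((preamble_runs (A := A) (B := B) (P := P) hl hw hm ht hp hz hWL hTL hSL hLX).imp
      fun s₁ _ _ h => (mainLoop_achieves hz h.1 hN c₀).imp (Q' := fun s' => s'.arr 5 0 = t ∧
        Filled P A B l w m p c₀ t 0 s') fun s₂ _ _ h' => ⟨by rw [h'.1, h.2], h'.2⟩))
    (inputState P k A B) rfl hb
  exact ⟨s', steps, h1, h2, h3, h4⟩

end

end RAM

/-! ### Parameters and their sizes -/

namespace TropicalSimilarity

open Arithmetization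

section Parameters

variable (W T k : ℕ)

/-- The number of bits of a node. -/
def nodeBits : ℕ := Nat.clog 2 W

/-- The number of bits of a layer. -/
def layerBits : ℕ := Nat.clog 2 T

/-- The number of reduction steps. -/
def stepCount : ℕ := numSteps (layerBits T) (nodeBits W)

/-- The number of coins for each step, where the threshold is at least `2 ^ (-k)`: the summand
`⌈log (3 * S)⌉` compensates for the factor `3 * S` in the soundness error of `S` steps, and the
summand `1` makes the inequality strict. -/
def coinBits : ℕ := k + 1 + Nat.clog 2 (3 * stepCount W T)

/-- The number of rounds. -/
def rounds : ℕ := stepCount W T * roundsPerStep (coinBits W T k)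

/-- The number of dimensions of the tensors. -/
def dims : ℕ := 2 * (rounds W T k + (coinBits W T k + 1))

/-- The size of the field. -/
def fieldSize : ℕ := Nat.findGreatest Nat.Prime (2 ^ (coinBits W T k + 1))

variable {W T k}

/-- Bertrand's postulate between powers of two. -/
theorem exists_prime_between (m : ℕ) : ∃ q ≤ 2 ^ (m + 1), q.Prime ∧ 2 ^ m ≤ q := by
  obtain ⟨q, h1, h2, h3⟩ := Nat.exists_prime_lt_and_le_two_mul (2 ^ m) (by positivity)
  exact ⟨q, by rw [pow_succ]; omega, h1, h2.le⟩

theorem fieldSize_prime : (fieldSize W T k).Prime := by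
  obtain ⟨q, h1, h2, -⟩ := exists_prime_between (coinBits W T k)
  exact Nat.findGreatest_spec h1 h2

theorem fieldSize_le : fieldSize W T k ≤ 2 ^ (coinBits W T k + 1) := Nat.findGreatest_le _

theorem le_fieldSize : 2 ^ coinBits W T k ≤ fieldSize W T k := by
  obtain ⟨q, h1, h2, h3⟩ := exists_prime_between (coinBits W T k)
  exact h3.trans (Nat.le_findGreatest h1 h2)

theorem one_le_clog {x : ℕ} (hx : 2 ≤ x) : 1 ≤ Nat.clog 2 x :=
  Nat.clog_pos (by norm_num) hx

theorem one_le_logb {x : ℕ} (hx : 2 ≤ x) : 1 ≤ Real.logb 2 x := by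
  rw [Real.le_logb_iff_rpow_le (by norm_num) (by positivity), Real.rpow_one]
  exact_mod_cast hx

theorem clog_lt {x : ℕ} (hx : 1 ≤ x) : (Nat.clog 2 x : ℝ) < Real.logb 2 x + 1 := by
  have h := Real.natCeil_logb_natCast 2 x
  rw [Nat.cast_ofNat] at h
  rw [← h]
  exact Nat.ceil_lt_add_one (Real.logb_nonneg (by norm_num) (by exact_mod_cast hx))

theorem clog_le {x : ℕ} (hx : 2 ≤ x) : (Nat.clog 2 x : ℝ) ≤ 2 * Real.logb 2 x := by
  have := clog_lt (one_le_two.trans hx)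
  have := one_le_logb hx
  linarith

theorem numSteps_le {l w : ℕ} (hl : 1 ≤ l) (hw : 1 ≤ w) : numSteps l w ≤ 15 * (l ^ 2 * w ^ 2) := by
  have h1 : 2 * w + 1 ≤ 3 * w := by omega
  have h2 : l + 3 * w + 1 ≤ 5 * (l * w) := by nlinarith [Nat.mul_le_mul hl hw]
  calc numSteps l w ≤ l * (3 * w) * (5 * (l * w)) :=
        Nat.mul_le_mul (Nat.mul_le_mul_left _ h1) h2
    _ = _ := by ring

theorem le_numSteps {l w : ℕ} (hl : 1 ≤ l) : l + 3 * w + 1 ≤ numSteps l w :=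
  Nat.le_mul_of_pos_left _ (Nat.mul_pos hl (by omega))

theorem le_stepCount (hT : 2 ≤ T) : layerBits T + 3 * nodeBits W + 1 ≤ stepCount W T :=
  le_numSteps (one_le_clog hT)

theorem stepCount_le (hW : 2 ≤ W) (hT : 2 ≤ T) :
    (stepCount W T : ℝ) ≤ 240 * (Real.logb 2 W ^ 2 * Real.logb 2 T ^ 2) := by
  -- rounding up at most doubles each of the four logarithms: `240 = 15 * 2 ^ 4`
  have h1 : (stepCount W T : ℝ) ≤ 15 * ((layerBits T : ℝ) ^ 2 * (nodeBits W : ℝ) ^ 2) := by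
    exact_mod_cast numSteps_le (one_le_clog hT) (one_le_clog hW)
  have h2 : (layerBits T : ℝ) ^ 2 ≤ (2 * Real.logb 2 T) ^ 2 :=
    pow_le_pow_left₀ (by positivity) (clog_le hT) 2
  have h3 : (nodeBits W : ℝ) ^ 2 ≤ (2 * Real.logb 2 W) ^ 2 :=
    pow_le_pow_left₀ (by positivity) (clog_le hW) 2
  have h4 := mul_le_mul h2 h3 (by positivity) (by positivity)
  nlinarith

theorem logb_stepCount_le (hW : 2 ≤ W) (hT : 2 ≤ T) : (Nat.clog 2 (3 * stepCount W T) : ℝ) ≤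
    11 + 2 * Real.logb 2 (Real.logb 2 W) + 2 * Real.logb 2 (Real.logb 2 T) := by
  have hw := one_le_logb hW
  have ht := one_le_logb hT
  have hS := le_stepCount (W := W) hT
  have h1 := clog_lt (x := 3 * stepCount W T) (by omega)
  have h2 : ((3 * stepCount W T : ℕ) : ℝ) ≤
      2 ^ 10 * (Real.logb 2 W ^ 2 * Real.logb 2 T ^ 2) := by
    have := stepCount_le hW hT
    have : 0 ≤ Real.logb 2 W ^ 2 * Real.logb 2 T ^ 2 := by positivity
    push_cast
    linarith
  have h3 := Real.logb_le_logb_of_le (b := 2) (by norm_num)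
    (by exact_mod_cast (by omega : 0 < 3 * stepCount W T)) h2
  rw [Real.logb_mul (by positivity) (by positivity), Real.logb_mul (by positivity) (by positivity),
    Real.logb_pow, Real.logb_pow, Real.logb_pow, Real.logb_self_eq_one (by norm_num)] at h3
  push_cast at h1 h3
  linarith

theorem loglog_nonneg (hW : 2 ≤ W) (hT : 2 ≤ T) :
    0 ≤ Real.logb 2 (Real.logb 2 W) ∧ 0 ≤ Real.logb 2 (Real.logb 2 T) :=
  ⟨Real.logb_nonneg (by norm_num) (one_le_logb hW), Real.logb_nonneg (by norm_num) (one_le_logb hT)⟩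

variable {ε : ℝ}

theorem one_le_logTerm (hW : 2 ≤ W) (hT : 2 ≤ T) (hε : 0 < ε) (hε1 : ε ≤ 1) :
    1 ≤ logTerm W T ε := by
  obtain ⟨h1, h2⟩ := loglog_nonneg hW hT
  have h3 : 0 ≤ Real.logb 2 ε⁻¹ :=
    Real.logb_nonneg (by norm_num) ((one_le_inv₀ hε).2 hε1)
  unfold logTerm
  linarith

theorem coinBits_le (hW : 2 ≤ W) (hT : 2 ≤ T) (hε : 0 < ε) (hε1 : ε ≤ 1) :
    (coinBits W T ⌈Real.logb 2 ε⁻¹⌉₊ : ℝ) + 1 ≤ 14 * logTerm W T ε := by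
  obtain ⟨h1, h2⟩ := loglog_nonneg hW hT
  have h3 : 0 ≤ Real.logb 2 ε⁻¹ :=
    Real.logb_nonneg (by norm_num) ((one_le_inv₀ hε).2 hε1)
  have h4 := logb_stepCount_le hW hT
  have h5 := Nat.ceil_lt_add_one h3
  unfold logTerm coinBits
  push_cast
  linarith

theorem rounds_le (hW : 2 ≤ W) (hT : 2 ≤ T) (hε : 0 < ε) (hε1 : ε ≤ 1) :
    (rounds W T ⌈Real.logb 2 ε⁻¹⌉₊ : ℝ) ≤ 16800 * sizeExponent W T ε := by
  have h1 := stepCount_le hW hT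
  have h2 := coinBits_le hW hT hε hε1
  have h3 : (roundsPerStep (coinBits W T ⌈Real.logb 2 ε⁻¹⌉₊) : ℝ) ≤ 70 * logTerm W T ε := by
    simp only [roundsPerStep]
    push_cast
    linarith
  -- `240 * 70 = 16800`
  have h4 := mul_le_mul h1 h3 (by positivity) (by positivity)
  rw [rounds, sizeExponent]
  push_cast at h4 ⊢
  linarith

theorem logTerm_le (hW : 2 ≤ W) (hT : 2 ≤ T) (hε : 0 < ε) (hε1 : ε ≤ 1) :
    logTerm W T ε ≤ sizeExponent W T ε := by
  have h1 := one_le_logTerm hW hT hε hε1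
  have h2 := mul_le_mul (one_le_pow₀ (one_le_logb hW) (n := 2))
    (one_le_pow₀ (one_le_logb hT) (n := 2)) zero_le_one (by positivity)
  rw [sizeExponent]
  nlinarith

theorem dims_le (hW : 2 ≤ W) (hT : 2 ≤ T) (hε : 0 < ε) (hε1 : ε ≤ 1) :
    (dims W T ⌈Real.logb 2 ε⁻¹⌉₊ : ℝ) ≤ 34000 * sizeExponent W T ε := by
  have h1 := rounds_le hW hT hε hε1
  have h2 := coinBits_le hW hT hε hε1
  have h3 := logTerm_le hW hT hε hε1
  have h4 := one_le_logTerm hW hT hε hε1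
  -- `2 * (16800 + 14) ≤ 34000`
  rw [dims]
  push_cast
  linarith

theorem two_pow_dims_le {C : ℕ} (hC : 34000 ≤ C) (hW : 2 ≤ W) (hT : 2 ≤ T) (hε : 0 < ε)
    (hε1 : ε ≤ 1) :
    (2 : ℝ) ^ dims W T ⌈Real.logb 2 ε⁻¹⌉₊ ≤ (2 : ℝ) ^ (C * sizeExponent W T ε) := by
  have hK := (one_le_logTerm hW hT hε hε1).trans (logTerm_le hW hT hε hε1)
  have hC' : (34000 : ℝ) ≤ C := by exact_mod_cast hC
  rw [← Real.rpow_natCast]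
  exact Real.rpow_le_rpow_of_exponent_le (by norm_num) ((dims_le hW hT hε hε1).trans
    (mul_le_mul_of_nonneg_right hC' (by linarith)))

/-- The soundness error is less than the threshold. -/
theorem error_lt (hT : 2 ≤ T) (hε : 0 < ε) :
    3 * (stepCount W T : ℝ) / 2 ^ coinBits W T ⌈Real.logb 2 ε⁻¹⌉₊ < ε := by
  have hS := le_stepCount (W := W) hT
  have h1 : (3 * stepCount W T : ℝ) ≤ 2 ^ Nat.clog 2 (3 * stepCount W T) := by
    exact_mod_cast Nat.le_pow_clog (b := 2) (by norm_num) (3 * stepCount W T)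
  have h2 : ε⁻¹ ≤ 2 ^ ⌈Real.logb 2 ε⁻¹⌉₊ := by
    have := (Real.logb_le_iff_le_rpow (b := 2) (by norm_num) (inv_pos.2 hε)).1
      (Nat.le_ceil (Real.logb 2 ε⁻¹))
    rwa [Real.rpow_natCast] at this
  have h3 : 1 ≤ ε * 2 ^ ⌈Real.logb 2 ε⁻¹⌉₊ := by
    rwa [inv_le_iff_one_le_mul₀' hε] at h2
  have h0 : (0 : ℝ) < 2 ^ Nat.clog 2 (3 * stepCount W T) := by positivity
  rw [div_lt_iff₀ (by positivity), coinBits, pow_add, pow_succ]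
  nlinarith

/-- All loops of the program but the one over the strings are bounded by the size of the tensors. -/
theorem sizes (W : ℕ) (hT : 2 ≤ T) {X : ℕ} (hX : 4 * 2 ^ dims W T k ≤ X) :
    RAM.Sizes (layerBits T) (nodeBits W) (coinBits W T k) (fieldSize W T k) (dims W T k) X
      (2 ^ dims W T k) := by
  have hS := le_stepCount (W := W) hT
  have hr : 4 * (coinBits W T k + 1) ≤ rounds W T k := by
    refine le_trans ?_ (Nat.le_mul_of_pos_left _ (by omega))
    simp only [roundsPerStep]
    omega
  have hSr : stepCount W T ≤ rounds W T k :=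
    Nat.le_mul_of_pos_right _ (by simp only [roundsPerStep]; omega)
  have hd : dims W T k = 2 * (rounds W T k + (coinBits W T k + 1)) := rfl
  have hle : ∀ i ≤ dims W T k, i ≤ 2 ^ dims W T k := fun i hi => hi.trans Nat.lt_two_pow_self.le
  have hpow : ∀ i ≤ dims W T k, 2 ^ i ≤ 2 ^ dims W T k := fun i hi =>
    Nat.pow_le_pow_right (by norm_num) hi
  refine ⟨?_, by omega, hle _ (by omega), hle _ ?_, hpow _ (by omega), hpow _ (by omega), le_rfl,
    fieldSize_le⟩
  · have := hpow 1 (by omega)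
    omega
  · have : numSteps (layerBits T) (nodeBits W) = stepCount W T := rfl
    omega

/-- The input fits into words that can hold its size. -/
theorem inputState_bdd {h N X : ℕ} (P : BranchingProgram W T (h + h))
    (A B : Fin N → Fin h → Bool) (hk : k ≤ X) (hX : RAM.inputSize W T h N ≤ X) (hW : 2 ≤ W)
    (hT : 2 ≤ T) (hN : 1 ≤ N) : (RAM.inputState P k A B).Bdd X := by
  have hh : 1 ≤ h := by
    have := (P.var ⟨0, by omega⟩).is_lt
    omega
  have hcells : ∀ {n : ℕ} (g : Fin n → ℕ), (∀ i, g i ≤ X) → ∀ i, RAM.cells g i ≤ X := by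
    intro n g hg i
    unfold RAM.cells
    split_ifs
    exacts [hg _, Nat.zero_le _]
  have h1 : 1 ≤ X := le_trans (by simp only [RAM.inputSize]; omega) hX
  have hstring : ∀ (A : Fin N → Fin h → Bool) (i : ℕ), RAM.stringCells A i ≤ 1 := by
    intro A i
    unfold RAM.stringCells RAM.cells
    split_ifs
    exacts [Bool.toNat_le _, zero_le_one]
  have hhN : h ≤ N * h := Nat.le_mul_of_pos_left _ hN
  have hNh : N ≤ N * h := Nat.le_mul_of_pos_right _ hh
  have hWT : W ≤ (T - 1) * (W * (W * 2)) :=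
    (Nat.le_mul_of_pos_right W (by positivity)).trans (Nat.le_mul_of_pos_left _ (by omega))
  simp only [RAM.inputSize] at hX
  refine ⟨fun r => Nat.zero_le _, fun a i => ?_⟩
  match a with
  | 0 =>
    refine hcells _ (fun i => ?_) i
    fin_cases i <;> simp <;> omega
  | 1 =>
    refine hcells (fun i => (P.var i : ℕ)) (fun i => ?_) i
    have := (P.var i).is_lt
    omega
  | 2 =>
    refine le_trans ?_ h1
    change RAM.edgeCells P i ≤ 1
    unfold RAM.edgeCells RAM.cells
    split_ifs
    exacts [Bool.toNat_le _, zero_le_one]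
  | 3 => exact (hstring A i).trans h1
  | 4 => exact (hstring B i).trans h1
  | _ + 5 => exact Nat.zero_le _

end Parameters

/-! ### The reduction -/

section Reduction

variable {W T h : ℕ}

instance (W T k : ℕ) : Fact (fieldSize W T k).Prime := ⟨fieldSize_prime⟩

/-- Alice's decision, where `c₀` is the claim about acceptance. -/
def decision (P : BranchingProgram W T (h + h)) (k : ℕ) (c₀ : Bool) :
    (Fin h → Bool) → ℕ → ℕ → Bool :=
  aliceDecision (p := fieldSize W T k) (layerBits T) (nodeBits W) (coinBits W T k) P
    (c₀.toNat : ℕ)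

/-- Bob's message. -/
def message (P : BranchingProgram W T (h + h)) (k : ℕ) : (Fin h → Bool) → ℕ → ℕ :=
  bobMessage (fieldSize W T k) (layerBits T) (nodeBits W) (coinBits W T k) P

theorem message_lt (P : BranchingProgram W T (h + h)) (k : ℕ) (y : Fin h → Bool) (e : ℕ) :
    message P k y e < 2 ^ (coinBits W T k + 1) :=
  (ZMod.val_lt _).trans_le fieldSize_le

/-- The tensor of a string of Alice. -/
def tensorG (P : BranchingProgram W T (h + h)) (k : ℕ) (c₀ : Bool) (x : Fin h → Bool) :
    Tensor (dims W T k) :=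
  IPProtocol.aliceTensor (rounds W T k) (coinBits W T k + 1) (decision P k c₀) x

/-- The tensor of a string of Bob. -/
def tensorH (P : BranchingProgram W T (h + h)) (k : ℕ) (y : Fin h → Bool) :
    Tensor (dims W T k) :=
  IPProtocol.bobTensor (rounds W T k) (coinBits W T k + 1) (message P k) y

theorem tensorG_testBit (P : BranchingProgram W T (h + h)) (k : ℕ) (c₀ : Bool) (x : Fin h → Bool)
    {c : ℕ} (hc : c < 2 ^ dims W T k) : tensorG P k c₀ x (fun i => c.testBit i) =
      decision P k c₀ x (c % 4 ^ rounds W T k)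
        (oddBits (coinBits W T k + 1) (c / 4 ^ rounds W T k)) := by
  have hmod : Nat.ofBits (fun i : Fin (dims W T k) => c.testBit i) = c := by
    rw [Nat.ofBits_testBit, Nat.mod_eq_of_lt hc]
  conv_rhs => rw [← hmod]
  rfl

theorem tensorH_testBit (P : BranchingProgram W T (h + h)) (k : ℕ) (y : Fin h → Bool)
    {c : ℕ} (hc : c < 2 ^ dims W T k) : tensorH P k y (fun i => c.testBit i) =
      decide (message P k y (evenBits (rounds W T k) c) =
        oddBits (coinBits W T k + 1) (c / 4 ^ rounds W T k)) := by
  have hmod : Nat.ofBits (fun i : Fin (dims W T k) => c.testBit i) = c := by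
    rw [Nat.ofBits_testBit, Nat.mod_eq_of_lt hc]
  conv_rhs => rw [← hmod]
  rfl

/-- The protocol for the claim `c₀` about acceptance. -/
def protocol (P : BranchingProgram W T (h + h)) (k : ℕ) (c₀ : Bool) :
    IPProtocol (Fin h → Bool) (Fin h → Bool) :=
  IPProtocol.ofNumbers (rounds W T k) (coinBits W T k + 1) (decision P k c₀) (message P k)

/-- The gap, for both kinds of claims: for `c₀ = true` the similarity is `1` if the program accepts,
and for `c₀ = false` it is `1` if the program does not accept. -/
theorem tropSim_gap (P : BranchingProgram W T (h + h)) (c₀ : Bool) {ε : ℝ} (hW : 2 ≤ W)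
    (hT : 2 ≤ T) (hε : 0 < ε) (x y : Fin h → Bool) :
    ((P.Accepts (Fin.append x y) ↔ c₀ = true) →
      tropSim (tensorG P ⌈Real.logb 2 ε⁻¹⌉₊ c₀ x) (tensorH P ⌈Real.logb 2 ε⁻¹⌉₊ y) = 1) ∧
    (¬ (P.Accepts (Fin.append x y) ↔ c₀ = true) →
      tropSim (tensorG P ⌈Real.logb 2 ε⁻¹⌉₊ c₀ x) (tensorH P ⌈Real.logb 2 ε⁻¹⌉₊ y) < ε) := by
  have key := tropSim_protocol P (fieldSize_le (W := W) (T := T) (k := ⌈Real.logb 2 ε⁻¹⌉₊))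
    le_fieldSize hW hT
    (Nat.le_pow_clog (b := 2) (by norm_num) W)
    ((Nat.sub_le T 1).trans (Nat.le_pow_clog (b := 2) (by norm_num) T)) c₀ x y
  exact ⟨key.1, fun hA => (key.2 hA).trans_lt (error_lt hT hε)⟩

theorem simulatedProtocol (P : BranchingProgram W T (h + h)) (c₀ : Bool) {ε : ℝ} {C : ℕ}
    (hC : 34000 ≤ C) (hW : 2 ≤ W) (hT : 2 ≤ T) (hε : 0 < ε) (hε1 : ε ≤ 1) :
    SimulatedProtocol (protocol P ⌈Real.logb 2 ε⁻¹⌉₊ c₀) C W T ε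
      (fun x y => P.Accepts (Fin.append x y) ↔ c₀ = true)
      (tensorG P ⌈Real.logb 2 ε⁻¹⌉₊ c₀) (tensorH P ⌈Real.logb 2 ε⁻¹⌉₊) := by
  have hopt : ∀ x y, (protocol P ⌈Real.logb 2 ε⁻¹⌉₊ c₀).IsOptimalAcceptProb x y
      (tropSim (tensorG P ⌈Real.logb 2 ε⁻¹⌉₊ c₀ x) (tensorH P ⌈Real.logb 2 ε⁻¹⌉₊ y)) :=
    fun x y => IPProtocol.ofNumbers_isOptimal _ _ _ _ x y (message_lt P _ y)
  have hC' : (34000 : ℝ) ≤ C := by exact_mod_cast hC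
  have hq := one_le_logTerm hW hT hε hε1
  have hK := hq.trans (logTerm_le hW hT hε hε1)
  have hrounds : (rounds W T ⌈Real.logb 2 ε⁻¹⌉₊ : ℝ) ≤ C * sizeExponent W T ε :=
    (rounds_le hW hT hε hε1).trans (mul_le_mul_of_nonneg_right (by linarith) (by linarith))
  refine ⟨fun x y => ⟨fun hf => ?_, fun hf σ => ?_⟩, ?_, ?_, ?_, hopt⟩
  · obtain ⟨σ, hσ⟩ := (hopt x y).1
    exact ⟨σ, hσ.trans ((tropSim_gap P c₀ hW hT hε x y).1 hf)⟩
  · exact ((hopt x y).2 ⟨σ, rfl⟩).trans ((tropSim_gap P c₀ hW hT hε x y).2 hf).le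
  · rwa [protocol, IPProtocol.merlinBits, IPProtocol.ofNumbers, IPProtocol.count_alternating]
  · rwa [protocol, IPProtocol.numCoins, IPProtocol.ofNumbers, IPProtocol.count_alternating]
  · have h1 := coinBits_le hW hT hε hε1
    have h2 : 14 * logTerm W T ε ≤ C * logTerm W T ε :=
      mul_le_mul_of_nonneg_right (by linarith) (by linarith)
    rw [protocol, IPProtocol.ofNumbers]
    push_cast
    exact h1.trans h2

/-- The running time is linear in the number `N` of strings and polynomial in the bound `L` for the
other loops. -/
theorem exists_steps_le (c₀ : Bool) : ∃ C, ∀ L N, 1 ≤ L → 1 ≤ N →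
    RAM.preamble.cost L + (2 + (2 + (N * ((RAM.stringBody c₀).cost L + 3) + 1))) ≤
      C * N * L ^ C := by
  obtain ⟨C₁, h₁⟩ := RAM.preamble.exists_cost_le
  obtain ⟨C₂, h₂⟩ := (RAM.stringBody c₀).exists_cost_le
  refine ⟨C₁ + C₂ + 8, fun L N hL hN => ?_⟩
  set E := L ^ (C₁ + C₂ + 8) with hE
  have hE1 : 1 ≤ E := Nat.one_le_pow _ _ hL
  have a1 : RAM.preamble.cost L ≤ C₁ * E :=
    (h₁ L hL).trans (Nat.mul_le_mul_left _ (Nat.pow_le_pow_right hL (by omega)))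
  have a2 : (RAM.stringBody c₀).cost L ≤ C₂ * E :=
    (h₂ L hL).trans (Nat.mul_le_mul_left _ (Nat.pow_le_pow_right hL (by omega)))
  have a3 : C₁ * E ≤ N * (C₁ * E) := Nat.le_mul_of_pos_left _ hN
  have a4 : N * (RAM.stringBody c₀).cost L ≤ N * (C₂ * E) := Nat.mul_le_mul_left _ a2
  have a5 : N ≤ N * E := Nat.le_mul_of_pos_right _ hE1
  have e1 : N * ((RAM.stringBody c₀).cost L + 3) = N * (RAM.stringBody c₀).cost L + 3 * N := by ring
  have e2 : (C₁ + C₂ + 8) * N * E = N * (C₁ * E) + N * (C₂ * E) + 8 * (N * E) := by ring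
  omega

/-- The program computes the tensors.  Its values are at most `X`, the input size times the size of
the tensors, and its intermediate results at most `X ^ 8`. -/
theorem exists_computesTensors (c₀ : Bool) : ∃ C, 34000 ≤ C ∧ ∀ (W T h : ℕ), 2 ≤ W → 2 ≤ T →
    ∀ (P : BranchingProgram W T (h + h)) (ε : ℝ) (N : ℕ), 1 ≤ N → ∀ (A B : Fin N → Fin h → Bool),
      RAM.ComputesTensors (RAM.tensorProgram c₀).compile C P ε
        (tensorG P ⌈Real.logb 2 ε⁻¹⌉₊ c₀) (tensorH P ⌈Real.logb 2 ε⁻¹⌉₊) A B := by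
  obtain ⟨C₁, hC₁⟩ := exists_steps_le c₀
  refine ⟨C₁ + 34000, by omega, fun W T h hW hT P ε N hN A B => ?_⟩
  set k := ⌈Real.logb 2 ε⁻¹⌉₊ with hk
  set t := dims W T k with ht
  set L := 2 ^ t with hL
  set X := RAM.inputSize W T h N * L with hX
  have hL1 : 1 ≤ L := Nat.one_le_two_pow
  have hin : 5 ≤ RAM.inputSize W T h N := by simp only [RAM.inputSize]; omega
  have hinX : RAM.inputSize W T h N ≤ X := Nat.le_mul_of_pos_right _ hL1
  have hXL : 5 * L ≤ X := Nat.mul_le_mul_right _ hin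
  have hz := sizes W hT (k := k) (X := X) (by change 4 * L ≤ X; omega)
  have hdims : dims W T k = 2 * (rounds W T k + (coinBits W T k + 1)) := rfl
  have hcoins : coinBits W T k = k + 1 + Nat.clog 2 (3 * stepCount W T) := rfl
  have hSr : stepCount W T ≤ rounds W T k :=
    Nat.le_mul_of_pos_right _ (by simp only [roundsPerStep]; omega)
  have hS := le_stepCount (W := W) hT
  have hclog : ∀ i, Nat.clog 2 i ≤ t → i ≤ L := fun i hi =>
    (Nat.le_pow_clog (b := 2) (by norm_num) i).trans (Nat.pow_le_pow_right (by norm_num) hi)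
  have hw : nodeBits W = Nat.clog 2 W := rfl
  have hl : layerBits T = Nat.clog 2 T := rfl
  have hkX : k ≤ X := by
    have : t ≤ L := Nat.lt_two_pow_self.le
    omega
  have hNX : N ≤ X := by
    -- the program queries a variable, so the strings are not empty and their number is at most the
    -- size of the input
    have hh : 1 ≤ h := by
      have := (P.var ⟨0, by omega⟩).is_lt
      omega
    have hNh : N ≤ N * h := Nat.le_mul_of_pos_right _ hh
    simp only [RAM.inputSize] at hinX
    omega
  obtain ⟨s, steps, h1, h2, h3, h4⟩ := RAM.exists_exec_tensorProgram (P := P) (A := A) (B := B)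
    (k := k) (l := layerBits T) (w := nodeBits W) (m := coinBits W T k) (p := fieldSize W T k)
    (t := t) (L := L) rfl rfl rfl rfl rfl hz (hclog _ (by omega)) (hclog _ (by omega))
    (hclog (3 * stepCount W T) (by omega)) (by omega) hNX
    (inputState_bdd P A B hkX hinX hW hT hN) c₀
  refine ⟨s, steps, h1.mono ?_, ?_, h3, fun j c hc => ?_, fun j c hc => ?_⟩
  · have hle : X ≤ (C₁ + 34000) * RAM.inputSize W T h N * L := by
      rw [mul_assoc]
      exact Nat.le_mul_of_pos_left _ (by omega)
    exact (Nat.pow_le_pow_left hle 8).trans (Nat.pow_le_pow_right (by omega) (by omega))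
  · refine (h2.trans (hC₁ L N hL1 hN)).trans ?_
    exact Nat.mul_le_mul (Nat.mul_le_mul_right _ (by omega)) (Nat.pow_le_pow_right hL1 (by omega))
  · exact (h4 j c hc (Nat.zero_le _)).1.trans
      (congrArg Bool.toNat (tensorG_testBit P k c₀ (A j) hc).symm)
  · exact (h4 j c hc (Nat.zero_le _)).2.trans
      (congrArg Bool.toNat (tensorH_testBit P k (B j) hc).symm)

end Reduction

end TropicalSimilarity

open TropicalSimilarity

theorem mainTheorem10 :
    -- Gap-Max-TropSim
    (∃ (C : ℕ) (M : RAM.Prog), ∀ (W T h : ℕ), 2 ≤ W → 2 ≤ T →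
      ∀ (P : BranchingProgram W T (h + h)) (ε : ℝ), 0 < ε → ε ≤ 1 →
      ∃ (t : ℕ) (G H : (Fin h → Bool) → Tensor t)
        (R : IPProtocol (Fin h → Bool) (Fin h → Bool)),
        Even t ∧
        (2 : ℝ) ^ t ≤ (2 : ℝ) ^ (C * sizeExponent W T ε) ∧
        SimulatedProtocol R C W T ε (fun x y => P.Accepts (Fin.append x y)) G H ∧
        ∀ (N : ℕ), 1 ≤ N → ∀ (A B : Fin N → Fin h → Bool),
          RAM.ComputesTensors M C P ε G H A B ∧
          (BPSatisfyingPair P A B →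
            GapMaxComplete (fun i => G (A i)) (fun j => H (B j))) ∧
          (¬ BPSatisfyingPair P A B →
            GapMaxSound ε (fun i => G (A i)) (fun j => H (B j)))) ∧
    -- Gap-Min-TropSim
    (∃ (C : ℕ) (M : RAM.Prog), ∀ (W T h : ℕ), 2 ≤ W → 2 ≤ T →
      ∀ (P : BranchingProgram W T (h + h)) (ε : ℝ), 0 < ε → ε ≤ 1 →
      ∃ (t : ℕ) (G H : (Fin h → Bool) → Tensor t)
        (R : IPProtocol (Fin h → Bool) (Fin h → Bool)),
        Even t ∧
        (2 : ℝ) ^ t ≤ (2 : ℝ) ^ (C * sizeExponent W T ε) ∧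
        SimulatedProtocol R C W T ε (fun x y => ¬ P.Accepts (Fin.append x y)) G H ∧
        ∀ (N : ℕ), 1 ≤ N → ∀ (A B : Fin N → Fin h → Bool),
          RAM.ComputesTensors M C P ε G H A B ∧
          (BPSatisfyingPair P A B →
            GapMinComplete ε (fun i => G (A i)) (fun j => H (B j))) ∧
          (¬ BPSatisfyingPair P A B →
            GapMinSound (fun i => G (A i)) (fun j => H (B j)))) := by
  refine ⟨?_, ?_⟩
  · obtain ⟨C, hC, hM⟩ := exists_computesTensors true
    refine ⟨C, _, fun W T h hW hT P ε hε hε1 => ⟨_, tensorG P ⌈Real.logb 2 ε⁻¹⌉₊ true,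
      tensorH P ⌈Real.logb 2 ε⁻¹⌉₊, protocol P ⌈Real.logb 2 ε⁻¹⌉₊ true, even_two_mul _,
      two_pow_dims_le hC hW hT hε hε1, ?_, fun N hN A B => ⟨hM W T h hW hT P ε N hN A B, ?_, ?_⟩⟩⟩
    · simpa using simulatedProtocol P true hC hW hT hε hε1
    · rintro ⟨i, j, hA⟩
      exact ⟨i, j, (tropSim_gap P true hW hT hε _ _).1 (by simpa using hA)⟩
    · exact fun hA i j => (tropSim_gap P true hW hT hε _ _).2 fun hij =>
        hA ⟨i, j, by simpa using hij⟩
  · obtain ⟨C, hC, hM⟩ := exists_computesTensors false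
    refine ⟨C, _, fun W T h hW hT P ε hε hε1 => ⟨_, tensorG P ⌈Real.logb 2 ε⁻¹⌉₊ false,
      tensorH P ⌈Real.logb 2 ε⁻¹⌉₊, protocol P ⌈Real.logb 2 ε⁻¹⌉₊ false, even_two_mul _,
      two_pow_dims_le hC hW hT hε hε1, ?_, fun N hN A B => ⟨hM W T h hW hT P ε N hN A B, ?_, ?_⟩⟩⟩
    · simpa using simulatedProtocol P false hC hW hT hε hε1
    · rintro ⟨i, j, hA⟩
      exact ⟨i, j, (tropSim_gap P false hW hT hε _ _).2 (by simpa using hA)⟩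
    · exact fun hA i j => (tropSim_gap P false hW hT hε _ _).1
        (by simpa using fun hij => hA ⟨i, j, hij⟩)
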